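/- Let $\Omega\subset\mathbb{R}^3$ be a bounded domain with a Liapunov ($C^{1,\alpha}$, $0<\alpha\le 1$) boundary, let $\lambda\in\mathbb{C}$, $\lambda\neq 0$, and let $1<p<\infty$. Let $W^{p,\operatorname{div}}(\Omega)$ be the space of vector fields $\vec u\in L^p(\Omega;\mathbb{C}^3)$ whose weak divergence lies in $L^p(\Omega)$. Put $\theta(\vec x)=-\dfrac{e^{i\lambda|\vec x|}}{4\pi|\vec x|}$ and \[ \overrightarrow{T}_{2,\lambda}[\vec w](\vec x)=\int_\Omega\bigl[\lambda\,\theta(\vec x-\vec y)\,\vec w(\vec y)-(\operatorname{grad}\theta)(\vec x-\vec y)\times\vec w(\vec y)\bigr]\,d\vec y . \] Then the operator \[ R_\lambda=\frac1\lambda\bigl(I-\operatorname{curl}\overrightarrow{T}_{2,\lambda}\bigr), \] with $\operatorname{curl}$ understood in the weak sense, is a right inverse of $\operatorname{curl}+\lambda I$ on $W^{p,\operatorname{div}}(\Omega)$. That is, for every $\vec g\in W^{p,\operatorname{div}}(\Omega)$: the integral defining $\overrightarrow{T}_{2,\lambda}[\vec g](\vec x)$ converges absolutely for almost every $\vec x\in\Omega$;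 $\overrightarrow{T}_{2,\lambda}[\vec g]$ has a weak curl in $\Omega$ that is a locally integrable function; $R_\lambda\vec g$ belongs to $W^{p,\operatorname{div}}(\Omega)$ and has a weak curl that is a locally integrable function; and \[ (\operatorname{curl}+\lambda I)\,R_\lambda\vec g=\vec g\quad\text{almost everywhere in }\Omega . \] -/

import Mathlib

open MeasureTheory
open scoped ENNReal NNReal ContDiff

/-- Three-dimensional Euclidean space. -/
abbrev R3 : Type := EuclideanSpace ℝ (Fin 3)

/-- Complex three-vectors (the values of the vector fields). -/
abbrev C3 : Type := Fin 3 → ℂ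

/-- A bounded domain (nonempty, open, connected) of `ℝ³` with a Liapunov boundary: for some
`0 < α ≤ 1`, near each boundary point and in suitable Cartesian coordinates (given by the linear
isometry `A`), the domain is the region strictly above the graph of a `C^1` function of two
variables whose differential is Hölder continuous with exponent `α`. -/
structure IsBoundedLiapunovDomain (Ω : Set R3) : Prop where
  isOpen : IsOpen Ω
  isConnected : IsConnected Ω
  isBounded : Bornology.IsBounded Ω
  boundary : ∃ α : ℝ≥0, 0 < α ∧ α ≤ 1 ∧ ∀ x₀ ∈ frontier Ω,
    ∃ (A : R3 ≃ₗᵢ[ℝ] R3) (r : ℝ) (γ : EuclideanSpace ℝ (Fin 2) → ℝ) (C : ℝ≥0),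
      0 < r ∧ ContDiff ℝ 1 γ ∧ HolderWith C α (fderiv ℝ γ) ∧
      Ω ∩ Metric.ball x₀ r =
        {x | γ (!₂[(A x) 0, (A x) 1]) < (A x) 2} ∩ Metric.ball x₀ r

noncomputable section

/-- The classical gradient of a complex-valued function on `ℝ³`. -/
def grad3 (f : R3 → ℂ) (x : R3) : C3 :=
  fun i => fderiv ℝ f x (EuclideanSpace.single i (1 : ℝ))

/-- Complex-valued test functions: the space `C_c^∞(Ω)`. -/
def IsTestFunction (Ω : Set R3) (φ : R3 → ℂ) : Prop :=
  ContDiff ℝ ∞ φ ∧ HasCompactSupport φ ∧ tsupport φ ⊆ Ω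

/-- `v` is the weak curl of `u` in `Ω`:
`∫_Ω φ v = - ∫_Ω grad φ × u` for all test functions `φ`. -/
def HasWeakCurl (Ω : Set R3) (u v : R3 → C3) : Prop :=
  LocallyIntegrableOn u Ω ∧ LocallyIntegrableOn v Ω ∧
    ∀ φ : R3 → ℂ, IsTestFunction Ω φ →
      ∫ x in Ω, φ x • v x = -∫ x in Ω, crossProduct (grad3 φ x) (u x)

/-- `d` is the weak divergence of `u` in `Ω`:
`∫_Ω φ d = - ∫_Ω grad φ · u` for all test functions `φ`. -/
def HasWeakDiv (Ω : Set R3) (u : R3 → C3) (d : R3 → ℂ) : Prop :=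
  LocallyIntegrableOn u Ω ∧ LocallyIntegrableOn d Ω ∧
    ∀ φ : R3 → ℂ, IsTestFunction Ω φ →
      ∫ x in Ω, φ x * d x = -∫ x in Ω, ∑ i, grad3 φ x i * u x i

/-- The space `W^{p,div}(Ω)` of fields in `L^p(Ω)` with weak divergence in `L^p(Ω)`. -/
def MemWdiv (p : ℝ≥0∞) (Ω : Set R3) (u : R3 → C3) : Prop :=
  MemLp u p (volume.restrict Ω) ∧
    ∃ d : R3 → ℂ, MemLp d p (volume.restrict Ω) ∧ HasWeakDiv Ω u d

open Classical in
/-- The operator `curl` in the weak sense: the weak curl of `u` in `Ω` (determined up to equality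
almost everywhere in `Ω`), and the default value `0` if `u` has none. -/
def weakCurl (Ω : Set R3) (u : R3 → C3) : R3 → C3 :=
  if h : ∃ v, HasWeakCurl Ω u v then h.choose else 0

/-- The fundamental solution `θ(x) = - e^{iλ|x|} / (4π|x|)` of the Helmholtz operator `Δ + λ²`. -/
def helmholtzTheta (lam : ℂ) (x : R3) : ℂ :=
  -Complex.exp (Complex.I * lam * (‖x‖ : ℂ)) / (4 * (Real.pi : ℂ) * (‖x‖ : ℂ))

/-- The integrand `λ θ(x-y) w(y) - grad θ(x-y) × w(y)` of the operator `T_{2,λ}`. -/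
def teodorescuIntegrand (lam : ℂ) (w : R3 → C3) (x y : R3) : C3 :=
  (lam * helmholtzTheta lam (x - y)) • w y -
    crossProduct (grad3 (helmholtzTheta lam) (x - y)) (w y)

/-- The component operator `T_{2,λ}` of the `λ`-Teodorescu transform over `Ω`. -/
def teodorescuT2 (lam : ℂ) (Ω : Set R3) (w : R3 → C3) (x : R3) : C3 :=
  ∫ y in Ω, teodorescuIntegrand lam w x y

/-- The operator `R_λ = (1/λ) (I - curl T_{2,λ})`. -/
def rightInverseR (lam : ℂ) (Ω : Set R3) (g : R3 → C3) (x : R3) : C3 :=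
  lam⁻¹ • (g x - weakCurl Ω (teodorescuT2 lam Ω g) x)

end

/-!
Let `V` be the Helmholtz potential of `g` extended by zero. In the sense of distributions on `Ω`,
`curl T g = g - λ T g - grad div V`, so that `R g = T g + λ⁻¹ grad div V`. Since
`grad div V` is curl-free and a weak curl is divergence-free, everything reduces to
`grad div V ∈ L^p(Ω)`.

No theory of singular integrals is needed for this, because `div g ∈ L^p(Ω)`. Replace `∂_i θ(x - y)`
by a kernel in which `|x - y|` is regularised to `D(x, y) = √(|x - y|² + dist(y, Ωᶜ)²)`. The two
kernels agree for `y ∈ ∂Ω`, so the difference of the two potentials of a test function vanishes on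
`∂Ω`; it is Lipschitz, hence may be tested against the weak divergence of `g`. This leaves weakly
singular kernels acting on `div g` and a kernel of size `D⁻³` acting on `g`. Flattening the
boundary turns the latter into a Hilbert-type kernel on a half-space, which is bounded on `L^p` by
Schur's test.
-/

open Filter Topology

/-! ### The radial profile of the Helmholtz fundamental solution -/

/-- The radial profile `Θ(r) = -e^{iλr} / (4πr)` of the fundamental solution `θ`. -/
noncomputable def helmholtzProfile (lam : ℂ) (r : ℝ) : ℂ :=
  -Complex.exp (Complex.I * lam * (r : ℂ)) / (4 * (Real.pi : ℂ) * (r : ℂ))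

/-- The function `r⁻¹ Θ'(r)`, so that `grad θ(x) = (|x|⁻¹ Θ'(|x|)) x`. -/
noncomputable def helmholtzSlope (lam : ℂ) (r : ℝ) : ℂ :=
  Complex.exp (Complex.I * lam * (r : ℂ)) * (1 - Complex.I * lam * r) /
    (4 * (Real.pi : ℂ) * (r : ℂ) ^ 3)

/-- The derivative of `r⁻¹ Θ'(r)`. -/
noncomputable def helmholtzSlopeDeriv (lam : ℂ) (r : ℝ) : ℂ :=
  Complex.exp (Complex.I * lam * (r : ℂ)) * (lam ^ 2 * r ^ 2 + 3 * Complex.I * lam * r - 3) /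
    (4 * (Real.pi : ℂ) * (r : ℂ) ^ 4)

section Profile

variable (lam : ℂ) {r : ℝ}

lemma measurable_helmholtzProfile : Measurable (helmholtzProfile lam) := by
  unfold helmholtzProfile; fun_prop

lemma measurable_helmholtzSlope : Measurable (helmholtzSlope lam) := by
  unfold helmholtzSlope; fun_prop

lemma measurable_helmholtzSlopeDeriv : Measurable (helmholtzSlopeDeriv lam) := by
  unfold helmholtzSlopeDeriv; fun_prop

lemma hasDerivAt_exp_I_mul (r : ℝ) :
    HasDerivAt (fun r : ℝ => Complex.exp (Complex.I * lam * (r : ℂ)))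
      (Complex.exp (Complex.I * lam * (r : ℂ)) * (Complex.I * lam)) r := by
  have h : HasDerivAt (fun r : ℝ => Complex.I * lam * (r : ℂ)) (Complex.I * lam) r := by
    simpa using (Complex.ofRealCLM.hasDerivAt (x := r)).const_mul (Complex.I * lam)
  exact h.cexp

lemma hasDerivAt_helmholtzProfile (hr : r ≠ 0) :
    HasDerivAt (helmholtzProfile lam) (r * helmholtzSlope lam r) r := by
  have hr' : (r : ℂ) ≠ 0 := by exact_mod_cast hr
  have hpi : (Real.pi : ℂ) ≠ 0 := by simp [Real.pi_ne_zero]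
  have hden : HasDerivAt (fun r : ℝ => 4 * (Real.pi : ℂ) * (r : ℂ)) (4 * (Real.pi : ℂ)) r := by
    simpa using (Complex.ofRealCLM.hasDerivAt (x := r)).const_mul (4 * (Real.pi : ℂ))
  convert! (hasDerivAt_exp_I_mul lam r).neg.div hden (by simp [hr', hpi]) using 1
  simp only [helmholtzSlope, Pi.neg_apply]
  field_simp
  ring

lemma hasDerivAt_helmholtzSlope (hr : r ≠ 0) :
    HasDerivAt (helmholtzSlope lam) (helmholtzSlopeDeriv lam r) r := by
  have hr' : (r : ℂ) ≠ 0 := by exact_mod_cast hr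
  have hpi : (Real.pi : ℂ) ≠ 0 := by simp [Real.pi_ne_zero]
  have hid : HasDerivAt (fun r : ℝ => (r : ℂ)) 1 r := Complex.ofRealCLM.hasDerivAt (x := r)
  have hden : HasDerivAt (fun r : ℝ => 4 * (Real.pi : ℂ) * (r : ℂ) ^ 3)
      (4 * (Real.pi : ℂ) * (3 * (r : ℂ) ^ 2)) r := by
    simpa using (hid.pow 3).const_mul (4 * (Real.pi : ℂ))
  have hlin : HasDerivAt (fun r : ℝ => 1 - Complex.I * lam * (r : ℂ)) (-(Complex.I * lam)) r := by
    simpa using (hid.const_mul (Complex.I * lam)).const_sub 1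
  convert! ((hasDerivAt_exp_I_mul lam r).mul hlin).div hden (by simp [hr', hpi]) using 1
  simp only [helmholtzSlopeDeriv, Pi.mul_apply]
  field_simp
  ring_nf
  simp only [Complex.I_sq]
  ring

/-- The profile of `ε⁻² ρ⁵ (Δ + λ²) Θ(ρ)`, where `ρ = √(|z|² + ε²)`. -/
noncomputable def helmholtzDefect (lam : ℂ) (r : ℝ) : ℂ :=
  Complex.exp (Complex.I * lam * (r : ℂ)) * (3 - 3 * Complex.I * lam * r - lam ^ 2 * r ^ 2) /
    (4 * (Real.pi : ℂ))

lemma continuous_helmholtzDefect : Continuous (helmholtzDefect lam) := by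
  unfold helmholtzDefect; fun_prop

lemma helmholtzProfile_equation (hr : r ≠ 0) (ε : ℂ) :
    3 * helmholtzSlope lam r + (r ^ 2 - ε ^ 2) * ((r : ℂ)⁻¹ * helmholtzSlopeDeriv lam r) +
      lam ^ 2 * helmholtzProfile lam r = ε ^ 2 * helmholtzDefect lam r / r ^ 5 := by
  have hr' : (r : ℂ) ≠ 0 := by exact_mod_cast hr
  have hpi : (Real.pi : ℂ) ≠ 0 := by simp [Real.pi_ne_zero]
  simp only [helmholtzSlope, helmholtzSlopeDeriv, helmholtzProfile, helmholtzDefect]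
  field_simp
  ring

lemma exists_norm_le_div_pow {k f : ℝ → ℂ} {n : ℕ} (hf : Continuous f)
    (hk : ∀ r : ℝ, k r = f r / (r : ℂ) ^ n) (R : ℝ) :
    ∃ C : ℝ, 0 < C ∧ ∀ r : ℝ, 0 < r → r ≤ R → ‖k r‖ ≤ C / r ^ n := by
  obtain ⟨C, hC⟩ :=
    (isCompact_Icc (a := 0) (b := R)).exists_bound_of_continuousOn hf.continuousOn
  refine ⟨|C| + 1, by positivity, fun r hr hrR => ?_⟩
  rw [hk, norm_div, norm_pow, Complex.norm_of_nonneg hr.le]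
  gcongr
  linarith [hC r ⟨hr.le, hrR⟩, le_abs_self C]

lemma exists_norm_helmholtzProfile_le (R : ℝ) :
    ∃ C : ℝ, 0 < C ∧ ∀ r : ℝ, 0 < r → r ≤ R → ‖helmholtzProfile lam r‖ ≤ C / r ^ 1 :=
  exists_norm_le_div_pow (f := fun r => -Complex.exp (Complex.I * lam * r) / (4 * Real.pi))
    (by fun_prop) (fun r => by rw [helmholtzProfile, div_div, pow_one]) R

lemma exists_norm_helmholtzSlope_le (R : ℝ) :
    ∃ C : ℝ, 0 < C ∧ ∀ r : ℝ, 0 < r → r ≤ R → ‖helmholtzSlope lam r‖ ≤ C / r ^ 3 :=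
  exists_norm_le_div_pow
    (f := fun r => Complex.exp (Complex.I * lam * r) * (1 - Complex.I * lam * r) / (4 * Real.pi))
    (by fun_prop) (fun r => by rw [helmholtzSlope, div_div]) R

lemma exists_norm_helmholtzSlopeDeriv_le (R : ℝ) :
    ∃ C : ℝ, 0 < C ∧ ∀ r : ℝ, 0 < r → r ≤ R → ‖helmholtzSlopeDeriv lam r‖ ≤ C / r ^ 4 :=
  exists_norm_le_div_pow
    (f := fun r => Complex.exp (Complex.I * lam * r) *
      (lam ^ 2 * r ^ 2 + 3 * Complex.I * lam * r - 3) / (4 * Real.pi))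
    (by fun_prop) (fun r => by rw [helmholtzSlopeDeriv, div_div]) R

end Profile

/-! ### The regularised norm -/

/-- The regularised norm `√(‖z‖² + ε²)`, which is smooth for `ε ≠ 0`. -/
noncomputable def regNorm {E : Type*} [NormedAddCommGroup E] (ε : ℝ) (z : E) : ℝ :=
  √(‖z‖ ^ 2 + ε ^ 2)

section RegNorm

variable {E : Type*} [NormedAddCommGroup E] (ε : ℝ) (z : E)

@[simp]
lemma regNorm_zero : regNorm 0 z = ‖z‖ := by simp [regNorm]

lemma regNorm_nonneg : 0 ≤ regNorm ε z := Real.sqrt_nonneg _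

lemma regNorm_sq : regNorm ε z ^ 2 = ‖z‖ ^ 2 + ε ^ 2 :=
  Real.sq_sqrt (by positivity)

lemma regNorm_eq_norm_complex : regNorm ε z = ‖(⟨‖z‖, ε⟩ : ℂ)‖ := by
  rw [Complex.norm_def, Complex.normSq_mk, regNorm, sq, sq]

lemma norm_le_regNorm : ‖z‖ ≤ regNorm ε z := by
  simpa [regNorm_eq_norm_complex] using Complex.abs_re_le_norm (⟨‖z‖, ε⟩ : ℂ)

lemma abs_le_regNorm : |ε| ≤ regNorm ε z := by
  simpa [regNorm_eq_norm_complex] using Complex.abs_im_le_norm (⟨‖z‖, ε⟩ : ℂ)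

lemma regNorm_le : regNorm ε z ≤ ‖z‖ + |ε| := by
  simpa [regNorm_eq_norm_complex] using Complex.norm_le_abs_re_add_abs_im (⟨‖z‖, ε⟩ : ℂ)

lemma abs_regNorm_sub_le (δ : ℝ) (w : E) :
    |regNorm ε z - regNorm δ w| ≤ ‖z - w‖ + |ε - δ| := by
  rw [regNorm_eq_norm_complex, regNorm_eq_norm_complex]
  calc |‖(⟨‖z‖, ε⟩ : ℂ)‖ - ‖(⟨‖w‖, δ⟩ : ℂ)‖| ≤ |‖z‖ - ‖w‖| + |ε - δ| :=
        (abs_norm_sub_norm_le _ _).trans (Complex.norm_le_abs_re_add_abs_im _)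
    _ ≤ ‖z - w‖ + |ε - δ| := by gcongr; exact abs_norm_sub_norm_le z w

variable {ε z}

lemma regNorm_pos_of_ne_zero_left (hε : ε ≠ 0) (z : E) : 0 < regNorm ε z :=
  (abs_pos.2 hε).trans_le (abs_le_regNorm ε z)

lemma regNorm_pos_of_ne_zero_right (ε : ℝ) (hz : z ≠ 0) : 0 < regNorm ε z :=
  (norm_pos_iff.2 hz).trans_le (norm_le_regNorm ε z)

lemma regNorm_smul [NormedSpace ℝ E] (hε : 0 ≤ ε) (z : E) :
    regNorm ε (ε • z) = ε * regNorm 1 z := by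
  rw [regNorm, regNorm, norm_smul, Real.norm_eq_abs, abs_of_nonneg hε,
    show (ε * ‖z‖) ^ 2 + ε ^ 2 = ε ^ 2 * (‖z‖ ^ 2 + 1 ^ 2) by ring, Real.sqrt_mul (by positivity),
    Real.sqrt_sq hε]

@[fun_prop]
lemma continuous_regNorm {X : Type*} [TopologicalSpace X] {f : X → ℝ} {g : X → E}
    (hf : Continuous f) (hg : Continuous g) : Continuous fun x => regNorm (f x) (g x) :=
  ((hg.norm.pow 2).add (hf.pow 2)).sqrt

end RegNorm

lemma hasFDerivAt_regNorm {E F : Type*} [NormedAddCommGroup E] [NormedSpace ℝ E]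
    [NormedAddCommGroup F] [InnerProductSpace ℝ F]
    {f : E → ℝ} {g : E → F} {f' : E →L[ℝ] ℝ} {g' : E →L[ℝ] F} {x : E}
    (hf : HasFDerivAt f f' x) (hg : HasFDerivAt g g' x) (h : 0 < regNorm (f x) (g x)) :
    HasFDerivAt (fun x => regNorm (f x) (g x))
      ((regNorm (f x) (g x))⁻¹ • ((innerSL ℝ (g x)).comp g' + f x • f')) x := by
  have hsq : ‖g x‖ ^ 2 + f x ^ 2 ≠ 0 := by
    rw [← regNorm_sq]; positivity
  convert! (hg.norm_sq.add (hf.pow 2)).sqrt hsq using 1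
  ext v
  have hD : √(‖g x‖ ^ 2 + f x ^ 2) ≠ 0 := h.ne'
  simp only [regNorm, Pi.add_apply, _root_.smul_apply, _root_.add_apply,
    ContinuousLinearMap.comp_apply, coe_innerSL_apply, smul_eq_mul, nsmul_eq_mul]
  field_simp
  push_cast
  ring

/-! ### Classical gradients and integration by parts -/

section Grad3

variable {φ ψ : R3 → ℂ} {x : R3}

lemma contDiff_grad3 {m n : WithTop ℕ∞} (h : ContDiff ℝ n φ) (hmn : m + 1 ≤ n) (i : Fin 3) :
    ContDiff ℝ m fun x => grad3 φ x i :=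
  (h.fderiv_right hmn).clm_apply contDiff_const

lemma continuous_grad3 (h : ContDiff ℝ 1 φ) (i : Fin 3) : Continuous fun x => grad3 φ x i :=
  (contDiff_grad3 (m := 0) h (by simp) i).continuous

lemma hasCompactSupport_grad3 (h : HasCompactSupport φ) (i : Fin 3) :
    HasCompactSupport fun x => grad3 φ x i :=
  h.fderiv_apply (𝕜 := ℝ) _

lemma IsTestFunction.grad3 {Ω : Set R3} (h : IsTestFunction Ω φ) (i : Fin 3) :
    IsTestFunction Ω fun x => grad3 φ x i :=
  ⟨contDiff_grad3 h.1 (by simp) i, hasCompactSupport_grad3 h.2.1 i,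
    (tsupport_fderiv_apply_subset ℝ _).trans h.2.2⟩

lemma grad3_add (hφ : DifferentiableAt ℝ φ x) (hψ : DifferentiableAt ℝ ψ x) (i : Fin 3) :
    grad3 (fun x => φ x + ψ x) x i = grad3 φ x i + grad3 ψ x i := by
  rw [grad3, fderiv_fun_add hφ hψ]
  rfl

lemma grad3_comp_add (φ : R3 → ℂ) (x y : R3) (i : Fin 3) :
    grad3 (fun z => φ (z + y)) x i = grad3 φ (x + y) i := by
  rw [grad3, grad3, fderiv_comp_add_right]

lemma grad3_grad3_comm (h : ContDiff ℝ 2 φ) (i j : Fin 3) (x : R3) :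
    grad3 (fun x => grad3 φ x i) x j = grad3 (fun x => grad3 φ x j) x i := by
  have hd : DifferentiableAt ℝ (fderiv ℝ φ) x :=
    (h.fderiv_right (m := 1) (by norm_num)).differentiable (by simp) x
  have key (a b : Fin 3) : grad3 (fun x => grad3 φ x a) x b =
      fderiv ℝ (fderiv ℝ φ) x (EuclideanSpace.single b 1) (EuclideanSpace.single a 1) := by
    simp only [grad3]
    rw [fderiv_clm_apply hd (differentiableAt_const _)]
    simp
  rw [key, key]
  exact h.contDiffAt.isSymmSndFDerivAt (by simp) _ _

lemma integral_grad3_mul (hφ : ContDiff ℝ 1 φ) (hφc : HasCompactSupport φ) (hψ : ContDiff ℝ 1 ψ)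
    (i : Fin 3) : ∫ z, grad3 φ z i * ψ z = -∫ z, φ z * grad3 ψ z i := by
  have h := integral_mul_fderiv_eq_neg_fderiv_mul_of_integrable (μ := (volume : Measure R3))
    (f := φ) (g := ψ) (v := EuclideanSpace.single i (1 : ℝ))
    (((continuous_grad3 hφ i).mul hψ.continuous).integrable_of_hasCompactSupport
      (hasCompactSupport_grad3 hφc i).mul_right)
    ((hφ.continuous.mul (continuous_grad3 hψ i)).integrable_of_hasCompactSupport hφc.mul_right)
    ((hφ.continuous.mul hψ.continuous).integrable_of_hasCompactSupport hφc.mul_right)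
    (fun x _ => (hφ.differentiable (by simp)).differentiableAt)
    (fun x _ => (hψ.differentiable (by simp)).differentiableAt)
  simp only [grad3]
  rw [h, neg_neg]

end Grad3

/-- The Helmholtz operator `Δ + λ²`. -/
noncomputable def helmholtzOp (lam : ℂ) (χ : R3 → ℂ) (z : R3) : ℂ :=
  ∑ i, grad3 (fun x => grad3 χ x i) z i + lam ^ 2 * χ z

section HelmholtzOp

variable (lam : ℂ) {χ ψ : R3 → ℂ}

lemma helmholtzOp_comp_add (χ : R3 → ℂ) (x y : R3) :
    helmholtzOp lam (fun z => χ (z + y)) x = helmholtzOp lam χ (x + y) := by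
  simp only [helmholtzOp, grad3_comp_add χ _ y]
  congr 1
  exact Finset.sum_congr rfl fun i _ => grad3_comp_add (fun x => grad3 χ x i) x y i

lemma continuous_helmholtzOp (hχ : ContDiff ℝ 2 χ) : Continuous (helmholtzOp lam χ) :=
  (continuous_finsetSum _ fun i _ =>
    continuous_grad3 (contDiff_grad3 hχ (by norm_num) i) i).add (continuous_const.mul hχ.continuous)

lemma hasCompactSupport_helmholtzOp (hχ : HasCompactSupport χ) :
    HasCompactSupport (helmholtzOp lam χ) := by
  have h (i : Fin 3) : HasCompactSupport fun z => grad3 (fun x => grad3 χ x i) z i :=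
    hasCompactSupport_grad3 (hasCompactSupport_grad3 hχ i) i
  unfold helmholtzOp
  simp only [Fin.sum_univ_three]
  exact (((h 0).add (h 1)).add (h 2)).add hχ.mul_left

lemma integral_helmholtzOp_mul (hχ : ContDiff ℝ 2 χ) (hχc : HasCompactSupport χ)
    (hψ : ContDiff ℝ 2 ψ) :
    ∫ z, helmholtzOp lam χ z * ψ z = ∫ z, χ z * helmholtzOp lam ψ z := by
  have hχ₁ (i : Fin 3) := contDiff_grad3 (m := 1) hχ (by norm_num) i
  have hψ₁ (i : Fin 3) := contDiff_grad3 (m := 1) hψ (by norm_num) i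
  have hχc₁ (i : Fin 3) := hasCompactSupport_grad3 hχc i
  have parts (i : Fin 3) : ∫ z, grad3 (fun x => grad3 χ x i) z i * ψ z =
      ∫ z, χ z * grad3 (fun x => grad3 ψ x i) z i := by
    rw [integral_grad3_mul (hχ₁ i) (hχc₁ i) (hψ.of_le (by norm_num)),
      integral_grad3_mul (hχ.of_le (by norm_num)) hχc (hψ₁ i), neg_neg]
  have intχ (i : Fin 3) : Integrable fun z => grad3 (fun x => grad3 χ x i) z i * ψ z :=
    ((continuous_grad3 (hχ₁ i) i).mul hψ.continuous).integrable_of_hasCompactSupport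
      (hasCompactSupport_grad3 (hχc₁ i) i).mul_right
  have intψ (i : Fin 3) : Integrable fun z => χ z * grad3 (fun x => grad3 ψ x i) z i :=
    (hχ.continuous.mul (continuous_grad3 (hψ₁ i) i)).integrable_of_hasCompactSupport hχc.mul_right
  have int₀ : Integrable fun z => lam ^ 2 * (χ z * ψ z) :=
    ((hχ.continuous.mul hψ.continuous).integrable_of_hasCompactSupport hχc.mul_right).const_mul _
  simp only [helmholtzOp, add_mul, mul_add, Finset.sum_mul, Finset.mul_sum, mul_assoc,
    mul_left_comm _ (lam ^ 2)]
  rw [integral_add (integrable_finsetSum _ fun i _ => intχ i) int₀,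
    integral_add (integrable_finsetSum _ fun i _ => intψ i) int₀,
    integral_finsetSum _ fun i _ => intχ i, integral_finsetSum _ fun i _ => intψ i]
  simp only [parts]

end HelmholtzOp

/-! ### The regularised fundamental solution -/

/-- The regularisation `Θ(√(|z|² + ε²))` of the fundamental solution `θ(z) = Θ(|z|)`. -/
noncomputable def regTheta (lam : ℂ) (ε : ℝ) (z : R3) : ℂ := helmholtzProfile lam (regNorm ε z)

/-- The partial derivatives of `regTheta lam ε`, with junk value `0` at `z = 0` if `ε = 0`. -/
noncomputable def regThetaGrad (lam : ℂ) (i : Fin 3) (ε : ℝ) (z : R3) : ℂ :=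
  (z i : ℂ) * helmholtzSlope lam (regNorm ε z)

section RegTheta

variable (lam : ℂ)

lemma helmholtzTheta_eq : helmholtzTheta lam = regTheta lam 0 := by
  ext z
  simp [helmholtzTheta, regTheta, helmholtzProfile]

lemma measurable_regTheta (ε : ℝ) : Measurable (regTheta lam ε) :=
  (measurable_helmholtzProfile lam).comp (by fun_prop)

lemma measurable_regThetaGrad (i : Fin 3) (ε : ℝ) : Measurable (regThetaGrad lam i ε) := by
  have hz : Measurable fun z : R3 => (z i : ℂ) := by fun_prop
  exact hz.mul ((measurable_helmholtzSlope lam).comp (by fun_prop))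

section Derivatives

variable {E : Type*} [NormedAddCommGroup E] [NormedSpace ℝ E] {f : E → ℝ} {g : E → R3}
  {f' : E →L[ℝ] ℝ} {g' : E →L[ℝ] R3} {x : E}

lemma hasFDerivAt_regTheta (hf : HasFDerivAt f f' x) (hg : HasFDerivAt g g' x)
    (h : 0 < regNorm (f x) (g x)) :
    HasFDerivAt (fun x => regTheta lam (f x) (g x))
      (helmholtzSlope lam (regNorm (f x) (g x)) •
        Complex.ofRealCLM.comp ((innerSL ℝ (g x)).comp g' + f x • f')) x := by
  convert! (hasDerivAt_helmholtzProfile lam h.ne').hasFDerivAt.comp x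
    (hasFDerivAt_regNorm hf hg h) using 1
  ext v
  have hD : (regNorm (f x) (g x) : ℂ) ≠ 0 := by exact_mod_cast h.ne'
  simp
  field_simp

lemma hasFDerivAt_regThetaGrad (i : Fin 3) (hf : HasFDerivAt f f' x) (hg : HasFDerivAt g g' x)
    (h : 0 < regNorm (f x) (g x)) :
    HasFDerivAt (fun x => regThetaGrad lam i (f x) (g x))
      (helmholtzSlope lam (regNorm (f x) (g x)) •
          Complex.ofRealCLM.comp ((EuclideanSpace.proj i : R3 →L[ℝ] ℝ).comp g') +
        ((g x i : ℂ) * ((regNorm (f x) (g x) : ℂ)⁻¹ *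
          helmholtzSlopeDeriv lam (regNorm (f x) (g x)))) •
          Complex.ofRealCLM.comp ((innerSL ℝ (g x)).comp g' + f x • f')) x := by
  have hcoord : HasFDerivAt (fun x => (g x i : ℂ))
      (Complex.ofRealCLM.comp ((EuclideanSpace.proj i : R3 →L[ℝ] ℝ).comp g')) x :=
    ((Complex.ofRealCLM.comp (EuclideanSpace.proj i : R3 →L[ℝ] ℝ)).hasFDerivAt (x := g x)).comp x hg
  convert! hcoord.mul ((hasDerivAt_helmholtzSlope lam h.ne').hasFDerivAt.comp x
    (hasFDerivAt_regNorm hf hg h)) using 1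
  ext v
  simp
  ring

end Derivatives

variable {ε : ℝ} {z : R3}

lemma grad3_regTheta (h : 0 < regNorm ε z) (i : Fin 3) :
    grad3 (regTheta lam ε) z i = regThetaGrad lam i ε z := by
  have hd := hasFDerivAt_regTheta lam (hasFDerivAt_const ε z) (hasFDerivAt_id z) h
  rw [grad3, show regTheta lam ε = fun z => regTheta lam ε (id z) from rfl, hd.fderiv]
  simp [regThetaGrad, EuclideanSpace.inner_single_right]
  ring

lemma grad3_regThetaGrad (h : 0 < regNorm ε z) (i : Fin 3) :
    grad3 (regThetaGrad lam i ε) z i = helmholtzSlope lam (regNorm ε z) +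
      (z i : ℂ) ^ 2 * ((regNorm ε z : ℂ)⁻¹ * helmholtzSlopeDeriv lam (regNorm ε z)) := by
  have hd := hasFDerivAt_regThetaGrad lam i (hasFDerivAt_const ε z) (hasFDerivAt_id z) h
  rw [grad3, show regThetaGrad lam i ε = fun z => regThetaGrad lam i ε (id z) from rfl, hd.fderiv]
  simp [EuclideanSpace.inner_single_right]
  ring

lemma grad3_helmholtzTheta (hz : z ≠ 0) (i : Fin 3) :
    grad3 (helmholtzTheta lam) z i = regThetaGrad lam i 0 z := by
  rw [helmholtzTheta_eq, grad3_regTheta lam (regNorm_pos_of_ne_zero_right 0 hz)]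

lemma contDiff_regTheta (hε : ε ≠ 0) : ContDiff ℝ ∞ (regTheta lam ε) := by
  have hreg : ContDiff ℝ ∞ fun z : R3 => (regNorm ε z : ℂ) :=
    Complex.ofRealCLM.contDiff.comp
      (((contDiff_norm_sq ℝ).add contDiff_const).sqrt fun z => by positivity)
  have hden : ContDiff ℝ ∞ fun z : R3 => 4 * (Real.pi : ℂ) * (regNorm ε z : ℂ) :=
    contDiff_const.mul hreg
  have heq : regTheta lam ε = fun z => -Complex.exp (Complex.I * lam * (regNorm ε z : ℂ)) *
      (4 * (Real.pi : ℂ) * (regNorm ε z : ℂ))⁻¹ := funext fun z => div_eq_mul_inv _ _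
  rw [heq]
  refine (ContDiff.cexp (contDiff_const.mul hreg)).neg.mul (hden.inv fun z => ?_)
  simpa [Real.pi_ne_zero] using (regNorm_pos_of_ne_zero_left hε z).ne'

lemma helmholtzOp_regTheta (hε : ε ≠ 0) (z : R3) : helmholtzOp lam (regTheta lam ε) z =
    (ε : ℂ) ^ 2 * helmholtzDefect lam (regNorm ε z) / (regNorm ε z : ℂ) ^ 5 := by
  have hpos := regNorm_pos_of_ne_zero_left (E := R3) hε
  have hsq : ∑ i, (z i : ℂ) ^ 2 = (regNorm ε z : ℂ) ^ 2 - (ε : ℂ) ^ 2 := by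
    have : ∑ i, z i ^ 2 = regNorm ε z ^ 2 - ε ^ 2 := by
      rw [regNorm_sq, EuclideanSpace.real_norm_sq_eq, add_sub_cancel_right]
    exact_mod_cast this
  simp only [helmholtzOp, grad3_regTheta lam (hpos _)]
  simp only [grad3_regThetaGrad lam (hpos _)]
  rw [Finset.sum_add_distrib, ← Finset.sum_mul, hsq, Finset.sum_const, Finset.card_univ,
    Fintype.card_fin, nsmul_eq_mul, ← helmholtzProfile_equation lam (hpos z).ne']
  rfl

lemma exists_norm_regTheta_le (R : ℝ) : ∃ C : ℝ, ∀ ε : ℝ, ∀ z : R3, z ≠ 0 → regNorm ε z ≤ R →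
    ‖regTheta lam ε z‖ ≤ C / ‖z‖ ^ 2 := by
  obtain ⟨C, hC, h⟩ := exists_norm_helmholtzProfile_le lam R
  refine ⟨C * R, fun ε z hz hR => ?_⟩
  have hz' : 0 < ‖z‖ := norm_pos_iff.2 hz
  have hle := norm_le_regNorm ε z
  calc ‖regTheta lam ε z‖ ≤ C / regNorm ε z ^ 1 := h _ (hz'.trans_le hle) hR
    _ ≤ C / ‖z‖ ^ 1 := by gcongr
    _ = C * ‖z‖ / ‖z‖ ^ 2 := by field_simp
    _ ≤ C * R / ‖z‖ ^ 2 := by gcongr; exact hle.trans hR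

lemma exists_norm_regThetaGrad_le (i : Fin 3) (R : ℝ) :
    ∃ C : ℝ, ∀ ε : ℝ, ∀ z : R3, z ≠ 0 → regNorm ε z ≤ R →
      ‖regThetaGrad lam i ε z‖ ≤ C / ‖z‖ ^ 2 := by
  obtain ⟨C, hC, h⟩ := exists_norm_helmholtzSlope_le lam R
  refine ⟨C, fun ε z hz hR => ?_⟩
  have hz' : 0 < ‖z‖ := norm_pos_iff.2 hz
  have hle := norm_le_regNorm ε z
  have hpos : 0 < regNorm ε z := hz'.trans_le hle
  calc ‖regThetaGrad lam i ε z‖ = ‖z i‖ * ‖helmholtzSlope lam (regNorm ε z)‖ := by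
        rw [regThetaGrad, norm_mul, Complex.norm_real]
    _ ≤ regNorm ε z * (C / regNorm ε z ^ 3) := by
        gcongr
        exacts [(PiLp.norm_apply_le z i).trans hle, h _ hpos hR]
    _ = C / regNorm ε z ^ 2 := by field_simp
    _ ≤ C / ‖z‖ ^ 2 := by gcongr

lemma tendsto_regTheta (hz : z ≠ 0) :
    Tendsto (fun ε => regTheta lam ε z) (𝓝 0) (𝓝 (regTheta lam 0 z)) :=
  (hasDerivAt_helmholtzProfile lam (regNorm_pos_of_ne_zero_right 0 hz).ne').continuousAt.comp
    (f := fun ε => regNorm ε z) (by fun_prop)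

lemma tendsto_regThetaGrad (i : Fin 3) (hz : z ≠ 0) :
    Tendsto (fun ε => regThetaGrad lam i ε z) (𝓝 0) (𝓝 (regThetaGrad lam i 0 z)) :=
  ((hasDerivAt_helmholtzSlope lam (regNorm_pos_of_ne_zero_right 0 hz).ne').continuousAt.comp
    (f := fun ε => regNorm ε z) (by fun_prop)).tendsto.const_mul _

end RegTheta

section WeaklySingular

lemma locallyIntegrable_inv_norm_sq : LocallyIntegrable fun z : R3 => (‖z‖ ^ 2)⁻¹ := by
  refine locallyIntegrable_of_norm_le_rpow (C := 1) (α := 2) (by simp) (by simp; norm_num)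
    (Eventually.of_forall fun z => ?_) (by fun_prop)
  rw [one_mul, Real.rpow_neg (norm_nonneg z), Real.rpow_two, Real.norm_of_nonneg (by positivity)]

lemma locallyIntegrable_of_norm_le_div_norm_sq {k : R3 → ℂ} (hk : Measurable k)
    (h : ∀ R, ∃ C, ∀ z, z ≠ 0 → ‖z‖ ≤ R → ‖k z‖ ≤ C / ‖z‖ ^ 2) : LocallyIntegrable k := by
  intro x
  obtain ⟨C, hC⟩ := h (‖x‖ + 1)
  refine ⟨Metric.closedBall 0 (‖x‖ + 1), Metric.closedBall_mem_nhds_of_mem (by simp), ?_⟩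
  refine ((locallyIntegrable_inv_norm_sq.integrableOn_isCompact
    (isCompact_closedBall 0 _)).const_mul C).mono' hk.aestronglyMeasurable ?_
  rw [ae_restrict_iff' measurableSet_closedBall]
  filter_upwards [Measure.ae_ne volume 0] with z hz hzR
  exact (hC z hz (by simpa using hzR)).trans_eq (div_eq_mul_inv _ _)

lemma integrable_mul_comp_sub {k χ : R3 → ℂ} (hk : LocallyIntegrable k) (hχ : Continuous χ)
    (hχc : HasCompactSupport χ) (y : R3) : Integrable fun x => χ x * k (x - y) := by
  have h := hk.integrable_smul_left_of_hasCompactSupport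
    (hχ.comp (continuous_add_const y)) (hχc.comp_homeomorph (Homeomorph.addRight y))
  simpa using h.comp_sub_right y

lemma locallyIntegrable_regTheta_zero (lam : ℂ) : LocallyIntegrable (regTheta lam 0) :=
  locallyIntegrable_of_norm_le_div_norm_sq (measurable_regTheta lam 0) fun R =>
    (exists_norm_regTheta_le lam R).imp fun _ h z hz hzR => h 0 z hz (by simpa using hzR)

lemma locallyIntegrable_regThetaGrad (lam : ℂ) (i : Fin 3) (ε : ℝ) :
    LocallyIntegrable (regThetaGrad lam i ε) :=
  locallyIntegrable_of_norm_le_div_norm_sq (measurable_regThetaGrad lam i ε) fun R =>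
    (exists_norm_regThetaGrad_le lam i (R + |ε|)).imp fun _ h z hz hzR =>
      h ε z hz ((regNorm_le ε z).trans (by gcongr))

lemma tendsto_integral_mul_of_norm_le_div_norm_sq {ψ : R3 → ℂ} (hψ : Continuous ψ)
    (hψc : HasCompactSupport ψ) {k : ℝ → R3 → ℂ} (hk : ∀ ε, Measurable (k ε))
    (hbound : ∀ R, ∃ C, ∀ ε z, z ≠ 0 → regNorm ε z ≤ R → ‖k ε z‖ ≤ C / ‖z‖ ^ 2)
    (hlim : ∀ z, z ≠ 0 → Tendsto (fun ε => k ε z) (𝓝 0) (𝓝 (k 0 z))) :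
    Tendsto (fun ε => ∫ z, ψ z * k ε z) (𝓝 0) (𝓝 (∫ z, ψ z * k 0 z)) := by
  obtain ⟨R, hR⟩ := hψc.isCompact.isBounded.subset_closedBall 0
  obtain ⟨C, hC⟩ := hbound (R + 1)
  have hdom : Integrable fun z => ‖ψ z‖ * (C * (‖z‖ ^ 2)⁻¹) :=
    (locallyIntegrable_inv_norm_sq.smul C).integrable_smul_left_of_hasCompactSupport hψ.norm
      hψc.norm
  refine tendsto_integral_filter_of_dominated_convergence _
    (Eventually.of_forall fun ε => (hψ.measurable.mul (hk ε)).aestronglyMeasurable) ?_ hdom ?_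
  · filter_upwards [Metric.closedBall_mem_nhds (0 : ℝ) one_pos] with ε hε
    filter_upwards [Measure.ae_ne volume 0] with z hz
    rw [norm_mul]
    by_cases hzR : z ∈ tsupport ψ
    · gcongr
      refine (hC ε z hz ((regNorm_le ε z).trans (add_le_add ?_ ?_))).trans_eq (div_eq_mul_inv _ _)
      exacts [by simpa using hR hzR, by simpa using hε]
    · simp [image_eq_zero_of_notMem_tsupport hzR]
  · filter_upwards [Measure.ae_ne volume 0] with z hz
    exact (hlim z hz).const_mul _

lemma tendsto_integral_mul_regTheta (lam : ℂ) {ψ : R3 → ℂ} (hψ : Continuous ψ)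
    (hψc : HasCompactSupport ψ) : Tendsto (fun ε => ∫ z, ψ z * regTheta lam ε z) (𝓝 0)
      (𝓝 (∫ z, ψ z * regTheta lam 0 z)) :=
  tendsto_integral_mul_of_norm_le_div_norm_sq hψ hψc (measurable_regTheta lam)
    (exists_norm_regTheta_le lam) fun _ => tendsto_regTheta lam

lemma tendsto_integral_mul_regThetaGrad (lam : ℂ) (i : Fin 3) {ψ : R3 → ℂ} (hψ : Continuous ψ)
    (hψc : HasCompactSupport ψ) : Tendsto (fun ε => ∫ z, ψ z * regThetaGrad lam i ε z) (𝓝 0)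
      (𝓝 (∫ z, ψ z * regThetaGrad lam i 0 z)) :=
  tendsto_integral_mul_of_norm_le_div_norm_sq hψ hψc (measurable_regThetaGrad lam i)
    (exists_norm_regThetaGrad_le lam i) fun _ => tendsto_regThetaGrad lam i

lemma integral_grad3_mul_regTheta_zero (lam : ℂ) {χ : R3 → ℂ} (hχ : ContDiff ℝ 1 χ)
    (hχc : HasCompactSupport χ) (i : Fin 3) :
    ∫ z, grad3 χ z i * regTheta lam 0 z = -∫ z, χ z * regThetaGrad lam i 0 z := by
  have hreg : ∀ᶠ ε in 𝓝[≠] (0 : ℝ),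
      ∫ z, grad3 χ z i * regTheta lam ε z = -∫ z, χ z * regThetaGrad lam i ε z := by
    filter_upwards [self_mem_nhdsWithin] with ε hε
    rw [integral_grad3_mul hχ hχc ((contDiff_regTheta lam hε).of_le (by simp))]
    simp only [grad3_regTheta lam (regNorm_pos_of_ne_zero_left hε _)]
  have hlim := (tendsto_integral_mul_regTheta lam (continuous_grad3 hχ i)
    (hasCompactSupport_grad3 hχc i)).mono_left (nhdsWithin_le_nhds (s := {0}ᶜ))
  exact tendsto_nhds_unique (hlim.congr' hreg)
    ((tendsto_integral_mul_regThetaGrad lam i hχ.continuous hχc).neg.mono_left nhdsWithin_le_nhds)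

end WeaklySingular

/-! ### The approximate identity `ε² / (|z|² + ε²)^(5/2)` -/

section ApproximateIdentity

lemma hasDerivAt_div_sqrt_sq_add_one_pow (r : ℝ) :
    HasDerivAt (fun r : ℝ => (r / √(r ^ 2 + 1)) ^ 3 / 3) (r ^ 2 * (√(r ^ 2 + 1) ^ 5)⁻¹) r := by
  have hpos : 0 < r ^ 2 + 1 := by positivity
  have hs : √(r ^ 2 + 1) ≠ 0 := (Real.sqrt_pos.2 hpos).ne'
  have hsq : √(r ^ 2 + 1) ^ 2 = r ^ 2 + 1 := Real.sq_sqrt hpos.le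
  have hinner : HasDerivAt (fun r : ℝ => r ^ 2 + 1) (2 * r) r := by
    simpa using (hasDerivAt_pow 2 r).add_const 1
  convert! (((hasDerivAt_id r).div (hinner.sqrt hpos.ne') hs).pow 3).div_const 3 using 1
  simp only [id_eq, Pi.div_apply, Nat.cast_ofNat, Nat.add_one_sub_one]
  field_simp
  rw [hsq]
  ring

lemma tendsto_div_sqrt_sq_add_one_pow :
    Tendsto (fun r : ℝ => (r / √(r ^ 2 + 1)) ^ 3 / 3) atTop (𝓝 (1 / 3)) := by
  have hinv : Tendsto (fun r : ℝ => √(1 - (r ^ 2 + 1)⁻¹)) atTop (𝓝 (√(1 - 0))) :=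
    (tendsto_const_nhds.sub (tendsto_inv_atTop_zero.comp
      ((tendsto_pow_atTop two_ne_zero).atTop_add tendsto_const_nhds))).sqrt
  have hquot : Tendsto (fun r : ℝ => r / √(r ^ 2 + 1)) atTop (𝓝 1) := by
    rw [sub_zero, Real.sqrt_one] at hinv
    refine hinv.congr' ?_
    filter_upwards [eventually_ge_atTop 0] with r hr
    have hpos : 0 < r ^ 2 + 1 := by positivity
    rw [show 1 - (r ^ 2 + 1)⁻¹ = r ^ 2 / (r ^ 2 + 1) by field_simp; ring,
      Real.sqrt_div' _ hpos.le, Real.sqrt_sq hr]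
  simpa using (hquot.pow 3).div_const 3

lemma regNorm_one_eq (w : R3) : (regNorm 1 w ^ 5)⁻¹ = (√(‖w‖ ^ 2 + 1) ^ 5)⁻¹ := by
  rw [regNorm, one_pow]

lemma integrable_inv_regNorm_one_pow : Integrable fun w : R3 => (regNorm 1 w ^ 5)⁻¹ := by
  simp only [regNorm_one_eq]
  rw [integrable_fun_norm_addHaar volume (f := fun r : ℝ => (√(r ^ 2 + 1) ^ 5)⁻¹)]
  simp only [finrank_euclideanSpace, Fintype.card_fin, smul_eq_mul]
  exact integrableOn_Ioi_deriv_of_nonneg' (a := 0)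
    (fun r _ => hasDerivAt_div_sqrt_sq_add_one_pow r)
    (fun r _ => mul_nonneg (sq_nonneg r) (by positivity)) tendsto_div_sqrt_sq_add_one_pow

lemma integral_inv_regNorm_one_pow : ∫ w : R3, (regNorm 1 w ^ 5)⁻¹ = 4 * Real.pi / 3 := by
  have hball : (volume : Measure R3).real (Metric.ball 0 1) = 4 * Real.pi / 3 := by
    rw [Measure.real, EuclideanSpace.volume_ball_fin_three, ENNReal.ofReal_one, one_pow, one_mul,
      ENNReal.toReal_ofReal (by positivity)]
    ring
  have hradial : ∫ r in Set.Ioi (0 : ℝ), r ^ 2 * (√(r ^ 2 + 1) ^ 5)⁻¹ = 1 / 3 := by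
    simpa using integral_Ioi_of_hasDerivAt_of_nonneg' (a := 0)
      (fun r _ => hasDerivAt_div_sqrt_sq_add_one_pow r) (fun r _ => by positivity)
      tendsto_div_sqrt_sq_add_one_pow
  simp only [regNorm_one_eq]
  rw [integral_fun_norm_addHaar volume (fun r : ℝ => (√(r ^ 2 + 1) ^ 5)⁻¹), hball]
  simp only [finrank_euclideanSpace, Fintype.card_fin, smul_eq_mul, Nat.add_one_sub_one, hradial]
  simp
  ring

variable {F : Type*} [NormedAddCommGroup F] [NormedSpace ℝ F]

lemma integral_div_regNorm_pow_smul {ε : ℝ} (hε : 0 < ε) (f : R3 → F) :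
    ∫ z, (ε ^ 2 / regNorm ε z ^ 5) • f z = ∫ w, (regNorm 1 w ^ 5)⁻¹ • f (ε • w) := by
  have hscale := Measure.integral_comp_smul_of_nonneg (volume : Measure R3)
    (fun z => (ε ^ 2 / regNorm ε z ^ 5) • f z) ε (hR := hε.le)
  rw [finrank_euclideanSpace, Fintype.card_fin] at hscale
  rw [← smul_inv_smul₀ (pow_ne_zero 3 hε.ne') (∫ z, (ε ^ 2 / regNorm ε z ^ 5) • f z), ← hscale,
    ← integral_smul]
  congr 1 with w
  have hw : regNorm 1 w ≠ 0 := (regNorm_pos_of_ne_zero_left one_ne_zero w).ne'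
  rw [regNorm_smul hε.le, smul_smul]
  congr 1
  field_simp

lemma tendsto_integral_div_regNorm_pow_smul [CompleteSpace F] {f : ℝ → R3 → F}
    (hf : Continuous (Function.uncurry f)) {M : ℝ}
    (hM : ∀ ε ∈ Set.Ioo 0 1, ∀ z, ‖f ε z‖ ≤ M) :
    Tendsto (fun ε => ∫ z, (ε ^ 2 / regNorm ε z ^ 5) • f ε z) (𝓝[>] 0)
      (𝓝 ((4 * Real.pi / 3) • f 0 0)) := by
  have hcont : Continuous fun p : ℝ × R3 => f p.1 (p.1 • p.2) :=
    hf.comp (continuous_fst.prodMk (continuous_fst.smul continuous_snd))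
  have hscaled : Tendsto (fun ε => ∫ w, (regNorm 1 w ^ 5)⁻¹ • f ε (ε • w)) (𝓝[>] 0)
      (𝓝 (∫ w : R3, (regNorm 1 w ^ 5)⁻¹ • f 0 0)) := by
    refine tendsto_integral_filter_of_dominated_convergence (fun w => (regNorm 1 w ^ 5)⁻¹ * M)
      (Eventually.of_forall fun ε => ?_) ?_ (integrable_inv_regNorm_one_pow.mul_const M)
      (Eventually.of_forall fun w => ?_)
    · exact integrable_inv_regNorm_one_pow.aestronglyMeasurable.smul
        (hcont.comp (Continuous.prodMk_right ε)).aestronglyMeasurable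
    · filter_upwards [Ioo_mem_nhdsGT (zero_lt_one (α := ℝ))] with ε hε
      refine Eventually.of_forall fun w => ?_
      have hnonneg : 0 ≤ (regNorm 1 w ^ 5)⁻¹ := inv_nonneg.2 (pow_nonneg (regNorm_nonneg 1 w) 5)
      rw [norm_smul, Real.norm_of_nonneg hnonneg]
      exact mul_le_mul_of_nonneg_left (hM ε hε _) hnonneg
    · have hw : Tendsto (fun ε => f ε (ε • w)) (𝓝 0) (𝓝 (f 0 0)) := by
        simpa [Function.comp_def] using (hcont.comp (Continuous.prodMk_left w)).tendsto 0
      exact (hw.mono_left nhdsWithin_le_nhds).const_smul _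
  rw [integral_smul_const, integral_inv_regNorm_one_pow] at hscaled
  refine hscaled.congr' ?_
  filter_upwards [self_mem_nhdsWithin] with ε hε using (integral_div_regNorm_pow_smul hε _).symm

end ApproximateIdentity

/-! ### The fundamental solution and its potentials -/

section Potential

variable (lam : ℂ) {χ : R3 → ℂ}

lemma tendsto_integral_mul_helmholtzOp_regTheta (hχ : Continuous χ) (hχc : HasCompactSupport χ) :
    Tendsto (fun ε => ∫ z, χ z * helmholtzOp lam (regTheta lam ε) z) (𝓝[>] 0) (𝓝 (χ 0)) := by
  have hdefect := continuous_helmholtzDefect lam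
  have hcont : Continuous fun p : ℝ × R3 => χ p.2 * helmholtzDefect lam (regNorm p.1 p.2) := by
    fun_prop
  obtain ⟨M, hM⟩ := ((isCompact_Icc (a := (0 : ℝ)) (b := 1)).prod
    hχc.isCompact).exists_bound_of_continuousOn hcont.continuousOn
  have hbound : ∀ ε ∈ Set.Ioo (0 : ℝ) 1, ∀ z,
      ‖χ z * helmholtzDefect lam (regNorm ε z)‖ ≤ max M 0 := by
    intro ε hε z
    by_cases hz : z ∈ tsupport χ
    · exact (hM (ε, z) ⟨⟨hε.1.le, hε.2.le⟩, hz⟩).trans (le_max_left M 0)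
    · simp [image_eq_zero_of_notMem_tsupport hz]
  have hlim := tendsto_integral_div_regNorm_pow_smul (F := ℂ)
    (f := fun ε z => χ z * helmholtzDefect lam (regNorm ε z)) hcont hbound
  have hval : (4 * Real.pi / 3 : ℝ) • (χ 0 * helmholtzDefect lam (regNorm 0 (0 : R3))) = χ 0 := by
    have hpi : (Real.pi : ℂ) ≠ 0 := by simp [Real.pi_ne_zero]
    simp only [regNorm_zero, norm_zero, helmholtzDefect, Complex.real_smul]
    push_cast
    simp
    field_simp
  rw [hval] at hlim
  refine hlim.congr' ?_
  filter_upwards [self_mem_nhdsWithin] with ε hε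
  congr 1 with z
  rw [helmholtzOp_regTheta lam (ne_of_gt hε), Complex.real_smul]
  push_cast
  ring

lemma integral_helmholtzOp_mul_regTheta_zero (hχ : ContDiff ℝ 2 χ) (hχc : HasCompactSupport χ) :
    ∫ z, helmholtzOp lam χ z * regTheta lam 0 z = χ 0 := by
  refine tendsto_nhds_unique (((tendsto_integral_mul_regTheta lam (continuous_helmholtzOp lam hχ)
    (hasCompactSupport_helmholtzOp lam hχc)).mono_left nhdsWithin_le_nhds).congr' ?_)
    (tendsto_integral_mul_helmholtzOp_regTheta lam hχ.continuous hχc)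
  filter_upwards [self_mem_nhdsWithin] with ε hε
  exact integral_helmholtzOp_mul lam hχ hχc ((contDiff_regTheta lam (ne_of_gt hε)).of_le
    (by norm_cast))

/-- The Helmholtz potential `y ↦ ∫ χ(x) θ(x - y) dx` of a density `χ`. -/
noncomputable def potential (lam : ℂ) (χ : R3 → ℂ) (y : R3) : ℂ :=
  ∫ x, χ x * helmholtzTheta lam (x - y)

lemma potential_eq_convolution (χ : R3 → ℂ) :
    potential lam χ = convolution (regTheta lam 0) χ (ContinuousLinearMap.mul ℝ ℂ) volume := by
  ext y
  rw [potential, convolution_def,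
    ← integral_sub_left_eq_self (fun x => χ x * helmholtzTheta lam (x - y)) volume y]
  congr 1 with t
  rw [sub_sub_cancel_left, helmholtzTheta_eq, mul_comm]
  simp [regTheta]

lemma potential_eq_integral_comp_add (χ : R3 → ℂ) (y : R3) :
    potential lam χ y = ∫ z, χ (z + y) * regTheta lam 0 z := by
  rw [potential, ← integral_add_right_eq_self _ y]
  simp [helmholtzTheta_eq]

lemma contDiff_potential {n : ℕ∞} (hχ : ContDiff ℝ n χ) (hχc : HasCompactSupport χ) :
    ContDiff ℝ n (potential lam χ) := by
  rw [potential_eq_convolution]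
  exact hχc.contDiff_convolution_right _ (locallyIntegrable_regTheta_zero lam) hχ

lemma grad3_potential (hχ : ContDiff ℝ 1 χ) (hχc : HasCompactSupport χ) (y : R3) (i : Fin 3) :
    grad3 (potential lam χ) y i = potential lam (fun x => grad3 χ x i) y := by
  have hint := locallyIntegrable_regTheta_zero lam
  rw [grad3, potential_eq_convolution, potential_eq_convolution,
    (hχc.hasFDerivAt_convolution_right (ContinuousLinearMap.mul ℝ ℂ) hint hχ y).fderiv,
    convolution_precompR_apply _ hint (hχc.fderiv (𝕜 := ℝ)) (hχ.continuous_fderiv (by simp))]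
  rfl

lemma potential_grad3 (hχ : ContDiff ℝ 1 χ) (hχc : HasCompactSupport χ) (y : R3) (i : Fin 3) :
    potential lam (fun x => grad3 χ x i) y = -∫ x, χ x * regThetaGrad lam i 0 (x - y) := by
  have h := integral_grad3_mul_regTheta_zero lam (χ := fun z => χ (z + y))
    (hχ.comp (contDiff_id.add contDiff_const)) (hχc.comp_homeomorph (Homeomorph.addRight y)) i
  simp only [grad3_comp_add] at h
  rw [potential_eq_integral_comp_add, h, ← integral_add_right_eq_self (fun x => χ x * _) y]
  simp only [add_sub_cancel_right]

lemma potential_helmholtzOp (hχ : ContDiff ℝ 2 χ) (hχc : HasCompactSupport χ) (y : R3) :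
    potential lam (helmholtzOp lam χ) y = χ y := by
  have h := integral_helmholtzOp_mul_regTheta_zero lam (χ := fun z => χ (z + y))
    (hχ.comp (contDiff_id.add contDiff_const)) (hχc.comp_homeomorph (Homeomorph.addRight y))
  simp only [helmholtzOp_comp_add, zero_add] at h
  rw [potential_eq_integral_comp_add, h]

lemma integrable_mul_helmholtzTheta_sub (hχ : Continuous χ) (hχc : HasCompactSupport χ) (y : R3) :
    Integrable fun x => χ x * helmholtzTheta lam (x - y) := by
  simpa only [helmholtzTheta_eq] using
    integrable_mul_comp_sub (locallyIntegrable_regTheta_zero lam) hχ hχc y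

lemma sum_potential_grad3_grad3_add (hχ : ContDiff ℝ 2 χ) (hχc : HasCompactSupport χ) (y : R3) :
    ∑ i, potential lam (fun x => grad3 (fun x => grad3 χ x i) x i) y +
      lam ^ 2 * potential lam χ y = χ y := by
  have hint (i : Fin 3) : Integrable fun x =>
      grad3 (fun x => grad3 χ x i) x i * helmholtzTheta lam (x - y) :=
    integrable_mul_helmholtzTheta_sub lam
      (continuous_grad3 (contDiff_grad3 hχ (by norm_num) i) i)
      (hasCompactSupport_grad3 (hasCompactSupport_grad3 hχc i) i) y
  have hint₀ := (integrable_mul_helmholtzTheta_sub lam hχ.continuous hχc y).const_mul (lam ^ 2)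
  calc _ = potential lam (helmholtzOp lam χ) y := by
        simp only [potential, helmholtzOp, add_mul, Finset.sum_mul, mul_assoc]
        rw [integral_add (integrable_finsetSum _ fun i _ => hint i) hint₀,
          integral_finsetSum _ fun i _ => hint i, integral_const_mul]
    _ = χ y := potential_helmholtzOp lam hχ hχc y

end Potential

/-! ### Positive kernels acting on `L^p` -/

/-- The integral operator with nonnegative kernel `k` is bounded on `L^p(μ)`. -/
structure IsLpKernel {α : Type*} [MeasurableSpace α] (p : ℝ) (μ : Measure α) (k : α → α → ℝ≥0∞) :
    Prop where
  measurable : Measurable (Function.uncurry k)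
  exists_bound : ∃ C : ℝ≥0∞, C ≠ ⊤ ∧ ∀ f : α → ℝ≥0∞, AEMeasurable f μ →
    ∫⁻ x, (∫⁻ y, k x y * f y ∂μ) ^ p ∂μ ≤ C * ∫⁻ y, f y ^ p ∂μ

namespace IsLpKernel

variable {α : Type*} [MeasurableSpace α] {p : ℝ} {μ : Measure α} {k l : α → α → ℝ≥0∞}

lemma mono (hk : IsLpKernel p μ k) (hp : 0 ≤ p) (hl : Measurable (Function.uncurry l))
    (h : ∀ᵐ x ∂μ, ∀ᵐ y ∂μ, l x y ≤ k x y) : IsLpKernel p μ l := by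
  obtain ⟨-, C, hC, hk⟩ := hk
  refine ⟨hl, C, hC, fun f hf => (lintegral_mono_ae ?_).trans (hk f hf)⟩
  filter_upwards [h] with x hx
  refine ENNReal.rpow_le_rpow (lintegral_mono_ae ?_) hp
  filter_upwards [hx] with y hy
  gcongr

lemma add [SFinite μ] (hk : IsLpKernel p μ k) (hl : IsLpKernel p μ l) (hp : 1 ≤ p) :
    IsLpKernel p μ (fun x y => k x y + l x y) := by
  obtain ⟨mk, C, hC, hk⟩ := hk
  obtain ⟨ml, D, hD, hl⟩ := hl
  have htwo : (2 : ℝ≥0∞) ^ (p - 1) ≠ ⊤ := ENNReal.rpow_ne_top_of_nonneg (by linarith) (by simp)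
  refine ⟨mk.add ml, 2 ^ (p - 1) * (C + D),
    ENNReal.mul_ne_top htwo (ENNReal.add_ne_top.2 ⟨hC, hD⟩), fun f hf => ?_⟩
  have mkf (x : α) : AEMeasurable (fun y => k x y * f y) μ :=
    (mk.comp measurable_prodMk_left).aemeasurable.mul hf
  have mkf_prod : AEMeasurable (fun q : α × α => k q.1 q.2 * f q.2) (μ.prod μ) :=
    mk.aemeasurable.mul hf.comp_snd
  calc ∫⁻ x, (∫⁻ y, (k x y + l x y) * f y ∂μ) ^ p ∂μ
      = ∫⁻ x, ((∫⁻ y, k x y * f y ∂μ) + ∫⁻ y, l x y * f y ∂μ) ^ p ∂μ := by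
        simp only [add_mul, lintegral_add_left' (mkf _)]
    _ ≤ ∫⁻ x, 2 ^ (p - 1) * ((∫⁻ y, k x y * f y ∂μ) ^ p + (∫⁻ y, l x y * f y ∂μ) ^ p) ∂μ :=
        lintegral_mono fun x => ENNReal.rpow_add_le_mul_rpow_add_rpow _ _ hp
    _ = 2 ^ (p - 1) * ((∫⁻ x, (∫⁻ y, k x y * f y ∂μ) ^ p ∂μ) +
          ∫⁻ x, (∫⁻ y, l x y * f y ∂μ) ^ p ∂μ) := by
        rw [lintegral_const_mul' _ _ htwo,
          lintegral_add_left' (mkf_prod.lintegral_prod_right'.pow_const p)]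
    _ ≤ 2 ^ (p - 1) * (C * ∫⁻ y, f y ^ p ∂μ + D * ∫⁻ y, f y ^ p ∂μ) := by
        gcongr
        exacts [hk f hf, hl f hf]
    _ = 2 ^ (p - 1) * (C + D) * ∫⁻ y, f y ^ p ∂μ := by ring

lemma const_mul (hk : IsLpKernel p μ k) (hp : 0 ≤ p) {c : ℝ≥0∞} (hc : c ≠ ⊤) :
    IsLpKernel p μ (fun x y => c * k x y) := by
  obtain ⟨mk, C, hC, hk⟩ := hk
  have hcp : c ^ p ≠ ⊤ := ENNReal.rpow_ne_top_of_nonneg hp hc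
  refine ⟨mk.const_mul c, c ^ p * C, ENNReal.mul_ne_top hcp hC, fun f hf => ?_⟩
  simp only [mul_assoc, lintegral_const_mul' c _ hc, ENNReal.mul_rpow_of_nonneg _ _ hp,
    lintegral_const_mul' _ _ hcp]
  gcongr
  exact hk f hf

lemma zero (hp : 0 < p) : IsLpKernel p μ (fun _ _ => 0) :=
  ⟨measurable_const, 0, by simp, fun f _ => by simp [hp]⟩

lemma finsetSum [SFinite μ] {ι : Type*} (s : Finset ι) {k : ι → α → α → ℝ≥0∞}
    (hk : ∀ i ∈ s, IsLpKernel p μ (k i)) (hp : 1 ≤ p) :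
    IsLpKernel p μ (fun x y => ∑ i ∈ s, k i x y) := by
  classical
  induction s using Finset.induction_on with
  | empty => simpa using zero (by linarith)
  | insert a s ha ih =>
    simp only [Finset.sum_insert ha]
    exact (hk a (Finset.mem_insert_self a s)).add
      (ih fun i hi => hk i (Finset.mem_insert_of_mem hi)) hp

end IsLpKernel

section Schur

variable {α : Type*} [MeasurableSpace α] {μ : Measure α} {p q : ℝ}

lemma rpow_lintegral_mul_le_of_weight (hpq : p.HolderConjugate q) {k f w : α → ℝ≥0∞}
    (hk : AEMeasurable k μ) (hf : AEMeasurable f μ) (hw : AEMeasurable w μ)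
    (hw_zero : ∀ y, w y ≠ 0) (hw_top : ∀ y, w y ≠ ⊤) :
    (∫⁻ y, k y * f y ∂μ) ^ p ≤
      (∫⁻ y, k y * w y ^ q ∂μ) ^ (p / q) * ∫⁻ y, k y * (f y ^ p * (w y ^ p)⁻¹) ∂μ := by
  have hp := hpq.pos
  have hq := hpq.symm.pos
  have hsplit (y : α) : k y * f y =
      (k y ^ (1 / p) * (f y * (w y)⁻¹)) * (k y ^ (1 / q) * w y) := by
    have hk_split : k y ^ (1 / p) * k y ^ (1 / q) = k y := by
      rw [← ENNReal.rpow_add_of_nonneg _ _ (by positivity) (by positivity), one_div, one_div,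
        hpq.inv_add_inv_eq_one, ENNReal.rpow_one]
    calc k y * f y = (k y ^ (1 / p) * k y ^ (1 / q)) * f y * ((w y)⁻¹ * w y) := by
          rw [hk_split, ENNReal.inv_mul_cancel (hw_zero y) (hw_top y), mul_one]
      _ = _ := by ring
  have hpowp (y : α) : (k y ^ (1 / p) * (f y * (w y)⁻¹)) ^ p =
      k y * (f y ^ p * (w y ^ p)⁻¹) := by
    rw [ENNReal.mul_rpow_of_nonneg _ _ hp.le, ENNReal.mul_rpow_of_nonneg _ _ hp.le,
      ← ENNReal.rpow_mul, one_div_mul_cancel hp.ne', ENNReal.rpow_one, ENNReal.inv_rpow]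
  have hpowq (y : α) : (k y ^ (1 / q) * w y) ^ q = k y * w y ^ q := by
    rw [ENNReal.mul_rpow_of_nonneg _ _ hq.le, ← ENNReal.rpow_mul,
      one_div_mul_cancel hq.ne', ENNReal.rpow_one]
  have holder := ENNReal.rpow_le_rpow (ENNReal.lintegral_mul_le_Lp_mul_Lq μ hpq
    ((hk.pow_const (1 / p)).mul (hf.mul hw.inv)) ((hk.pow_const (1 / q)).mul hw)) hp.le
  simp only [Pi.mul_apply, Pi.inv_apply, ← hsplit, hpowp, hpowq] at holder
  rwa [ENNReal.mul_rpow_of_nonneg _ _ hp.le, ← ENNReal.rpow_mul, ← ENNReal.rpow_mul,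
    one_div_mul_cancel hp.ne', ENNReal.rpow_one, mul_comm, one_div_mul_eq_div] at holder

lemma IsLpKernel.of_schur [SFinite μ] (hpq : p.HolderConjugate q) {k : α → α → ℝ≥0∞}
    (hk : Measurable (Function.uncurry k)) {w : α → ℝ≥0∞} (hw : Measurable w)
    (hw_zero : ∀ x, w x ≠ 0) (hw_top : ∀ x, w x ≠ ⊤) {C : ℝ≥0∞} (hC : C ≠ ⊤)
    (hrow : ∀ x, ∫⁻ y, k x y * w y ^ q ∂μ ≤ C * w x ^ q)
    (hcol : ∀ y, ∫⁻ x, k x y * w x ^ p ∂μ ≤ C * w y ^ p) : IsLpKernel p μ k := by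
  have hp := hpq.pos
  have hq := hpq.symm.pos
  have hCpq : C ^ (p / q) ≠ ⊤ := ENNReal.rpow_ne_top_of_nonneg (by positivity) hC
  refine ⟨hk, C ^ (p / q) * C, ENNReal.mul_ne_top hCpq hC, fun f hf => ?_⟩
  have hkf : AEMeasurable (fun z : α × α => k z.1 z.2 * w z.1 ^ p * (f z.2 ^ p * (w z.2 ^ p)⁻¹))
      (μ.prod μ) := by
    have hf₂ : AEMeasurable (fun z : α × α => f z.2) (μ.prod μ) := hf.comp_snd
    exact (hk.mul ((hw.comp measurable_fst).pow_const p)).aemeasurable.mul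
      ((hf₂.pow_const p).mul ((hw.comp measurable_snd).pow_const p).inv.aemeasurable)
  have hrow' (x : α) : (∫⁻ y, k x y * f y ∂μ) ^ p ≤
      C ^ (p / q) * ∫⁻ y, k x y * w x ^ p * (f y ^ p * (w y ^ p)⁻¹) ∂μ := by
    have hwx : w x ^ p ≠ ⊤ := ENNReal.rpow_ne_top_of_nonneg hp.le (hw_top x)
    calc _ ≤ (∫⁻ y, k x y * w y ^ q ∂μ) ^ (p / q) * ∫⁻ y, k x y * (f y ^ p * (w y ^ p)⁻¹) ∂μ :=
          rpow_lintegral_mul_le_of_weight hpq (hk.comp measurable_prodMk_left).aemeasurable hf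
            hw.aemeasurable hw_zero hw_top
      _ ≤ (C * w x ^ q) ^ (p / q) * ∫⁻ y, k x y * (f y ^ p * (w y ^ p)⁻¹) ∂μ := by
          gcongr
          exact hrow x
      _ = C ^ (p / q) * ∫⁻ y, k x y * w x ^ p * (f y ^ p * (w y ^ p)⁻¹) ∂μ := by
          rw [ENNReal.mul_rpow_of_nonneg _ _ (by positivity), ← ENNReal.rpow_mul,
            mul_div_cancel₀ _ hq.ne', mul_assoc, ← lintegral_const_mul' _ _ hwx]
          simp only [mul_left_comm (w x ^ p), mul_assoc]
  calc ∫⁻ x, (∫⁻ y, k x y * f y ∂μ) ^ p ∂μ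
      ≤ ∫⁻ x, C ^ (p / q) * ∫⁻ y, k x y * w x ^ p * (f y ^ p * (w y ^ p)⁻¹) ∂μ ∂μ :=
        lintegral_mono hrow'
    _ = C ^ (p / q) * ∫⁻ y, ∫⁻ x, k x y * w x ^ p * (f y ^ p * (w y ^ p)⁻¹) ∂μ ∂μ := by
        rw [lintegral_const_mul' _ _ hCpq, lintegral_lintegral_swap hkf]
    _ ≤ C ^ (p / q) * ∫⁻ y, C * f y ^ p ∂μ := by
        gcongr with y
        have hwy_zero : w y ^ p ≠ 0 := by simp [ENNReal.rpow_eq_zero_iff, hw_zero y, hw_top y]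
        have hwy_top : w y ^ p ≠ ⊤ := ENNReal.rpow_ne_top_of_nonneg hp.le (hw_top y)
        rw [lintegral_mul_const (f := fun x => k x y * w x ^ p) _
          ((hk.comp measurable_prodMk_right).mul (hw.pow_const p))]
        calc (∫⁻ x, k x y * w x ^ p ∂μ) * (f y ^ p * (w y ^ p)⁻¹)
            ≤ C * w y ^ p * (f y ^ p * (w y ^ p)⁻¹) := by gcongr; exact hcol y
          _ = C * f y ^ p * (w y ^ p * (w y ^ p)⁻¹) := by ring
          _ = C * f y ^ p := by rw [ENNReal.mul_inv_cancel hwy_zero hwy_top, mul_one]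
    _ = C ^ (p / q) * C * ∫⁻ y, f y ^ p ∂μ := by rw [lintegral_const_mul' _ _ hC, mul_assoc]

end Schur

namespace IsLpKernel

variable {α : Type*} [MeasurableSpace α] {p : ℝ} {μ : Measure α} {K : α → α → ℂ} {f : α → ℂ}

lemma lintegral_rpow_lt_top (hK : IsLpKernel p μ fun x y => ‖K x y‖ₑ) (hp : 0 < p)
    (hf : MemLp f (ENNReal.ofReal p) μ) :
    ∫⁻ x, (∫⁻ y, ‖K x y‖ₑ * ‖f y‖ₑ ∂μ) ^ p ∂μ < ⊤ := by
  obtain ⟨-, C, hC, h⟩ := hK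
  refine (h _ hf.1.enorm).trans_lt (ENNReal.mul_lt_top hC.lt_top ?_)
  have hfp := (eLpNorm_lt_top_iff_lintegral_rpow_enorm_lt_top (by simpa) (by simp)).1 hf.2
  rwa [ENNReal.toReal_ofReal hp.le] at hfp

lemma memLp [SFinite μ] (hK : IsLpKernel p μ fun x y => ‖K x y‖ₑ)
    (mK : Measurable (Function.uncurry K)) (hp : 0 < p) (hf : MemLp f (ENNReal.ofReal p) μ) :
    MemLp (fun x => ∫ y, K x y * f y ∂μ) (ENNReal.ofReal p) μ := by
  have hm : AEStronglyMeasurable (fun z : α × α => K z.1 z.2 * f z.2) (μ.prod μ) :=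
    mK.aestronglyMeasurable.mul hf.1.comp_snd
  refine ⟨hm.integral_prod_right', ?_⟩
  rw [eLpNorm_lt_top_iff_lintegral_rpow_enorm_lt_top (by simpa) (by simp),
    ENNReal.toReal_ofReal hp.le]
  refine lt_of_le_of_lt (lintegral_mono fun x => ?_) (lintegral_rpow_lt_top hK hp hf)
  simp only [← enorm_mul]
  gcongr
  exact enorm_integral_le_lintegral_enorm _

variable [IsFiniteMeasure μ]

lemma integrable_prod (hK : IsLpKernel p μ fun x y => ‖K x y‖ₑ)
    (mK : Measurable (Function.uncurry K)) (hp : 1 ≤ p) (hf : MemLp f (ENNReal.ofReal p) μ) :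
    Integrable (fun z : α × α => K z.1 z.2 * f z.2) (μ.prod μ) := by
  have hm : AEStronglyMeasurable (fun z : α × α => K z.1 z.2 * f z.2) (μ.prod μ) :=
    mK.aestronglyMeasurable.mul hf.1.comp_snd
  refine ⟨hm, ?_⟩
  rw [hasFiniteIntegral_iff_enorm, lintegral_prod _ hm.enorm]
  simp only [enorm_mul]
  have hle (a : ℝ≥0∞) : a ≤ 1 + a ^ p := by
    rcases le_total a 1 with ha | ha
    · exact ha.trans le_self_add
    · exact le_add_left (by simpa using ENNReal.rpow_le_rpow_of_exponent_le ha hp)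
  calc ∫⁻ x, ∫⁻ y, ‖K x y‖ₑ * ‖f y‖ₑ ∂μ ∂μ
      ≤ ∫⁻ x, (1 + (∫⁻ y, ‖K x y‖ₑ * ‖f y‖ₑ ∂μ) ^ p) ∂μ := lintegral_mono fun x => hle _
    _ < ⊤ := by
        rw [lintegral_add_left measurable_const]
        exact ENNReal.add_lt_top.2 ⟨by simp, lintegral_rpow_lt_top hK (by linarith) hf⟩

lemma ae_integrable (hK : IsLpKernel p μ fun x y => ‖K x y‖ₑ)
    (mK : Measurable (Function.uncurry K)) (hp : 1 ≤ p) (hf : MemLp f (ENNReal.ofReal p) μ) :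
    ∀ᵐ x ∂μ, Integrable (fun y => K x y * f y) μ :=
  (integrable_prod hK mK hp hf).prod_right_ae

lemma integral_mul_integral (hK : IsLpKernel p μ fun x y => ‖K x y‖ₑ)
    (mK : Measurable (Function.uncurry K)) (hp : 1 ≤ p) (hf : MemLp f (ENNReal.ofReal p) μ)
    {φ : α → ℂ} (hφ : AEStronglyMeasurable φ μ) {M : ℝ} (hM : ∀ x, ‖φ x‖ ≤ M) :
    Integrable (fun y => (∫ x, φ x * K x y ∂μ) * f y) μ ∧
    ∫ x, φ x * ∫ y, K x y * f y ∂μ ∂μ = ∫ y, (∫ x, φ x * K x y ∂μ) * f y ∂μ := by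
  have hint : Integrable (fun z : α × α => φ z.1 * (K z.1 z.2 * f z.2)) (μ.prod μ) :=
    (integrable_prod hK mK hp hf).bdd_mul hφ.comp_fst (Eventually.of_forall fun z => hM z.1)
  simp only [← integral_mul_const, ← integral_const_mul, mul_assoc]
  exact ⟨hint.integral_prod_right, integral_integral_swap hint⟩

end IsLpKernel

/-! ### A Hilbert-type kernel on the half-space -/

lemma lintegral_eq_mul_lintegral_comp_mul_left {c : ℝ} (hc : 0 < c) {f : ℝ → ℝ≥0∞}
    (hf : Measurable f) : ∫⁻ t, f t = ENNReal.ofReal c * ∫⁻ t, f (c * t) := by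
  conv_lhs => rw [← Real.smul_map_volume_mul_left hc.ne']
  rw [lintegral_smul_measure, lintegral_map hf (measurable_const_mul c), abs_of_pos hc,
    smul_eq_mul]

lemma lintegral_abs_sub_add_rpow (r a : ℝ) {c : ℝ} (hc : 0 < c) :
    ∫⁻ t : ℝ, ENNReal.ofReal ((|a - t| + c) ^ (-r)) =
      ENNReal.ofReal (c ^ (1 - r)) * ∫⁻ t : ℝ, ENNReal.ofReal ((1 + ‖t‖) ^ (-r)) := by
  have hscale (t : ℝ) : ENNReal.ofReal ((|c * t| + c) ^ (-r)) =
      ENNReal.ofReal (c ^ (-r)) * ENNReal.ofReal ((1 + ‖t‖) ^ (-r)) := by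
    rw [← ENNReal.ofReal_mul (by positivity), ← Real.mul_rpow hc.le (by positivity), abs_mul,
      abs_of_pos hc, Real.norm_eq_abs, mul_add, mul_one, add_comm]
  rw [lintegral_sub_left_eq_self (fun t : ℝ => ENNReal.ofReal ((|t| + c) ^ (-r))) a,
    lintegral_eq_mul_lintegral_comp_mul_left hc (by fun_prop)]
  simp only [hscale]
  rw [lintegral_const_mul' _ _ ENNReal.ofReal_ne_top, ← mul_assoc, ← ENNReal.ofReal_mul hc.le,
    sub_eq_add_neg, Real.rpow_add hc, Real.rpow_one]

lemma lintegral_Ioi_inv_one_add_mul_rpow_lt_top {a : ℝ} (ha₀ : 0 < a) (ha₁ : a < 1) :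
    ∫⁻ t in Set.Ioi (0 : ℝ), ENNReal.ofReal ((1 + t)⁻¹ * t ^ (-a)) < ⊤ := by
  rw [← Set.Ioc_union_Ioi_eq_Ioi zero_le_one]
  refine (lintegral_union_le _ _ _).trans_lt (ENNReal.add_lt_top.2 ⟨?_, ?_⟩)
  · have hint : IntegrableOn (fun t : ℝ => t ^ (-a)) (Set.Ioc 0 1) :=
      (intervalIntegrable_iff_integrableOn_Ioc_of_le zero_le_one).1
        (intervalIntegral.intervalIntegrable_rpow' (by linarith))
    refine (setLIntegral_mono' measurableSet_Ioc fun t ht => ?_).trans_lt hint.lintegral_lt_top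
    have ht₀ : 0 < t := ht.1
    exact ENNReal.ofReal_le_ofReal (mul_le_of_le_one_left (by positivity)
      (inv_le_one_of_one_le₀ (by linarith)))
  · have hint : IntegrableOn (fun t : ℝ => t ^ (-1 - a)) (Set.Ioi 1) :=
      integrableOn_Ioi_rpow_of_lt (by linarith) zero_lt_one
    refine (setLIntegral_mono' measurableSet_Ioi fun t ht => ?_).trans_lt hint.lintegral_lt_top
    have ht₀ : 0 < t := zero_lt_one.trans ht
    rw [sub_eq_add_neg, Real.rpow_add ht₀, Real.rpow_neg_one]
    gcongr
    linarith

lemma lintegral_Ioi_inv_add_mul_rpow (a : ℝ) {s : ℝ} (hs : 0 < s) :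
    ∫⁻ t in Set.Ioi (0 : ℝ), ENNReal.ofReal ((s + t)⁻¹ * t ^ (-a)) =
      ENNReal.ofReal (s ^ (-a)) *
        ∫⁻ t in Set.Ioi (0 : ℝ), ENNReal.ofReal ((1 + t)⁻¹ * t ^ (-a)) := by
  have hscale (t : ℝ) : (Set.Ioi (0 : ℝ)).indicator
      (fun t => ENNReal.ofReal ((s + t)⁻¹ * t ^ (-a))) (s * t) =
      ENNReal.ofReal (s⁻¹ * s ^ (-a)) * (Set.Ioi (0 : ℝ)).indicator
        (fun t => ENNReal.ofReal ((1 + t)⁻¹ * t ^ (-a))) t := by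
    rcases lt_or_ge 0 t with ht | ht
    · rw [Set.indicator_of_mem (Set.mem_Ioi.2 (mul_pos hs ht)),
        Set.indicator_of_mem (Set.mem_Ioi.2 ht), ← ENNReal.ofReal_mul (by positivity),
        Real.mul_rpow hs.le ht.le, show s + s * t = s * (1 + t) by ring, mul_inv]
      ring_nf
    · rw [Set.indicator_of_notMem (by simpa using mul_nonpos_of_nonneg_of_nonpos hs.le ht),
        Set.indicator_of_notMem (by simpa using ht), mul_zero]
  rw [← lintegral_indicator measurableSet_Ioi, ← lintegral_indicator measurableSet_Ioi,
    lintegral_eq_mul_lintegral_comp_mul_left hs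
      (Measurable.indicator (by fun_prop) measurableSet_Ioi)]
  simp only [hscale]
  rw [lintegral_const_mul' _ _ ENNReal.ofReal_ne_top, ← mul_assoc, ← ENNReal.ofReal_mul hs.le,
    mul_inv_cancel_left₀ hs.ne']

/-- A kernel on the half-space `{(a, t) | 0 < t}` of `ℝ² × ℝ`, extended by zero, which dominates
`(|a - b| + s + t) ^ (-3)` and whose integral factorises over the three coordinates. -/
noncomputable def halfSpaceKernel (u v : (ℝ × ℝ) × ℝ) : ℝ≥0∞ :=
  if 0 < u.2 ∧ 0 < v.2 then
    ENNReal.ofReal ((|u.1.1 - v.1.1| + (u.2 + v.2)) ^ (-(3 / 2) : ℝ)) *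
      ENNReal.ofReal ((|u.1.2 - v.1.2| + (u.2 + v.2)) ^ (-(3 / 2) : ℝ))
  else 0

/-- The weight `t ^ (-a)` for Schur's test on the half-space `{(b, t) | 0 < t}`; the value `1`
elsewhere keeps it away from `0` and `∞`. -/
noncomputable def halfSpaceWeight (a : ℝ) (v : (ℝ × ℝ) × ℝ) : ℝ≥0∞ :=
  if 0 < v.2 then ENNReal.ofReal (v.2 ^ (-a)) else 1

lemma measurable_halfSpaceKernel : Measurable (Function.uncurry halfSpaceKernel) := by
  unfold halfSpaceKernel Function.uncurry
  refine Measurable.ite ?_ (by fun_prop) measurable_const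
  exact (measurableSet_lt measurable_const (measurable_snd.comp measurable_fst)).inter
    (measurableSet_lt measurable_const (measurable_snd.comp measurable_snd))

lemma measurable_halfSpaceWeight (a : ℝ) : Measurable (halfSpaceWeight a) := by
  unfold halfSpaceWeight
  exact Measurable.ite (measurableSet_lt measurable_const (by fun_prop)) (by fun_prop)
    measurable_const

lemma halfSpaceKernel_comm (u v : (ℝ × ℝ) × ℝ) : halfSpaceKernel u v = halfSpaceKernel v u := by
  simp only [halfSpaceKernel, abs_sub_comm u.1.1, abs_sub_comm u.1.2, add_comm u.2,
    and_comm (a := 0 < u.2)]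

lemma halfSpaceWeight_ne_zero (a : ℝ) (v : (ℝ × ℝ) × ℝ) : halfSpaceWeight a v ≠ 0 := by
  unfold halfSpaceWeight
  split_ifs with hv
  · simpa using Real.rpow_pos_of_pos hv _
  · exact one_ne_zero

lemma halfSpaceWeight_ne_top (a : ℝ) (v : (ℝ × ℝ) × ℝ) : halfSpaceWeight a v ≠ ⊤ := by
  unfold halfSpaceWeight
  split_ifs <;> simp

lemma halfSpaceWeight_rpow (a : ℝ) {r : ℝ} (hr : 0 ≤ r) (v : (ℝ × ℝ) × ℝ) :
    halfSpaceWeight a v ^ r = halfSpaceWeight (a * r) v := by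
  unfold halfSpaceWeight
  split_ifs with hv
  · rw [ENNReal.ofReal_rpow_of_nonneg (by positivity) hr, ← Real.rpow_mul hv.le, neg_mul]
  · simp

lemma lintegral_halfSpaceKernel_horizontal (a : ℝ) {u : (ℝ × ℝ) × ℝ} (hu : 0 < u.2) {t : ℝ}
    (ht : 0 < t) :
    ∫⁻ b : ℝ × ℝ, halfSpaceKernel u (b, t) * halfSpaceWeight a (b, t) =
      (∫⁻ b : ℝ, ENNReal.ofReal ((1 + ‖b‖) ^ (-(3 / 2) : ℝ))) ^ 2 *
        ENNReal.ofReal ((u.2 + t)⁻¹ * t ^ (-a)) := by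
  have hut : 0 < u.2 + t := add_pos hu ht
  simp only [halfSpaceKernel, halfSpaceWeight, hu, ht, and_self, if_true]
  rw [lintegral_mul_const' _ _ ENNReal.ofReal_ne_top, Measure.volume_eq_prod,
    lintegral_prod_mul (f := fun b : ℝ =>
      ENNReal.ofReal ((|u.1.1 - b| + (u.2 + t)) ^ (-(3 / 2) : ℝ)))
      (g := fun b : ℝ => ENNReal.ofReal ((|u.1.2 - b| + (u.2 + t)) ^ (-(3 / 2) : ℝ)))
      (by fun_prop) (by fun_prop), lintegral_abs_sub_add_rpow _ _ hut,
    lintegral_abs_sub_add_rpow _ _ hut]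
  have hsq : ENNReal.ofReal ((u.2 + t) ^ (1 - 3 / 2 : ℝ)) ^ 2 = ENNReal.ofReal ((u.2 + t)⁻¹) := by
    rw [← ENNReal.ofReal_pow (by positivity), ← Real.rpow_natCast, ← Real.rpow_mul hut.le,
      ← Real.rpow_neg_one]
    norm_num
  rw [ENNReal.ofReal_mul (by positivity), ← hsq]
  ring

lemma exists_lintegral_halfSpaceKernel_le {a : ℝ} (ha₀ : 0 < a) (ha₁ : a < 1) :
    ∃ C : ℝ≥0∞, C ≠ ⊤ ∧ ∀ u, ∫⁻ v, halfSpaceKernel u v * halfSpaceWeight a v ≤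
      C * halfSpaceWeight a u := by
  set A : ℝ≥0∞ := (∫⁻ b : ℝ, ENNReal.ofReal ((1 + ‖b‖) ^ (-(3 / 2) : ℝ))) ^ 2
  set B : ℝ≥0∞ := ∫⁻ t in Set.Ioi (0 : ℝ), ENNReal.ofReal ((1 + t)⁻¹ * t ^ (-a))
  have hA : A ≠ ⊤ := ENNReal.pow_ne_top (finite_integral_one_add_norm (by simp; norm_num)).ne
  have hB : B ≠ ⊤ := (lintegral_Ioi_inv_one_add_mul_rpow_lt_top ha₀ ha₁).ne
  refine ⟨A * B, ENNReal.mul_ne_top hA hB, fun u => ?_⟩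
  rcases le_or_gt u.2 0 with hu | hu
  · simp [halfSpaceKernel, hu.not_gt]
  have hmeas : Measurable fun v => halfSpaceKernel u v * halfSpaceWeight a v :=
    (measurable_halfSpaceKernel.comp measurable_prodMk_left).mul (measurable_halfSpaceWeight a)
  have hslice (t : ℝ) : ∫⁻ b : ℝ × ℝ, halfSpaceKernel u (b, t) * halfSpaceWeight a (b, t) =
      (Set.Ioi (0 : ℝ)).indicator (fun t => A * ENNReal.ofReal ((u.2 + t)⁻¹ * t ^ (-a))) t := by
    rcases le_or_gt t 0 with ht | ht
    · simp [halfSpaceKernel, ht.not_gt]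
    · rw [Set.indicator_of_mem (Set.mem_Ioi.2 ht), lintegral_halfSpaceKernel_horizontal a hu ht]
  rw [Measure.volume_eq_prod, lintegral_prod_symm _ hmeas.aemeasurable]
  simp only [hslice]
  rw [lintegral_indicator measurableSet_Ioi, lintegral_const_mul' _ _ hA,
    lintegral_Ioi_inv_add_mul_rpow a hu, halfSpaceWeight, if_pos hu, mul_assoc, mul_comm B]

lemma isLpKernel_halfSpaceKernel_comp {α : Type*} [MeasurableSpace α] {μ : Measure α} [SFinite μ]
    {p q : ℝ} (hpq : p.HolderConjugate q) {F : α → (ℝ × ℝ) × ℝ} (hF : MeasurePreserving F μ)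
    (s : Set α) : IsLpKernel p (μ.restrict s) fun x y => halfSpaceKernel (F x) (F y) := by
  have hp := hpq.pos
  have hq := hpq.symm.pos
  obtain ⟨C, hC, hrow⟩ := exists_lintegral_halfSpaceKernel_le (a := 1 / p) (by positivity)
    ((div_lt_one hp).2 hpq.lt)
  obtain ⟨D, hD, hcol⟩ := exists_lintegral_halfSpaceKernel_le (a := 1 / q) (by positivity)
    ((div_lt_one hq).2 hpq.symm.lt)
  have hpull (a : ℝ) (u : (ℝ × ℝ) × ℝ) :
      ∫⁻ y in s, halfSpaceKernel u (F y) * halfSpaceWeight a (F y) ∂μ ≤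
        ∫⁻ v, halfSpaceKernel u v * halfSpaceWeight a v :=
    (setLIntegral_le_lintegral _ _).trans (hF.lintegral_comp
      ((measurable_halfSpaceKernel.comp measurable_prodMk_left).mul
        (measurable_halfSpaceWeight a))).le
  refine IsLpKernel.of_schur hpq (w := fun x => halfSpaceWeight (1 / (p * q)) (F x)) (C := C + D)
    (measurable_halfSpaceKernel.comp (hF.measurable.prodMap hF.measurable))
    ((measurable_halfSpaceWeight _).comp hF.measurable) (fun x => halfSpaceWeight_ne_zero _ _)
    (fun x => halfSpaceWeight_ne_top _ _) (by finiteness) (fun x => ?_) fun y => ?_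
  · simp only [halfSpaceWeight_rpow _ hq.le, show 1 / (p * q) * q = 1 / p by field_simp]
    refine ((hpull _ _).trans (hrow _)).trans ?_
    gcongr
    exact le_self_add
  · simp only [halfSpaceWeight_rpow _ hp.le, halfSpaceKernel_comm _ (F y),
      show 1 / (p * q) * p = 1 / q by field_simp]
    refine ((hpull _ _).trans (hcol _)).trans ?_
    gcongr
    exact le_add_self

/-! ### Lipschitz domains and their boundary kernel -/

/-- A bounded open set, not necessarily connected, with locally Lipschitz boundary: near each
boundary point and in suitable Cartesian coordinates, it is the region strictly above the graph of
a locally Lipschitz function. -/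
structure IsBoundedLipschitzDomain (Ω : Set R3) : Prop where
  isOpen : IsOpen Ω
  isBounded : Bornology.IsBounded Ω
  boundary : ∀ x₀ ∈ frontier Ω,
    ∃ (A : R3 ≃ₗᵢ[ℝ] R3) (r : ℝ) (γ : EuclideanSpace ℝ (Fin 2) → ℝ),
      0 < r ∧ LocallyLipschitz γ ∧
      Ω ∩ Metric.ball x₀ r = {x | γ (!₂[(A x) 0, (A x) 1]) < (A x) 2} ∩ Metric.ball x₀ r

lemma IsBoundedLiapunovDomain.isBoundedLipschitzDomain {Ω : Set R3}
    (hΩ : IsBoundedLiapunovDomain Ω) : IsBoundedLipschitzDomain Ω where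
  isOpen := hΩ.isOpen
  isBounded := hΩ.isBounded
  boundary x₀ hx₀ := by
    obtain ⟨α, -, -, hgraph⟩ := hΩ.boundary
    obtain ⟨A, r, γ, -, hr, hγ, -, heq⟩ := hgraph x₀ hx₀
    exact ⟨A, r, γ, hr, hγ.locallyLipschitz, heq⟩

/-- Coordinates, obtained from the isometry `A` by a shear, in which the region above the graph of
`γ` becomes the half-space `{(b, t) | 0 < t}`. -/
noncomputable def flattenGraph (A : R3 ≃ₗᵢ[ℝ] R3) (γ : EuclideanSpace ℝ (Fin 2) → ℝ) (x : R3) :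
    (ℝ × ℝ) × ℝ :=
  (((A x) 0, (A x) 1), (A x) 2 - γ (!₂[(A x) 0, (A x) 1]))

lemma continuous_toLp_pair :
    Continuous fun b : ℝ × ℝ => (!₂[b.1, b.2] : EuclideanSpace ℝ (Fin 2)) :=
  (PiLp.continuous_toLp 2 _).comp <| continuous_pi <|
    Fin.forall_fin_two.2 ⟨continuous_fst, continuous_snd⟩

lemma measurePreserving_flattenGraph (A : R3 ≃ₗᵢ[ℝ] R3) {γ : EuclideanSpace ℝ (Fin 2) → ℝ}
    (hγ : Continuous γ) : MeasurePreserving (flattenGraph A γ) := by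
  have hsplit : MeasurePreserving (Prod.map (id : ℝ → ℝ) (MeasurableEquiv.finTwoArrow (α := ℝ)))
      (volume.prod volume) (volume.prod volume) :=
    (MeasurePreserving.id volume).prod (volume_preserving_finTwoArrow ℝ)
  have hswap : MeasurePreserving (Prod.swap : ℝ × (ℝ × ℝ) → (ℝ × ℝ) × ℝ) (volume.prod volume)
      (volume.prod volume) := Measure.measurePreserving_swap
  have hshear : MeasurePreserving (fun v : (ℝ × ℝ) × ℝ => (v.1, v.2 - γ (!₂[v.1.1, v.1.2])))
      (volume.prod volume) (volume.prod volume) :=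
    (MeasurePreserving.id (volume : Measure (ℝ × ℝ))).skew_product
      (g := fun b t => t - γ (!₂[b.1, b.2]))
      (continuous_snd.sub (hγ.comp (continuous_toLp_pair.comp continuous_fst))).measurable
      (Eventually.of_forall fun b => (measurePreserving_sub_right volume (γ (!₂[b.1, b.2]))).map_eq)
  exact hshear.comp <| hswap.comp <| hsplit.comp <|
    (volume_preserving_piFinSuccAbove (fun _ : Fin 3 => ℝ) 2).comp <|
    (PiLp.volume_preserving_ofLp (Fin 3)).comp A.measurePreserving

lemma locallyLipschitz_flattenGraph_snd (A : R3 ≃ₗᵢ[ℝ] R3) {γ : EuclideanSpace ℝ (Fin 2) → ℝ}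
    (hγ : LocallyLipschitz γ) : LocallyLipschitz fun x => (flattenGraph A γ x).2 := by
  have hcoord (i : Fin 3) : ContDiff ℝ 1 fun x => (A x) i :=
    (EuclideanSpace.proj i : R3 →L[ℝ] ℝ).contDiff.comp A.contDiff
  have hpair : ContDiff ℝ 1 fun x => (!₂[(A x) 0, (A x) 1] : EuclideanSpace ℝ (Fin 2)) :=
    contDiff_euclidean.2 (Fin.forall_fin_two.2 ⟨hcoord 0, hcoord 1⟩)
  exact (hcoord 2).locallyLipschitz.sub (hγ.comp hpair.locallyLipschitz)

lemma exists_lipschitzOnWith_flattenGraph_snd {Ω : Set R3} {x₀ : R3} {A : R3 ≃ₗᵢ[ℝ] R3} {r : ℝ}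
    {γ : EuclideanSpace ℝ (Fin 2) → ℝ} (hr : 0 < r) (hγ : LocallyLipschitz γ)
    (hgraph : Ω ∩ Metric.ball x₀ r =
      {x | γ (!₂[(A x) 0, (A x) 1]) < (A x) 2} ∩ Metric.ball x₀ r) :
    ∃ δ : ℝ, 0 < δ ∧ ∃ K : ℝ≥0,
      LipschitzOnWith K (fun x => (flattenGraph A γ x).2) (Metric.ball x₀ (2 * δ)) ∧
      ∀ x ∈ Metric.ball x₀ (2 * δ), x ∈ Ω ↔ 0 < (flattenGraph A γ x).2 := by
  obtain ⟨K, u, hu, hK⟩ := locallyLipschitz_flattenGraph_snd A hγ x₀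
  obtain ⟨r', hr', hr'u⟩ := Metric.mem_nhds_iff.1 hu
  have hmin : 2 * (min r r' / 2) = min r r' := by ring
  refine ⟨min r r' / 2, by positivity, K, hK.mono ?_, fun x hx => ?_⟩
  · rw [hmin]
    exact (Metric.ball_subset_ball (min_le_right r r')).trans hr'u
  · have hxr : x ∈ Metric.ball x₀ r := Metric.ball_subset_ball (min_le_left r r') (hmin ▸ hx)
    simpa only [Set.mem_inter_iff, hxr, and_true, Set.mem_ofPred_eq, flattenGraph, sub_pos]
      using Set.ext_iff.1 hgraph x

lemma le_mul_infDist_compl {E : Type*} [PseudoMetricSpace E] [ProperSpace E] {Ω : Set E}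
    (hΩ : IsOpen Ω) {s : E → ℝ} {K : ℝ≥0} {x₀ x : E} {δ : ℝ}
    (hs : LipschitzOnWith K s (Metric.ball x₀ (2 * δ))) (hx₀ : x₀ ∉ Ω)
    (hs_nonpos : ∀ z ∈ Metric.ball x₀ (2 * δ), z ∉ Ω → s z ≤ 0) (hx : x ∈ Metric.ball x₀ δ) :
    s x ≤ K * Metric.infDist x Ωᶜ := by
  obtain ⟨z, hz, hxz⟩ := hΩ.isClosed_compl.exists_infDist_eq_dist ⟨x₀, hx₀⟩ x
  have hxx₀ : dist x x₀ < δ := hx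
  have hle : dist x z ≤ dist x x₀ := hxz ▸ Metric.infDist_le_dist_of_mem hx₀
  have hzx₀ : dist z x₀ < 2 * δ := by linarith [dist_triangle z x x₀, dist_comm z x]
  have hx' : x ∈ Metric.ball x₀ (2 * δ) := by
    rw [Metric.mem_ball]
    linarith [dist_nonneg (x := x) (y := x₀)]
  have hsz := hs.dist_le_mul x hx' z hzx₀
  rw [hxz]
  linarith [hs_nonpos z hzx₀ hz, (abs_le.1 hsz).2]

/-- The kernel `D(x, y)⁻³` on `Ω`, where `D(x, y)² = |x - y|² + dist(y, Ωᶜ)²`. -/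
noncomputable def boundaryKernel (Ω : Set R3) (x y : R3) : ℝ≥0∞ :=
  ENNReal.ofReal ((regNorm (Metric.infDist y Ωᶜ) (x - y) ^ 3)⁻¹)

lemma measurable_boundaryKernel (Ω : Set R3) :
    Measurable (Function.uncurry (boundaryKernel Ω)) := by
  have hcont : Continuous fun q : R3 × R3 => regNorm (Metric.infDist q.2 Ωᶜ) (q.1 - q.2) :=
    continuous_regNorm ((Metric.continuous_infDist_pt _).comp continuous_snd) (by fun_prop)
  exact ENNReal.measurable_ofReal.comp (hcont.measurable.pow_const 3).inv

lemma ofReal_inv_cube_le_mul_rpow {a b c D : ℝ} (hc : 0 < c) (ha : 0 ≤ a) (hb : 0 ≤ b)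
    {M : ℝ} (haM : a + c ≤ M * D) (hbM : b + c ≤ M * D) (hD : 0 < D) :
    ENNReal.ofReal ((D ^ 3)⁻¹) ≤ ENNReal.ofReal (M ^ 3) *
      (ENNReal.ofReal ((a + c) ^ (-(3 / 2) : ℝ)) * ENNReal.ofReal ((b + c) ^ (-(3 / 2) : ℝ))) := by
  have hM : 0 < M := pos_of_mul_pos_left (by linarith : 0 < M * D) hD.le
  have hMD : (M * D) ^ (-(3 / 2) : ℝ) * (M * D) ^ (-(3 / 2) : ℝ) = ((M * D) ^ 3)⁻¹ := by
    rw [← Real.rpow_add (by positivity), ← Real.rpow_natCast, ← Real.rpow_neg (by positivity)]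
    norm_num
  rw [← ENNReal.ofReal_mul (by positivity), ← ENNReal.ofReal_mul (by positivity)]
  refine ENNReal.ofReal_le_ofReal ?_
  calc (D ^ 3)⁻¹ = M ^ 3 * ((M * D) ^ (-(3 / 2) : ℝ) * (M * D) ^ (-(3 / 2) : ℝ)) := by
        rw [hMD]
        field_simp
    _ ≤ _ := by
        gcongr M ^ 3 * (?_ * ?_)
        · exact Real.rpow_le_rpow_of_nonpos (by linarith) haM (by norm_num)
        · exact Real.rpow_le_rpow_of_nonpos (by linarith) hbM (by norm_num)

lemma exists_boundaryKernel_le_halfSpaceKernel {Ω : Set R3} (hΩ : IsOpen Ω) {x₀ : R3}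
    (hx₀ : x₀ ∉ Ω) {A : R3 ≃ₗᵢ[ℝ] R3} {r : ℝ} {γ : EuclideanSpace ℝ (Fin 2) → ℝ} (hr : 0 < r)
    (hγ : LocallyLipschitz γ) (hgraph : Ω ∩ Metric.ball x₀ r =
      {x | γ (!₂[(A x) 0, (A x) 1]) < (A x) 2} ∩ Metric.ball x₀ r) :
    ∃ δ : ℝ, 0 < δ ∧ ∃ C : ℝ≥0∞, C ≠ ⊤ ∧ ∀ x ∈ Ω ∩ Metric.ball x₀ δ, ∀ y ∈ Ω ∩ Metric.ball x₀ δ,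
      boundaryKernel Ω x y ≤ C * halfSpaceKernel (flattenGraph A γ x) (flattenGraph A γ y) := by
  obtain ⟨δ, hδ, K, hlip, hpos⟩ := exists_lipschitzOnWith_flattenGraph_snd hr hγ hgraph
  set s : R3 → ℝ := fun x => (flattenGraph A γ x).2
  refine ⟨δ, hδ, ENNReal.ofReal ((3 * K + 1) ^ 3), ENNReal.ofReal_ne_top,
    fun x ⟨hxΩ, hxδ⟩ y ⟨hyΩ, hyδ⟩ => ?_⟩
  have hsub := Metric.ball_subset_ball (x := x₀) (show δ ≤ 2 * δ by linarith)
  have hsx : 0 < s x := (hpos x (hsub hxδ)).1 hxΩ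
  have hsy : 0 < s y := (hpos y (hsub hyδ)).1 hyΩ
  set D := regNorm (Metric.infDist y Ωᶜ) (x - y)
  have hnorm : ‖x - y‖ ≤ D := norm_le_regNorm _ _
  have hcoord (i : Fin 3) : |(A x) i - (A y) i| ≤ D :=
    calc |(A x) i - (A y) i| = ‖(A (x - y)) i‖ := by rw [map_sub]; rfl
      _ ≤ D := (PiLp.norm_apply_le _ i).trans ((A.norm_map _).trans_le hnorm)
  have hsum : s x + s y ≤ 3 * K * D := by
    have hy : s y ≤ K * D := (le_mul_infDist_compl hΩ hlip hx₀
      (fun z hz hzΩ => not_lt.1 ((hpos z hz).not.1 hzΩ)) hyδ).trans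
      (mul_le_mul_of_nonneg_left ((le_abs_self _).trans (abs_le_regNorm _ _)) K.2)
    have hxy : |s x - s y| ≤ K * D := (hlip.dist_le_mul x (hsub hxδ) y (hsub hyδ)).trans
      (mul_le_mul_of_nonneg_left (dist_eq_norm x y ▸ hnorm) K.2)
    linarith [(abs_le.1 hxy).2]
  have hD : 0 < D := pos_of_mul_pos_right ((add_pos hsx hsy).trans_le hsum) (by positivity)
  rw [halfSpaceKernel, if_pos ⟨hsx, hsy⟩]
  refine ofReal_inv_cube_le_mul_rpow (add_pos hsx hsy) (abs_nonneg _) (abs_nonneg _)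
    ?_ ?_ hD
  · change _ + (s x + s y) ≤ _
    linarith [show |(flattenGraph A γ x).1.1 - (flattenGraph A γ y).1.1| ≤ D from hcoord 0]
  · change _ + (s x + s y) ≤ _
    linarith [show |(flattenGraph A γ x).1.2 - (flattenGraph A γ y).1.2| ≤ D from hcoord 1]

lemma isLpKernel_const {α : Type*} [MeasurableSpace α] {p q : ℝ} (hpq : p.HolderConjugate q)
    (μ : Measure α) [IsFiniteMeasure μ] {c : ℝ≥0∞} (hc : c ≠ ⊤) :
    IsLpKernel p μ fun _ _ => c := by
  refine IsLpKernel.of_schur hpq measurable_const (w := fun _ => 1) measurable_const (by simp)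
    (by simp) (C := c * μ Set.univ) (by finiteness) ?_ ?_ <;> simp

lemma exists_forall_mem_ball_of_regNorm_infDist_lt {Ω : Set R3} (hΩ : Bornology.IsBounded Ω)
    {δ : frontier Ω → ℝ} (hδ : ∀ x₀, 0 < δ x₀) :
    ∃ (t : Finset (frontier Ω)) (ε : ℝ), 0 < ε ∧ ∀ x, ∀ y ∈ Ω,
      regNorm (Metric.infDist y Ωᶜ) (x - y) < ε →
        ∃ x₀ ∈ t, x ∈ Metric.ball (x₀ : R3) (δ x₀) ∧ y ∈ Metric.ball (x₀ : R3) (δ x₀) := by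
  have hcompact : IsCompact (frontier Ω) := Metric.isCompact_of_isClosed_isBounded
    isClosed_frontier (hΩ.closure.subset frontier_subset_closure)
  obtain ⟨t, ht⟩ := hcompact.elim_finite_subcover
    (fun x₀ : frontier Ω => Metric.ball (x₀ : R3) (δ x₀)) (fun _ => Metric.isOpen_ball)
    fun x hx => Set.mem_iUnion.2 ⟨⟨x, hx⟩, Metric.mem_ball_self (hδ _)⟩
  obtain ⟨ε, hε, hball⟩ := lebesgue_number_lemma_of_metric
    (c := fun x₀ : t => Metric.ball ((x₀ : frontier Ω) : R3) (δ x₀)) hcompact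
    (fun _ => Metric.isOpen_ball) (by simpa [Set.subset_def] using ht)
  refine ⟨t, ε / 2, half_pos hε, fun x y hy hD => ?_⟩
  have hne : Ω ≠ Set.univ := fun h => NormedSpace.unbounded_univ ℝ R3 (h ▸ hΩ)
  obtain ⟨z, hz, hyz⟩ := exists_mem_frontier_infDist_compl_eq_dist hy hne
  obtain ⟨x₀, hx₀⟩ := hball z hz
  have hyz_lt : dist y z < ε / 2 :=
    hyz ▸ ((le_abs_self _).trans (abs_le_regNorm _ _)).trans_lt hD
  have hxy_lt : dist x y < ε / 2 := dist_eq_norm x y ▸ (norm_le_regNorm _ _).trans_lt hD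
  exact ⟨x₀, x₀.2, hx₀ (Metric.mem_ball.2 (by linarith [dist_triangle x y z])),
    hx₀ (Metric.mem_ball.2 (by linarith))⟩

lemma IsBoundedLipschitzDomain.exists_isLpKernel_boundaryKernel_le {Ω : Set R3}
    (hΩ : IsBoundedLipschitzDomain Ω) {p q : ℝ} (hpq : p.HolderConjugate q) {x₀ : R3}
    (hx₀ : x₀ ∈ frontier Ω) :
    ∃ δ : ℝ, 0 < δ ∧ ∃ k, IsLpKernel p (volume.restrict Ω) k ∧
      ∀ x ∈ Ω ∩ Metric.ball x₀ δ, ∀ y ∈ Ω ∩ Metric.ball x₀ δ, boundaryKernel Ω x y ≤ k x y := by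
  obtain ⟨A, r, γ, hr, hγ, hgraph⟩ := hΩ.boundary x₀ hx₀
  have hx₀Ω : x₀ ∉ Ω := (hΩ.isOpen.frontier_eq ▸ hx₀).2
  obtain ⟨δ, hδ, C, hC, hle⟩ := exists_boundaryKernel_le_halfSpaceKernel hΩ.isOpen hx₀Ω hr hγ hgraph
  have hflat := measurePreserving_flattenGraph A hγ.continuous
  exact ⟨δ, hδ, _, (isLpKernel_halfSpaceKernel_comp hpq hflat Ω).const_mul hpq.nonneg hC, hle⟩

lemma IsBoundedLipschitzDomain.isLpKernel_boundaryKernel {Ω : Set R3}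
    (hΩ : IsBoundedLipschitzDomain Ω) {p q : ℝ} (hpq : p.HolderConjugate q) :
    IsLpKernel p (volume.restrict Ω) (boundaryKernel Ω) := by
  have : IsFiniteMeasure (volume.restrict Ω) := ⟨by simpa using hΩ.isBounded.measure_lt_top⟩
  choose δ hδ k hk hle using
    fun x₀ : frontier Ω => hΩ.exists_isLpKernel_boundaryKernel_le hpq x₀.2
  obtain ⟨t, ε, hε, hball⟩ := exists_forall_mem_ball_of_regNorm_infDist_lt hΩ.isBounded hδ
  have hsum := (IsLpKernel.finsetSum t (fun x₀ _ => hk x₀) hpq.lt.le).add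
    (isLpKernel_const hpq (volume.restrict Ω) (c := ENNReal.ofReal ((ε ^ 3)⁻¹))
      ENNReal.ofReal_ne_top) hpq.lt.le
  refine hsum.mono hpq.nonneg (measurable_boundaryKernel Ω) ?_
  have hmem := ae_restrict_mem (μ := (volume : Measure R3)) hΩ.isOpen.measurableSet
  filter_upwards [hmem] with x hx
  filter_upwards [hmem] with y hy
  rcases lt_or_ge (regNorm (Metric.infDist y Ωᶜ) (x - y)) ε with hD | hD
  · obtain ⟨x₀, hx₀, hxδ, hyδ⟩ := hball x y hy hD
    exact ((hle x₀ x ⟨hx, hxδ⟩ y ⟨hy, hyδ⟩).trans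
      (Finset.single_le_sum (f := fun x₀ => k x₀ x y) (fun _ _ => zero_le) hx₀)).trans le_self_add
  · have hle_const : boundaryKernel Ω x y ≤ ENNReal.ofReal ((ε ^ 3)⁻¹) := by
      unfold boundaryKernel
      gcongr
    exact hle_const.trans le_add_self

lemma lintegral_ofReal_inv_norm_sub_sq_le (s : Set R3) (x : R3) :
    ∫⁻ y in s, ENNReal.ofReal ((‖x - y‖ ^ 2)⁻¹) ≤
      (∫⁻ z in Metric.ball (0 : R3) 1, ENNReal.ofReal ((‖z‖ ^ 2)⁻¹)) + volume s := by
  set k : R3 → ℝ≥0∞ := (Metric.ball (0 : R3) 1).indicator fun z => ENNReal.ofReal ((‖z‖ ^ 2)⁻¹)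
  have hle (z : R3) : ENNReal.ofReal ((‖z‖ ^ 2)⁻¹) ≤ k z + 1 := by
    by_cases hz : z ∈ Metric.ball (0 : R3) 1
    · rw [show k z = _ from Set.indicator_of_mem hz _]
      exact le_self_add
    · refine le_add_left (ENNReal.ofReal_le_one.2 (inv_le_one_of_one_le₀ (one_le_pow₀ ?_)))
      simpa using hz
  calc ∫⁻ y in s, ENNReal.ofReal ((‖x - y‖ ^ 2)⁻¹)
      ≤ ∫⁻ y in s, (k (x - y) + 1) := lintegral_mono fun y => hle (x - y)
    _ = (∫⁻ y in s, k (x - y)) + volume s := by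
        rw [lintegral_add_right _ measurable_const, setLIntegral_one]
    _ ≤ (∫⁻ y, k (x - y)) + volume s := by gcongr; exact Measure.restrict_le_self
    _ = _ := by rw [lintegral_sub_left_eq_self k x, lintegral_indicator measurableSet_ball]

lemma isLpKernel_inv_norm_sub_sq {s : Set R3} (hs : Bornology.IsBounded s) {p q : ℝ}
    (hpq : p.HolderConjugate q) :
    IsLpKernel p (volume.restrict s) fun x y => ENNReal.ofReal ((‖x - y‖ ^ 2)⁻¹) := by
  have hball : ∫⁻ z in Metric.ball (0 : R3) 1, ENNReal.ofReal ((‖z‖ ^ 2)⁻¹) ≠ ⊤ :=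
    ((locallyIntegrable_inv_norm_sq.integrableOn_isCompact
      (isCompact_closedBall 0 1)).mono_set Metric.ball_subset_closedBall).lintegral_lt_top.ne
  refine IsLpKernel.of_schur hpq (by fun_prop) (w := fun _ => 1) measurable_const (by simp)
    (by simp) (ENNReal.add_ne_top.2 ⟨hball, (hs.measure_lt_top (μ := volume)).ne⟩)
    (fun x => ?_) fun y => ?_
  · simpa using lintegral_ofReal_inv_norm_sub_sq_le s x
  · simp only [norm_sub_rev _ y]
    simpa using lintegral_ofReal_inv_norm_sub_sq_le s y

/-! ### Lipschitz functions as test functions for the weak divergence -/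

section Mollification

open ContinuousLinearMap
open scoped Convolution

variable {E F : Type*} [NormedAddCommGroup E] [NormedSpace ℝ E] [FiniteDimensional ℝ E]
  [MeasurableSpace E] [BorelSpace E] {μ : Measure E} [μ.IsAddHaarMeasure]
  [NormedAddCommGroup F] [NormedSpace ℝ F] (φ : ContDiffBump (0 : E))

lemma norm_normed_convolution_le {f : E → F} {M : ℝ} (hM : ∀ x, ‖f x‖ ≤ M) (x : E) :
    ‖(φ.normed μ ⋆[lsmul ℝ ℝ, μ] f) x‖ ≤ M := by
  refine (norm_integral_le_of_norm_le (g := fun t => φ.normed μ t * M)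
    (φ.integrable_normed.mul_const M) (Eventually.of_forall fun t => ?_)).trans_eq ?_
  · rw [lsmul_apply, norm_smul, Real.norm_of_nonneg (φ.nonneg_normed t)]
    exact mul_le_mul_of_nonneg_left (hM _) (φ.nonneg_normed t)
  · rw [integral_mul_const, φ.integral_normed, one_mul]

lemma tsupport_normed_convolution_subset (f : E → F) :
    tsupport (φ.normed μ ⋆[lsmul ℝ ℝ, μ] f) ⊆ Metric.cthickening φ.rOut (tsupport f) := by
  refine closure_minimal ((support_convolution_subset _).trans ?_) Metric.isClosed_cthickening
  rintro _ ⟨a, ha, b, hb, rfl⟩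
  rw [φ.support_normed_eq, mem_ball_zero_iff] at ha
  refine Metric.mem_cthickening_of_dist_le _ b _ _ (subset_tsupport _ hb) ?_
  simpa [dist_eq_norm] using ha.le

lemma fderiv_normed_convolution [FiniteDimensional ℝ F] {f : E → F} {L : ℝ≥0}
    (hf : LipschitzWith L f) (x : E) :
    fderiv ℝ (φ.normed μ ⋆[lsmul ℝ ℝ, μ] f) x = (φ.normed μ ⋆[lsmul ℝ ℝ, μ] fderiv ℝ f) x := by
  have : CompleteSpace F := FiniteDimensional.complete ℝ F
  have hφ : Continuous (φ.normed μ) := (φ.contDiff_normed (n := 0)).continuous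
  have hcont (y : E) : Continuous fun t => φ.normed μ t • f (y - t) :=
    hφ.smul (hf.continuous.comp (by fun_prop))
  have hlip (t : E) :
      LipschitzOnWith (Real.nnabs (φ.normed μ t * L)) (fun y => φ.normed μ t • f (y - t))
        Set.univ := by
    refine LipschitzOnWith.of_dist_le_mul fun y _ z _ => ?_
    have hfyz := hf.dist_le_mul (y - t) (z - t)
    rw [dist_sub_right] at hfyz
    rw [dist_eq_norm, ← smul_sub, norm_smul, Real.coe_nnabs, ← dist_eq_norm, abs_mul,
      Real.norm_eq_abs, NNReal.abs_eq, mul_assoc]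
    exact mul_le_mul_of_nonneg_left hfyz (abs_nonneg _)
  have hderiv : ∀ᵐ t ∂μ, HasFDerivAt (fun y => φ.normed μ t • f (y - t))
      (φ.normed μ t • fderiv ℝ f (x - t)) x := by
    filter_upwards [(quasiMeasurePreserving_sub_left_of_right_invariant μ x).ae
      hf.ae_differentiableAt] with t ht
    exact ((hasFDerivAt_comp_sub t).2 ht.hasFDerivAt).const_smul _
  exact (hasFDerivAt_integral_of_dominated_loc_of_lip
    (bound := fun t => φ.normed μ t * L) univ_mem
    (Eventually.of_forall fun y => (hcont y).aestronglyMeasurable)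
    ((hcont x).integrable_of_hasCompactSupport φ.hasCompactSupport_normed.smul_right)
    (hφ.aestronglyMeasurable.smul
      ((measurable_fderiv ℝ f).comp (measurable_const.sub measurable_id)).aestronglyMeasurable)
    (Eventually.of_forall hlip) (φ.integrable_normed.mul_const _) hderiv).2.fderiv

end Mollification

section WeakDivergence

variable {Ω : Set R3} {g : R3 → C3} {d : R3 → ℂ}

lemma integral_mul_eq_neg_integral_grad3_of_tendsto (hg : IntegrableOn g Ω)
    (hd : IntegrableOn d Ω) {F : ℕ → R3 → ℂ} {f : R3 → ℂ} {M L : ℝ}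
    (hF : ∀ n, Continuous (F n)) (hM : ∀ n x, ‖F n x‖ ≤ M) (hL : ∀ n x, ‖fderiv ℝ (F n) x‖ ≤ L)
    (hlim : ∀ᵐ x ∂volume.restrict Ω, Tendsto (fun n => F n x) atTop (𝓝 (f x)))
    (hlim' : ∀ᵐ x ∂volume.restrict Ω,
      Tendsto (fun n => fderiv ℝ (F n) x) atTop (𝓝 (fderiv ℝ f x)))
    (h : ∀ n, ∫ x in Ω, F n x * d x = -∫ x in Ω, ∑ i, grad3 (F n) x i * g x i) :
    ∫ x in Ω, f x * d x = -∫ x in Ω, ∑ i, grad3 f x i * g x i := by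
  have hgrad (n : ℕ) (x : R3) (i : Fin 3) : ‖grad3 (F n) x i‖ ≤ L :=
    ((fderiv ℝ (F n) x).le_opNorm _).trans (by simpa using hL n x)
  have hleft : Tendsto (fun n => ∫ x in Ω, F n x * d x) atTop (𝓝 (∫ x in Ω, f x * d x)) := by
    refine tendsto_integral_of_dominated_convergence (fun x => M * ‖d x‖)
      (fun n => (hF n).aestronglyMeasurable.mul hd.1) (hd.norm.const_mul M)
      (fun n => Eventually.of_forall fun x => ?_) ?_
    · rw [norm_mul]
      exact mul_le_mul_of_nonneg_right (hM n x) (norm_nonneg _)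
    · filter_upwards [hlim] with x hx using hx.mul_const _
  have hright : Tendsto (fun n => ∫ x in Ω, ∑ i, grad3 (F n) x i * g x i) atTop
      (𝓝 (∫ x in Ω, ∑ i, grad3 f x i * g x i)) := by
    refine tendsto_integral_of_dominated_convergence (fun x => ∑ i, L * ‖g x i‖) (fun n => ?_)
      (integrable_finsetSum _ fun i _ => (hg.eval i).norm.const_mul _)
      (fun n => Eventually.of_forall fun x => ?_) ?_
    · exact Finset.aestronglyMeasurable_fun_sum _ fun i _ =>
        (measurable_fderiv_apply_const ℝ (F n) _).aestronglyMeasurable.mul (hg.eval i).1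
    · refine (norm_sum_le _ _).trans (Finset.sum_le_sum fun i _ => ?_)
      rw [norm_mul]
      exact mul_le_mul_of_nonneg_right (hgrad n x i) (norm_nonneg _)
    · filter_upwards [hlim'] with x hx
      exact tendsto_finsetSum _ fun i _ =>
        (((ContinuousLinearMap.apply ℝ ℂ _).continuous.tendsto _).comp hx).mul_const _
  exact tendsto_nhds_unique (hleft.congr h) hright.neg

lemma HasWeakDiv.integral_lipschitz_of_hasCompactSupport (h : HasWeakDiv Ω g d)
    (hg : IntegrableOn g Ω) (hd : IntegrableOn d Ω) (hΩ : IsOpen Ω) {f : R3 → ℂ} {L : ℝ≥0}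
    (hf : LipschitzWith L f) (hfc : HasCompactSupport f) (hfΩ : tsupport f ⊆ Ω) :
    ∫ x in Ω, f x * d x = -∫ x in Ω, ∑ i, grad3 f x i * g x i := by
  obtain ⟨δ, hδ, hδΩ⟩ := hfc.isCompact.exists_cthickening_subset_open hΩ hfΩ
  let φ (n : ℕ) : ContDiffBump (0 : R3) :=
    { rIn := δ / 2 / (n + 1)
      rOut := δ / (n + 1)
      rIn_pos := by positivity
      rIn_lt_rOut := by gcongr; linarith }
  have hrOut_le (n : ℕ) : (φ n).rOut ≤ δ := div_le_self hδ.le (by simp)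
  have hrOut : Tendsto (fun n => (φ n).rOut) atTop (𝓝 0) := by
    simpa [φ, div_eq_mul_inv] using
      (tendsto_one_div_add_atTop_nhds_zero_nat (𝕜 := ℝ)).const_mul δ
  have htest (n : ℕ) : IsTestFunction Ω
      (convolution ((φ n).normed volume) f (ContinuousLinearMap.lsmul ℝ ℝ) volume) :=
    ⟨(φ n).hasCompactSupport_normed.contDiff_convolution_left _ (φ n).contDiff_normed
        hf.continuous.locallyIntegrable,
      (φ n).hasCompactSupport_normed.convolution _ hfc,
      ((tsupport_normed_convolution_subset (φ n) f).trans
        (Metric.cthickening_mono (hrOut_le n) _)).trans hδΩ⟩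
  obtain ⟨M, hM⟩ := hf.continuous.bounded_above_of_compact_support hfc
  have hfderiv (x : R3) : ‖fderiv ℝ f x‖ ≤ L := norm_fderiv_le_of_lipschitz ℝ hf
  have hfderiv_int : LocallyIntegrable (fderiv ℝ f) :=
    (locallyIntegrable_const (L : ℝ)).mono (measurable_fderiv ℝ f).aestronglyMeasurable
      (Eventually.of_forall fun x => by simpa using hfderiv x)
  refine integral_mul_eq_neg_integral_grad3_of_tendsto (M := M) (L := L) hg hd
    (fun n => (htest n).1.continuous) (fun n => norm_normed_convolution_le (φ n) hM) (fun n x => ?_)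
    (Eventually.of_forall
      (ContDiffBump.convolution_tendsto_right_of_continuous hrOut hf.continuous))
    ?_ fun n => h.2.2 _ (htest n)
  · rw [fderiv_normed_convolution (φ n) hf]
    exact norm_normed_convolution_le (φ n) hfderiv x
  · simp only [fderiv_normed_convolution (φ _) hf]
    refine ae_restrict_of_ae (ContDiffBump.ae_convolution_tendsto_right_of_locallyIntegrable
      (K := 2) hrOut (Eventually.of_forall fun n => le_of_eq ?_) hfderiv_int)
    change δ / (n + 1) = 2 * (δ / 2 / (n + 1))
    ring

end WeakDivergence

/-- The piecewise linear cut-off of `t` which is `0` for `t ≤ ε` and `1` for `t ≥ 2ε`. -/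
noncomputable def cutoff (ε t : ℝ) : ℝ := min 1 (max 0 (t / ε - 1))

lemma cutoff_nonneg (ε t : ℝ) : 0 ≤ cutoff ε t := le_min zero_le_one (le_max_left _ _)

lemma cutoff_le_one (ε t : ℝ) : cutoff ε t ≤ 1 := min_le_left _ _

lemma cutoff_eq_one {ε t : ℝ} (hε : 0 < ε) (ht : 2 * ε ≤ t) : cutoff ε t = 1 := by
  have ht' : 2 ≤ t / ε := (le_div_iff₀ hε).2 ht
  exact min_eq_left (le_max_of_le_right (by linarith))

lemma cutoff_eq_zero {ε t : ℝ} (hε : 0 < ε) (ht : t ≤ ε) : cutoff ε t = 0 := by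
  have ht' : t / ε ≤ 1 := (div_le_one hε).2 ht
  rw [cutoff, max_eq_left (by linarith), min_eq_right zero_le_one]

lemma abs_cutoff_sub_le {ε : ℝ} (hε : 0 < ε) (s t : ℝ) :
    |cutoff ε s - cutoff ε t| ≤ |s - t| / ε :=
  calc |cutoff ε s - cutoff ε t| ≤ |(s / ε - 1) - (t / ε - 1)| :=
        (abs_min_sub_min_le_max _ _ _ _).trans <| max_le (by simp) <|
          (abs_max_sub_max_le_max _ _ _ _).trans (max_le (by simp) le_rfl)
    _ = |s - t| / ε := by rw [sub_sub_sub_cancel_right, ← sub_div, abs_div, abs_of_pos hε]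

section Cutoff

variable {E : Type*} [PseudoMetricSpace E] {s : Set E} {f : E → ℂ} {L : ℝ≥0}

lemma norm_le_mul_infDist_of_lipschitzWith [ProperSpace E] (hs : s.Nonempty) (hsc : IsClosed s)
    (hf : LipschitzWith L f) (hfs : ∀ x ∈ s, f x = 0) (x : E) :
    ‖f x‖ ≤ L * Metric.infDist x s := by
  obtain ⟨z, hz, hxz⟩ := hsc.exists_infDist_eq_dist hs x
  rw [hxz]
  simpa [hfs z hz] using hf.dist_le_mul x z

lemma lipschitzWith_cutoff_infDist_mul [ProperSpace E] (hs : s.Nonempty) (hsc : IsClosed s)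
    (hf : LipschitzWith L f) (hfs : ∀ x ∈ s, f x = 0) {ε : ℝ} (hε : 0 < ε) :
    LipschitzWith (3 * L) fun x => (cutoff ε (Metric.infDist x s) : ℂ) * f x := by
  refine LipschitzWith.of_dist_le_mul fun x y => ?_
  wlog hxy : Metric.infDist y s ≤ Metric.infDist x s generalizing x y
  · rw [dist_comm, dist_comm x y]
    exact this y x (le_of_not_ge hxy)
  set a := cutoff ε (Metric.infDist x s)
  set b := cutoff ε (Metric.infDist y s)
  have hsplit : (a : ℂ) * f x - b * f y = a * (f x - f y) + ((a - b : ℝ) : ℂ) * f y := by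
    push_cast; ring
  have hfirst : ‖(a : ℂ) * (f x - f y)‖ ≤ L * dist x y := by
    rw [norm_mul, Complex.norm_of_nonneg (cutoff_nonneg _ _), ← dist_eq_norm]
    exact (mul_le_of_le_one_left dist_nonneg (cutoff_le_one _ _)).trans (hf.dist_le_mul x y)
  have hsecond : ‖((a - b : ℝ) : ℂ) * f y‖ ≤ 2 * L * dist x y := by
    rw [norm_mul, Complex.norm_real, Real.norm_eq_abs]
    rcases le_total (2 * ε) (Metric.infDist y s) with hy | hy
    · have ha : a = 1 := cutoff_eq_one hε (hy.trans hxy)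
      have hb : b = 1 := cutoff_eq_one hε hy
      rw [ha, hb, sub_self, abs_zero, zero_mul]
      positivity
    · have hab : |a - b| ≤ dist x y / ε := by
        refine (abs_cutoff_sub_le hε _ _).trans ?_
        gcongr
        simpa [Real.dist_eq] using (Metric.lipschitz_infDist_pt s).dist_le_mul x y
      have hfy : ‖f y‖ ≤ L * (2 * ε) :=
        (norm_le_mul_infDist_of_lipschitzWith hs hsc hf hfs y).trans
          (mul_le_mul_of_nonneg_left hy L.2)
      calc |a - b| * ‖f y‖ ≤ dist x y / ε * (L * (2 * ε)) := by gcongr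
        _ = 2 * L * dist x y := by field_simp
  rw [dist_eq_norm, hsplit, NNReal.coe_mul, NNReal.coe_ofNat]
  linarith [norm_add_le ((a : ℂ) * (f x - f y)) (((a - b : ℝ) : ℂ) * f y)]

lemma eventually_cutoff_infDist_mul_eventuallyEq (hs : s.Nonempty) (hsc : IsClosed s)
    (f : E → ℂ) {x : E} (hx : x ∉ s) :
    ∀ᶠ ε : ℝ in 𝓝[>] 0, (fun y => (cutoff ε (Metric.infDist y s) : ℂ) * f y) =ᶠ[𝓝 x] f := by
  have hpos : 0 < Metric.infDist x s := (hsc.notMem_iff_infDist_pos hs).1 hx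
  filter_upwards [Ioo_mem_nhdsGT (half_pos hpos)] with ε hε
  have hε₂ : 2 * ε < Metric.infDist x s := by linarith [hε.2]
  filter_upwards [(Metric.continuous_infDist_pt s).continuousAt.eventually_const_lt hε₂] with y hy
  rw [cutoff_eq_one hε.1 hy.le, Complex.ofReal_one, one_mul]

lemma tsupport_cutoff_infDist_mul_subset (s : Set E) (f : E → ℂ) {ε : ℝ} (hε : 0 < ε) :
    tsupport (fun y => (cutoff ε (Metric.infDist y s) : ℂ) * f y) ⊆ sᶜ := by
  have hsub : tsupport (fun y => (cutoff ε (Metric.infDist y s) : ℂ) * f y) ⊆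
      {y | ε ≤ Metric.infDist y s} := by
    refine closure_minimal (fun y hy => ?_)
      (isClosed_le continuous_const (Metric.continuous_infDist_pt _))
    by_contra hlt
    exact hy (by simp [cutoff_eq_zero hε (not_le.1 hlt).le])
  intro y hy hys
  have hle : ε ≤ Metric.infDist y s := hsub hy
  linarith [Metric.infDist_zero_of_mem hys]

end Cutoff

section WeakDivergence

variable {Ω : Set R3} {g : R3 → C3} {d : R3 → ℂ}

lemma HasWeakDiv.integral_lipschitz (h : HasWeakDiv Ω g d) (hg : IntegrableOn g Ω)
    (hd : IntegrableOn d Ω) (hΩ : IsOpen Ω) (hΩb : Bornology.IsBounded Ω) {f : R3 → ℂ} {L : ℝ≥0}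
    (hf : LipschitzWith L f) (hfΩ : ∀ x ∉ Ω, f x = 0) :
    ∫ x in Ω, f x * d x = -∫ x in Ω, ∑ i, grad3 f x i * g x i := by
  have hne : (Ωᶜ).Nonempty :=
    Set.nonempty_compl.2 fun huniv => NormedSpace.unbounded_univ ℝ R3 (huniv ▸ hΩb)
  have hcl : IsClosed Ωᶜ := hΩ.isClosed_compl
  let ε (n : ℕ) : ℝ := 1 / (n + 1)
  let F (n : ℕ) (x : R3) : ℂ := (cutoff (ε n) (Metric.infDist x Ωᶜ) : ℂ) * f x
  have hε (n : ℕ) : 0 < ε n := by positivity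
  have hε_lim : Tendsto ε atTop (𝓝[>] 0) :=
    tendsto_nhdsWithin_iff.2 ⟨tendsto_one_div_add_atTop_nhds_zero_nat, Eventually.of_forall hε⟩
  have hlip (n : ℕ) : LipschitzWith (3 * L) (F n) :=
    lipschitzWith_cutoff_infDist_mul hne hcl hf hfΩ (hε n)
  have hsupp (n : ℕ) : tsupport (F n) ⊆ Ω :=
    (tsupport_cutoff_infDist_mul_subset Ωᶜ f (hε n)).trans_eq (compl_compl Ω)
  have hcomp (n : ℕ) : HasCompactSupport (F n) :=
    Metric.isCompact_of_isClosed_isBounded (isClosed_tsupport _) (hΩb.subset (hsupp n))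
  have heq : ∀ᵐ x ∂volume.restrict Ω, ∀ᶠ n in atTop, F n =ᶠ[𝓝 x] f := by
    filter_upwards [ae_restrict_mem hΩ.measurableSet] with x hx
    exact hε_lim.eventually
      (eventually_cutoff_infDist_mul_eventuallyEq hne hcl f (Set.notMem_compl_iff.2 hx))
  have hfc : HasCompactSupport f :=
    HasCompactSupport.intro hΩb.isCompact_closure fun x hx =>
      hfΩ x (mt (@subset_closure _ _ Ω x) hx)
  obtain ⟨M, hM⟩ := hf.continuous.bounded_above_of_compact_support hfc
  refine integral_mul_eq_neg_integral_grad3_of_tendsto (M := M) hg hd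
    (fun n => (hlip n).continuous) (fun n x => ?_)
    (fun n x => norm_fderiv_le_of_lipschitz ℝ (hlip n)) ?_ ?_
    fun n => h.integral_lipschitz_of_hasCompactSupport hg hd hΩ (hlip n) (hcomp n) (hsupp n)
  · rw [norm_mul, Complex.norm_of_nonneg (cutoff_nonneg _ _)]
    exact (mul_le_of_le_one_left (norm_nonneg _) (cutoff_le_one _ _)).trans (hM x)
  · filter_upwards [heq] with x hx
    exact tendsto_const_nhds.congr' (hx.mono fun n hn => hn.eq_of_nhds.symm)
  · filter_upwards [heq] with x hx
    exact tendsto_const_nhds.congr' (hx.mono fun n hn => hn.fderiv_eq.symm)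

lemma lipschitzWith_indicator_of_frontier {E F : Type*} [NormedAddCommGroup E] [NormedSpace ℝ E]
    [FiniteDimensional ℝ E] [NormedAddCommGroup F] {Ω : Set E} (hΩ : Ω ≠ Set.univ) {f : E → F}
    {L : ℝ≥0} (hf : LipschitzOnWith L f (closure Ω)) (hf₀ : ∀ x ∈ frontier Ω, f x = 0) :
    LipschitzWith L (Ω.indicator f) := by
  have hle {x y : E} (hx : x ∈ Ω) (hy : y ∉ Ω) : ‖f x‖ ≤ L * dist x y := by
    obtain ⟨z, hz, hxz⟩ := exists_mem_frontier_infDist_compl_eq_dist hx hΩ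
    calc ‖f x‖ = dist (f x) (f z) := by rw [hf₀ z hz, dist_zero_right]
      _ ≤ L * dist x z := hf.dist_le_mul x (subset_closure hx) z (frontier_subset_closure hz)
      _ ≤ L * dist x y := by
        rw [← hxz]
        exact mul_le_mul_of_nonneg_left (Metric.infDist_le_dist_of_mem hy) L.2
  refine LipschitzWith.of_dist_le_mul fun x y => ?_
  by_cases hx : x ∈ Ω <;> by_cases hy : y ∈ Ω
  · simpa [hx, hy] using hf.dist_le_mul x (subset_closure hx) y (subset_closure hy)
  · simpa [hx, hy] using hle hx hy
  · rw [dist_comm, dist_comm x y]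
    simpa [hx, hy] using hle hy hx
  · simp only [hx, hy, not_false_eq_true, Set.indicator_of_notMem, dist_self]
    positivity

lemma HasWeakDiv.integral_lipschitzOn (h : HasWeakDiv Ω g d) (hg : IntegrableOn g Ω)
    (hd : IntegrableOn d Ω) (hΩ : IsOpen Ω) (hΩb : Bornology.IsBounded Ω) {f : R3 → ℂ} {L : ℝ≥0}
    (hf : LipschitzOnWith L f (closure Ω)) (hf₀ : ∀ x ∈ frontier Ω, f x = 0) :
    ∫ x in Ω, f x * d x = -∫ x in Ω, ∑ i, grad3 f x i * g x i := by
  have huniv : Ω ≠ Set.univ := fun h => NormedSpace.unbounded_univ ℝ R3 (h ▸ hΩb)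
  have heq : ∀ x ∈ Ω, Ω.indicator f =ᶠ[𝓝 x] f := fun x hx => by
    filter_upwards [hΩ.mem_nhds hx] with y hy using Set.indicator_of_mem hy f
  calc ∫ x in Ω, f x * d x = ∫ x in Ω, Ω.indicator f x * d x :=
        setIntegral_congr_fun hΩ.measurableSet fun x hx => by
          simp only [(heq x hx).eq_of_nhds]
    _ = -∫ x in Ω, ∑ i, grad3 (Ω.indicator f) x i * g x i :=
        h.integral_lipschitz hg hd hΩ hΩb (lipschitzWith_indicator_of_frontier huniv hf hf₀)
          fun x hx => Set.indicator_of_notMem hx f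
    _ = -∫ x in Ω, ∑ i, grad3 f x i * g x i := by
        congr 1
        exact setIntegral_congr_fun hΩ.measurableSet fun x hx => by
          simp only [grad3, (heq x hx).fderiv_eq]

end WeakDivergence

/-! ### The regularised kernels -/

/-- The kernel `∂_i θ(x - y)`, with `|x - y|` replaced by `√(|x - y|² + ρ(y)²)` in its radial
factor. It is `∂_i θ(x - y)` itself wherever `ρ(y) = 0`. -/
noncomputable def thetaGrad (lam : ℂ) (ρ : R3 → ℝ) (i : Fin 3) (x y : R3) : ℂ :=
  regThetaGrad lam i (ρ y) (x - y)

/-- The derivative of `thetaGrad lam ρ i x` at a point `y` where `ρ` is differentiable. -/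
noncomputable def thetaGradDeriv (lam : ℂ) (ρ : R3 → ℝ) (i : Fin 3) (x y : R3) : R3 →L[ℝ] ℂ :=
  helmholtzSlope lam (regNorm (ρ y) (x - y)) •
      Complex.ofRealCLM.comp ((EuclideanSpace.proj i : R3 →L[ℝ] ℝ).comp
        (-ContinuousLinearMap.id ℝ R3)) +
    (((x - y) i : ℂ) * ((regNorm (ρ y) (x - y) : ℂ)⁻¹ *
      helmholtzSlopeDeriv lam (regNorm (ρ y) (x - y)))) •
      Complex.ofRealCLM.comp ((innerSL ℝ (x - y)).comp (-ContinuousLinearMap.id ℝ R3) +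
        ρ y • fderiv ℝ ρ y)

/-- The partial derivative `∂_{y_j}` of `thetaGrad lam ρ i x y`. -/
noncomputable def thetaHess (lam : ℂ) (ρ : R3 → ℝ) (i j : Fin 3) (x y : R3) : ℂ :=
  thetaGradDeriv lam ρ i x y (EuclideanSpace.single j (1 : ℝ))

section ThetaGrad

variable (lam : ℂ) {ρ : R3 → ℝ}

lemma hasFDerivAt_thetaGrad (i : Fin 3) {x y : R3} (hρ : DifferentiableAt ℝ ρ y)
    (h : 0 < regNorm (ρ y) (x - y)) :
    HasFDerivAt (thetaGrad lam ρ i x) (thetaGradDeriv lam ρ i x y) y :=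
  hasFDerivAt_regThetaGrad lam i hρ.hasFDerivAt (by simpa using (hasFDerivAt_id y).const_sub x) h

lemma measurable_thetaGrad (hρ : Continuous ρ) (i : Fin 3) :
    Measurable (Function.uncurry (thetaGrad lam ρ i)) := by
  have hcoord : Measurable fun q : R3 × R3 => ((q.1 - q.2) i : ℂ) := by fun_prop
  exact hcoord.mul ((measurable_helmholtzSlope lam).comp (by fun_prop))

lemma measurable_thetaGradDeriv (hρ : Continuous ρ) (i : Fin 3) :
    Measurable (Function.uncurry (thetaGradDeriv lam ρ i)) := by
  have hD : Measurable fun q : R3 × R3 => regNorm (ρ q.2) (q.1 - q.2) := by fun_prop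
  have hcoord : Measurable fun q : R3 × R3 => ((q.1 - q.2) i : ℂ) := by fun_prop
  have hinner : Measurable fun q : R3 × R3 =>
      (innerSL ℝ (q.1 - q.2)).comp (-ContinuousLinearMap.id ℝ R3) := by fun_prop
  have hderiv : Measurable fun q : R3 × R3 => ρ q.2 • fderiv ℝ ρ q.2 :=
    (hρ.measurable.smul (measurable_fderiv ℝ ρ)).comp measurable_snd
  have hcomp : Continuous fun T : R3 →L[ℝ] ℝ => Complex.ofRealCLM.comp T := by fun_prop
  exact (((measurable_helmholtzSlope lam).comp hD).smul_const _).add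
    ((hcoord.mul ((Complex.measurable_ofReal.comp hD).inv.mul
      ((measurable_helmholtzSlopeDeriv lam).comp hD))).smul
        (hcomp.measurable.comp (hinner.add hderiv)))

lemma measurable_thetaHess (hρ : Continuous ρ) (i j : Fin 3) :
    Measurable (Function.uncurry (thetaHess lam ρ i j)) :=
  (measurable_thetaGradDeriv lam hρ i).apply_continuousLinearMap _

lemma exists_norm_thetaGradDeriv_le (hρ : LipschitzWith 1 ρ) (i : Fin 3) (R : ℝ) :
    ∃ C : ℝ, ∀ x y : R3, 0 < regNorm (ρ y) (x - y) → regNorm (ρ y) (x - y) ≤ R →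
      ‖thetaGradDeriv lam ρ i x y‖ ≤ C / regNorm (ρ y) (x - y) ^ 3 := by
  obtain ⟨C, hC, hslope⟩ := exists_norm_helmholtzSlope_le lam R
  obtain ⟨C', hC', hderiv⟩ := exists_norm_helmholtzSlopeDeriv_le lam R
  refine ⟨C + 2 * C', fun x y => ?_⟩
  set D := regNorm (ρ y) (x - y)
  intro hD hDR
  have hcoord : ‖(x - y) i‖ ≤ D := (PiLp.norm_apply_le _ i).trans (norm_le_regNorm _ _)
  have hofReal (T : R3 →L[ℝ] ℝ) : ‖Complex.ofRealCLM.comp T‖ ≤ ‖T‖ := by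
    simpa using Complex.ofRealCLM.opNorm_comp_le T
  have hproj : ‖(EuclideanSpace.proj i : R3 →L[ℝ] ℝ).comp (-ContinuousLinearMap.id ℝ R3)‖ ≤ 1 :=
    ContinuousLinearMap.opNorm_le_bound _ zero_le_one fun v => by
      simpa using PiLp.norm_apply_le v i
  have hinner : ‖(innerSL ℝ (x - y)).comp (-ContinuousLinearMap.id ℝ R3)‖ ≤ D :=
    (ContinuousLinearMap.opNorm_le_bound _ (norm_nonneg (x - y)) fun v => by
      simpa [inner_sub_left, abs_sub_comm] using abs_real_inner_le_norm (x - y) v).trans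
        (norm_le_regNorm _ _)
  have hgrad : ‖ρ y • fderiv ℝ ρ y‖ ≤ D := by
    rw [norm_smul]
    exact (mul_le_of_le_one_right (norm_nonneg _)
      (by simpa using norm_fderiv_le_of_lipschitz ℝ hρ)).trans (abs_le_regNorm _ _)
  calc ‖thetaGradDeriv lam ρ i x y‖ ≤ C / D ^ 3 * 1 + D * (D⁻¹ * (C' / D ^ 4)) * (D + D) := by
        refine (norm_add_le _ _).trans ?_
        rw [norm_smul, norm_smul, norm_mul, norm_mul, norm_inv, Complex.norm_of_nonneg hD.le,
          Complex.norm_real]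
        gcongr
        exacts [hslope D hD hDR, (hofReal _).trans hproj, hderiv D hD hDR,
          (hofReal _).trans ((norm_add_le _ _).trans (add_le_add hinner hgrad))]
    _ = (C + 2 * C') / D ^ 3 := by field_simp; ring

lemma exists_lipschitzOnWith_helmholtzSlope {a : ℝ} (ha : 0 < a) (b : ℝ) :
    ∃ L : ℝ≥0, LipschitzOnWith L (helmholtzSlope lam) (Set.Icc a b) := by
  obtain ⟨C, hC, h⟩ := exists_norm_helmholtzSlopeDeriv_le lam b
  refine ⟨(C / a ^ 4).toNNReal, (convex_Icc a b).lipschitzOnWith_of_nnnorm_hasDerivWithin_le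
    (fun r hr => (hasDerivAt_helmholtzSlope lam (ha.trans_le hr.1).ne').hasDerivWithinAt)
    fun r hr => ?_⟩
  rw [← NNReal.coe_le_coe, coe_nnnorm, Real.coe_toNNReal _ (by positivity)]
  refine (h r (ha.trans_le hr.1) hr.2).trans ?_
  gcongr
  exact hr.1

lemma exists_lipschitzOnWith_regThetaGrad (i : Fin 3) {a : ℝ} (ha : 0 < a) (b : ℝ) :
    ∃ L : ℝ≥0, LipschitzOnWith L (fun q : ℝ × R3 => regThetaGrad lam i q.1 q.2)
      {q | regNorm q.1 q.2 ∈ Set.Icc a b} := by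
  obtain ⟨L, hL⟩ := exists_lipschitzOnWith_helmholtzSlope lam ha b
  obtain ⟨M, hM⟩ := isCompact_Icc.exists_bound_of_continuousOn hL.continuousOn
  refine ⟨(b * (L * 2) + M).toNNReal, LipschitzOnWith.of_dist_le_mul ?_⟩
  rintro ⟨ε, z⟩ hz ⟨δ, w⟩ hw
  set s := helmholtzSlope lam (regNorm ε z)
  set t := helmholtzSlope lam (regNorm δ w)
  set r := dist (ε, z) (δ, w)
  have hsplit : regThetaGrad lam i ε z - regThetaGrad lam i δ w =
      (z i : ℂ) * (s - t) + ((z - w) i : ℂ) * t := by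
    simp only [regThetaGrad, PiLp.sub_apply]
    push_cast
    ring
  have hzb : ‖z i‖ ≤ b := (PiLp.norm_apply_le z i).trans ((norm_le_regNorm ε z).trans hz.2)
  have hzw : ‖z - w‖ ≤ r := (dist_eq_norm z w).symm.trans_le (le_max_right _ _)
  have hεδ : |ε - δ| ≤ r := le_max_left _ _
  have hst : ‖s - t‖ ≤ L * (2 * r) := by
    rw [← dist_eq_norm]
    refine (hL.dist_le_mul _ hz _ hw).trans ?_
    gcongr
    exact (abs_regNorm_sub_le ε z δ w).trans (by linarith)
  calc dist (regThetaGrad lam i ε z) (regThetaGrad lam i δ w)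
      ≤ ‖z i‖ * ‖s - t‖ + ‖(z - w) i‖ * ‖t‖ := by
        rw [dist_eq_norm, hsplit]
        refine (norm_add_le _ _).trans_eq ?_
        rw [norm_mul, norm_mul, Complex.norm_real, Complex.norm_real]
    _ ≤ b * (L * (2 * r)) + r * M := by
        gcongr
        exacts [(norm_nonneg _).trans hzb, (PiLp.norm_apply_le _ i).trans hzw, hM _ hw]
    _ = (b * (L * 2) + M) * r := by ring
    _ ≤ (b * (L * 2) + M).toNNReal * r := by gcongr; exact Real.le_coe_toNNReal _

end ThetaGrad

section LowerBound

variable {ρ : R3 → ℝ}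

lemma le_two_mul_regNorm (hρ : LipschitzWith 1 ρ) (x y : R3) :
    ρ x ≤ 2 * regNorm (ρ y) (x - y) := by
  have hxy : ρ x ≤ ρ y + dist x y := by simpa using hρ.le_add_mul x y
  rw [dist_eq_norm] at hxy
  linarith [norm_le_regNorm (ρ y) (x - y), (le_abs_self _).trans (abs_le_regNorm (ρ y) (x - y))]

lemma exists_pos_forall_le_regNorm (hρ : LipschitzWith 1 ρ) {K : Set R3} (hK : IsCompact K)
    (hρK : ∀ x ∈ K, 0 < ρ x) : ∃ a : ℝ, 0 < a ∧ ∀ x ∈ K, ∀ y, a ≤ regNorm (ρ y) (x - y) := by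
  obtain ⟨c, hc, hcK⟩ := hK.exists_forall_le' hρ.continuous.continuousOn hρK
  exact ⟨c / 2, half_pos hc, fun x hx y => by linarith [hcK x hx, le_two_mul_regNorm hρ x y]⟩

lemma exists_forall_regNorm_le (hρ : Continuous ρ) {s t : Set R3} (hs : Bornology.IsBounded s)
    (ht : Bornology.IsBounded t) : ∃ b : ℝ, ∀ x ∈ s, ∀ y ∈ t, regNorm (ρ y) (x - y) ≤ b := by
  have hcont : Continuous fun q : R3 × R3 => regNorm (ρ q.2) (q.1 - q.2) := by fun_prop
  obtain ⟨b, hb⟩ := (hs.isCompact_closure.prod ht.isCompact_closure).exists_bound_of_continuousOn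
    hcont.continuousOn
  exact ⟨b, fun x hx y hy => (le_abs_self _).trans
    (hb (x, y) ⟨subset_closure hx, subset_closure hy⟩)⟩

lemma exists_lipschitzOnWith_thetaGrad (lam : ℂ) (hρ : LipschitzWith 1 ρ) {K s : Set R3}
    (hK : IsCompact K) (hρK : ∀ x ∈ K, 0 < ρ x) (hs : Bornology.IsBounded s) (i : Fin 3) :
    ∃ L : ℝ≥0, ∀ x ∈ K, LipschitzOnWith L (thetaGrad lam ρ i x) s := by
  obtain ⟨a, ha, haK⟩ := exists_pos_forall_le_regNorm hρ hK hρK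
  obtain ⟨b, hb⟩ := exists_forall_regNorm_le hρ.continuous hK.isBounded hs
  obtain ⟨L, hL⟩ := exists_lipschitzOnWith_regThetaGrad lam i ha b
  refine ⟨L, fun x hx => ?_⟩
  have hpair : LipschitzWith 1 fun y => (ρ y, x - y) := by
    simpa only [max_self, IsometryEquiv.subLeft_apply] using
      hρ.prodMk (IsometryEquiv.subLeft x).isometry.lipschitz
  have hcomp := hL.comp hpair.lipschitzOnWith fun y hy => ⟨haK x hx y, hb x hx y hy⟩
  rwa [mul_one] at hcomp

end LowerBound

section LpKernels

variable (lam : ℂ) {Ω : Set R3} {p q : ℝ}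

lemma isLpKernel_of_norm_le_div_norm_sq (hΩ : MeasurableSet Ω) (hΩb : Bornology.IsBounded Ω)
    (hpq : p.HolderConjugate q) {K : R3 → R3 → ℂ} (hK : Measurable (Function.uncurry K)) {C : ℝ}
    (h : ∀ x ∈ Ω, ∀ y ∈ Ω, x ≠ y → ‖K x y‖ ≤ C / ‖x - y‖ ^ 2) :
    IsLpKernel p (volume.restrict Ω) fun x y => ‖K x y‖ₑ := by
  refine ((isLpKernel_inv_norm_sub_sq hΩb hpq).const_mul hpq.nonneg
    (ENNReal.ofReal_ne_top (r := C))).mono hpq.nonneg hK.enorm ?_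
  filter_upwards [ae_restrict_mem hΩ] with x hx
  filter_upwards [ae_restrict_mem hΩ, Measure.ae_ne _ x] with y hy hxy
  rw [← ofReal_norm, ← ENNReal.ofReal_mul' (by positivity), ← div_eq_mul_inv]
  exact ENNReal.ofReal_le_ofReal (h x hx y hy hxy.symm)

lemma measurable_helmholtzTheta_sub :
    Measurable (Function.uncurry fun x y : R3 => helmholtzTheta lam (x - y)) := by
  simp only [helmholtzTheta_eq]
  exact (measurable_regTheta lam 0).comp measurable_sub

lemma isLpKernel_helmholtzTheta_sub (hΩ : MeasurableSet Ω) (hΩb : Bornology.IsBounded Ω)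
    (hpq : p.HolderConjugate q) :
    IsLpKernel p (volume.restrict Ω) fun x y => ‖helmholtzTheta lam (x - y)‖ₑ := by
  obtain ⟨R, hR⟩ := exists_forall_regNorm_le (continuous_const (y := (0 : ℝ))) hΩb hΩb
  obtain ⟨C, hC⟩ := exists_norm_regTheta_le lam R
  simp only [helmholtzTheta_eq]
  exact isLpKernel_of_norm_le_div_norm_sq hΩ hΩb hpq
    ((measurable_regTheta lam 0).comp measurable_sub)
    fun x hx y hy hxy => hC 0 (x - y) (sub_ne_zero.2 hxy) (hR x hx y hy)

lemma isLpKernel_thetaGrad (hΩ : MeasurableSet Ω) (hΩb : Bornology.IsBounded Ω)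
    (hpq : p.HolderConjugate q) {ρ : R3 → ℝ} (hρ : Continuous ρ) (i : Fin 3) :
    IsLpKernel p (volume.restrict Ω) fun x y => ‖thetaGrad lam ρ i x y‖ₑ := by
  obtain ⟨R, hR⟩ := exists_forall_regNorm_le hρ hΩb hΩb
  obtain ⟨C, hC⟩ := exists_norm_regThetaGrad_le lam i R
  exact isLpKernel_of_norm_le_div_norm_sq hΩ hΩb hpq (measurable_thetaGrad lam hρ i)
    fun x hx y hy hxy => hC (ρ y) (x - y) (sub_ne_zero.2 hxy) (hR x hx y hy)

lemma IsBoundedLipschitzDomain.isLpKernel_thetaHess (hΩ : IsBoundedLipschitzDomain Ω)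
    (hpq : p.HolderConjugate q) (i j : Fin 3) :
    IsLpKernel p (volume.restrict Ω) fun x y =>
      ‖thetaHess lam (Metric.infDist · Ωᶜ) i j x y‖ₑ := by
  have hρ : LipschitzWith 1 (Metric.infDist · Ωᶜ) := Metric.lipschitz_infDist_pt Ωᶜ
  obtain ⟨R, hR⟩ := exists_forall_regNorm_le hρ.continuous hΩ.isBounded hΩ.isBounded
  obtain ⟨C, hC⟩ := exists_norm_thetaGradDeriv_le lam hρ i R
  refine ((hΩ.isLpKernel_boundaryKernel hpq).const_mul hpq.nonneg
    (ENNReal.ofReal_ne_top (r := C))).mono hpq.nonneg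
    (measurable_thetaHess lam hρ.continuous i j).enorm ?_
  have hmem := ae_restrict_mem (μ := volume) hΩ.isOpen.measurableSet
  filter_upwards [hmem] with x hx
  filter_upwards [hmem, Measure.ae_ne _ x] with y hy hxy
  have hpos : 0 < regNorm (Metric.infDist y Ωᶜ) (x - y) :=
    regNorm_pos_of_ne_zero_right _ (sub_ne_zero.2 hxy.symm)
  rw [boundaryKernel, ← ofReal_norm, ← ENNReal.ofReal_mul' (by positivity), ← div_eq_mul_inv]
  refine ENNReal.ofReal_le_ofReal (le_trans ?_ (hC x y hpos (hR x hx y hy)))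
  simpa [thetaHess] using (thetaGradDeriv lam (Metric.infDist · Ωᶜ) i x y).le_opNorm
    (EuclideanSpace.single j (1 : ℝ))

end LpKernels

/-- The regularised potential `y ↦ ∫ φ(x) k_i(x, y) dx` with `k_i` the kernel `thetaGrad`; where
`ρ` vanishes it is the potential of `-∂_i φ`. -/
noncomputable def regPotential (lam : ℂ) (ρ : R3 → ℝ) (i : Fin 3) (φ : R3 → ℂ) (y : R3) : ℂ :=
  ∫ x, φ x * thetaGrad lam ρ i x y

section RegPotential

variable (lam : ℂ) {ρ : R3 → ℝ} {φ : R3 → ℂ}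

lemma regPotential_of_eq_zero (hφ : ContDiff ℝ 1 φ) (hφc : HasCompactSupport φ) (i : Fin 3) {y : R3}
    (hy : ρ y = 0) : regPotential lam ρ i φ y = -potential lam (fun x => grad3 φ x i) y := by
  simp only [regPotential, thetaGrad, potential_grad3 lam hφ hφc, neg_neg, hy]

lemma integrable_mul_thetaGrad (ρ : R3 → ℝ) (hφ : Continuous φ) (hφc : HasCompactSupport φ)
    (i : Fin 3) (y : R3) : Integrable fun x => φ x * thetaGrad lam ρ i x y :=
  integrable_mul_comp_sub (locallyIntegrable_regThetaGrad lam i (ρ y)) hφ hφc y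

lemma exists_lipschitzOnWith_mul_thetaGrad (hρ : LipschitzWith 1 ρ) (hφc : HasCompactSupport φ)
    (hφρ : ∀ x ∈ tsupport φ, 0 < ρ x) {s : Set R3} (hs : Bornology.IsBounded s) (i : Fin 3) :
    ∃ L : ℝ≥0, ∀ x, LipschitzOnWith (‖φ x‖₊ * L) (fun y => φ x * thetaGrad lam ρ i x y) s := by
  obtain ⟨L, hL⟩ := exists_lipschitzOnWith_thetaGrad lam hρ hφc hφρ hs i
  refine ⟨L, fun x => ?_⟩
  by_cases hx : x ∈ tsupport φ
  · exact (lipschitzWith_smul (φ x)).comp_lipschitzOnWith (hL x hx)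
  · simp [image_eq_zero_of_notMem_tsupport hx]

lemma exists_lipschitzOnWith_regPotential (hρ : LipschitzWith 1 ρ) (hφ : Continuous φ)
    (hφc : HasCompactSupport φ) (hφρ : ∀ x ∈ tsupport φ, 0 < ρ x) {s : Set R3}
    (hs : Bornology.IsBounded s) (i : Fin 3) :
    ∃ L : ℝ≥0, LipschitzOnWith L (regPotential lam ρ i φ) s := by
  obtain ⟨L, hL⟩ := exists_lipschitzOnWith_mul_thetaGrad lam hρ hφc hφρ hs i
  have hφi := (hφ.integrable_of_hasCompactSupport (μ := volume) hφc).norm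
  have hint := integrable_mul_thetaGrad lam ρ hφ hφc i
  refine ⟨((∫ x, ‖φ x‖) * L).toNNReal, LipschitzOnWith.of_dist_le_mul fun y hy z hz => ?_⟩
  rw [Real.coe_toNNReal _ (by positivity), dist_eq_norm, regPotential, regPotential,
    ← integral_sub (hint y) (hint z), ← integral_mul_const, ← integral_mul_const]
  refine norm_integral_le_of_norm_le ((hφi.mul_const _).mul_const _)
    (Eventually.of_forall fun x => ?_)
  simpa [dist_eq_norm] using (hL x).dist_le_mul y hy z hz

lemma hasFDerivAt_regPotential (hρ : LipschitzWith 1 ρ) (hφ : Continuous φ)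
    (hφc : HasCompactSupport φ) (hφρ : ∀ x ∈ tsupport φ, 0 < ρ x) (i : Fin 3) {y : R3}
    (hy : DifferentiableAt ℝ ρ y) :
    Integrable (fun x => φ x • thetaGradDeriv lam ρ i x y) ∧
      HasFDerivAt (regPotential lam ρ i φ) (∫ x, φ x • thetaGradDeriv lam ρ i x y) y := by
  obtain ⟨L, hL⟩ := exists_lipschitzOnWith_mul_thetaGrad lam hρ hφc hφρ
    (Metric.isBounded_ball (x := y) (r := 1)) i
  have hφi := (hφ.integrable_of_hasCompactSupport (μ := volume) hφc).norm
  refine hasFDerivAt_integral_of_dominated_loc_of_lip (𝕜 := ℝ) (bound := fun x => ‖φ x‖ * L)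
    (Metric.ball_mem_nhds y one_pos)
    (Eventually.of_forall fun z => (integrable_mul_thetaGrad lam ρ hφ hφc i z).1)
    (integrable_mul_thetaGrad lam ρ hφ hφc i y)
    (hφ.aestronglyMeasurable.smul ((measurable_thetaGradDeriv lam hρ.continuous i).comp
      measurable_prodMk_right).aestronglyMeasurable)
    (Eventually.of_forall fun x => ?_) (hφi.mul_const _) (Eventually.of_forall fun x => ?_)
  · convert! hL x
    ext
    simp
  · by_cases hx : x ∈ tsupport φ
    · have hpos : 0 < regNorm (ρ y) (x - y) := by
        linarith [hφρ x hx, le_two_mul_regNorm hρ x y]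
      exact (hasFDerivAt_thetaGrad lam i hy hpos).const_smul (φ x)
    · have hzero : φ x • thetaGradDeriv lam ρ i x y = 0 := by
        ext v
        simp [image_eq_zero_of_notMem_tsupport hx]
      rw [hzero]
      simpa [image_eq_zero_of_notMem_tsupport hx] using hasFDerivAt_const (𝕜 := ℝ) (0 : ℂ) y

lemma grad3_regPotential (hρ : LipschitzWith 1 ρ) (hφ : Continuous φ) (hφc : HasCompactSupport φ)
    (hφρ : ∀ x ∈ tsupport φ, 0 < ρ x) {y : R3} (hy : DifferentiableAt ℝ ρ y) (i j : Fin 3) :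
    grad3 (regPotential lam ρ i φ) y j = ∫ x, φ x * thetaHess lam ρ i j x y := by
  obtain ⟨hint, hderiv⟩ := hasFDerivAt_regPotential lam hρ hφ hφc hφρ i hy
  rw [grad3, hderiv.fderiv, ContinuousLinearMap.integral_apply hint]
  rfl

end RegPotential

section WeakDiv

variable {Ω : Set R3} {φ : R3 → ℂ}

lemma IsTestFunction.setIntegral_mul (hφ : IsTestFunction Ω φ) (f : R3 → ℂ) :
    ∫ x in Ω, φ x * f x = ∫ x, φ x * f x :=
  setIntegral_eq_integral_of_forall_compl_eq_zero fun x hx => by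
    rw [image_eq_zero_of_notMem_tsupport fun h => hx (hφ.2.2 h), zero_mul]

lemma HasWeakDiv.integral_potential {g : R3 → C3} {d : R3 → ℂ} (h : HasWeakDiv Ω g d)
    (hg : IntegrableOn g Ω) (hd : IntegrableOn d Ω) (hΩ : IsOpen Ω) (hΩb : Bornology.IsBounded Ω)
    (lam : ℂ) {ρ : R3 → ℝ} (hρ : LipschitzWith 1 ρ) (hρΩ : ∀ x ∈ Ω, 0 < ρ x)
    (hρ₀ : ∀ x ∈ frontier Ω, ρ x = 0) (hφ : IsTestFunction Ω φ) (i : Fin 3) :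
    ∫ y in Ω, (potential lam (fun x => grad3 φ x i) y + regPotential lam ρ i φ y) * d y =
      -∫ y in Ω, ∑ j, (potential lam (fun x => grad3 (fun x => grad3 φ x i) x j) y +
        ∫ x, φ x * thetaHess lam ρ i j x y) * g y j := by
  have hφ₁ : ContDiff ℝ 1 φ := hφ.1.of_le (by simp)
  have hφi : ContDiff ℝ 1 fun x => grad3 φ x i := (hφ.grad3 i).1.of_le (by simp)
  have hφρ : ∀ x ∈ tsupport φ, 0 < ρ x := fun x hx => hρΩ x (hφ.2.2 hx)
  have hpot := contDiff_potential lam (n := 1) hφi (hφ.grad3 i).2.1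
  obtain ⟨R, hR⟩ := hΩb.closure.subset_closedBall (0 : R3)
  obtain ⟨L, hL⟩ := hpot.contDiffOn.exists_lipschitzOnWith (by simp) (convex_closedBall (0 : R3) R)
    (isCompact_closedBall _ _)
  obtain ⟨L', hL'⟩ := exists_lipschitzOnWith_regPotential lam hρ hφ.1.continuous hφ.2.1 hφρ
    hΩb.closure i
  rw [h.integral_lipschitzOn hg hd hΩ hΩb ((hL.mono hR).add hL') fun y hy => by
    rw [regPotential_of_eq_zero lam hφ₁ hφ.2.1 i (hρ₀ y hy), add_neg_cancel]]
  congr 1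
  refine setIntegral_congr_ae hΩ.measurableSet ?_
  filter_upwards [hρ.ae_differentiableAt] with y hy _
  refine Finset.sum_congr rfl fun j _ => ?_
  rw [← grad3_regPotential lam hρ hφ.1.continuous hφ.2.1 hφρ hy i j,
    ← grad3_potential lam hφi (hφ.grad3 i).2.1,
    ← grad3_add (hpot.differentiable (by simp) y)
      (hasFDerivAt_regPotential lam hρ hφ.1.continuous hφ.2.1 hφρ i hy).2.differentiableAt]

end WeakDiv

/-! ### The gradient of the divergence of the volume potential -/

lemma locallyIntegrableOn_of_memLp {E : Type*} [NormedAddCommGroup E] {f : R3 → E} {Ω : Set R3}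
    {p : ℝ} (hf : MemLp f (ENNReal.ofReal p) (volume.restrict Ω)) (hp : 1 ≤ p) :
    LocallyIntegrableOn f Ω :=
  locallyIntegrableOn_of_locallyIntegrable_restrict (hf.locallyIntegrable (by simpa using hp))

lemma IsBoundedLipschitzDomain.isFiniteMeasure_restrict {Ω : Set R3}
    (hΩ : IsBoundedLipschitzDomain Ω) :
    IsFiniteMeasure (volume.restrict Ω) :=
  MeasureTheory.isFiniteMeasure_restrict.2 hΩ.isBounded.measure_lt_top.ne

/-- The gradient of the divergence of the potential `∫_Ω θ(· - y) g(y) dy`, where `d` is the weak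
divergence of `g` (see `integral_mul_gradDivPotential`). The second derivatives of `θ` are not
locally integrable, so that it is written with the kernels regularised by the distance to the
boundary, at the price of two terms involving `d`. -/
noncomputable def gradDivPotential (lam : ℂ) (Ω : Set R3) (g : R3 → C3) (d : R3 → ℂ) (x : R3) :
    C3 := fun i =>
  (∫ y in Ω, thetaGrad lam 0 i x y * d y) -
    (∫ y in Ω, thetaGrad lam (Metric.infDist · Ωᶜ) i x y * d y) -
    ∑ j, ∫ y in Ω, thetaHess lam (Metric.infDist · Ωᶜ) i j x y * g y j

section GradDiv

variable {Ω : Set R3} {p q : ℝ} {φ : R3 → ℂ}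

lemma IsTestFunction.integrableOn_smul (hφ : IsTestFunction Ω φ) {E : Type*}
    [NormedAddCommGroup E] [NormedSpace ℂ E] {f : R3 → E} (hf : LocallyIntegrableOn f Ω) :
    IntegrableOn (fun x => φ x • f x) Ω := by
  have hK := hf.integrableOn_compact_subset hφ.2.2 hφ.2.1.isCompact
  obtain ⟨M, hM⟩ := hφ.1.continuous.bounded_above_of_compact_support hφ.2.1
  have hsupp : IntegrableOn (fun x => φ x • f x) (tsupport φ) :=
    Integrable.bdd_smul hK M hφ.1.continuous.aestronglyMeasurable (Eventually.of_forall hM)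
  refine ((integrableOn_iff_integrable_of_support_subset fun x hx => ?_).1 hsupp).integrableOn
  exact subset_tsupport φ (Function.support_smul_subset_left φ f hx)

lemma IsTestFunction.integral_mul_integral [IsFiniteMeasure (volume.restrict Ω)]
    (hφ : IsTestFunction Ω φ) {K : R3 → R3 → ℂ}
    (hK : IsLpKernel p (volume.restrict Ω) fun x y => ‖K x y‖ₑ)
    (mK : Measurable (Function.uncurry K)) (hp : 1 ≤ p) {f : R3 → ℂ}
    (hf : MemLp f (ENNReal.ofReal p) (volume.restrict Ω)) :
    IntegrableOn (fun y => (∫ x, φ x * K x y) * f y) Ω ∧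
      ∫ x in Ω, φ x * ∫ y in Ω, K x y * f y = ∫ y in Ω, (∫ x, φ x * K x y) * f y := by
  obtain ⟨M, hM⟩ := hφ.1.continuous.bounded_above_of_compact_support hφ.2.1
  simpa only [hφ.setIntegral_mul, IntegrableOn] using
    hK.integral_mul_integral mK hp hf hφ.1.continuous.aestronglyMeasurable hM

/-- The pairing over `Ω` of the potential of `χ` with the `j`-th component of `g`. The transforms
of `g` are compared by expressing their distributions through these pairings. -/
noncomputable def potentialPairing (lam : ℂ) (Ω : Set R3) (g : R3 → C3) (χ : R3 → ℂ)
    (j : Fin 3) : ℂ :=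
  ∫ y in Ω, potential lam χ y * g y j

variable {g : R3 → C3} {d : R3 → ℂ} (lam : ℂ)

lemma IsTestFunction.integrableOn_potential_mul (hφ : IsTestFunction Ω φ)
    (hΩ : Bornology.IsBounded Ω) (hΩm : MeasurableSet Ω) (hg : IntegrableOn g Ω) (j : Fin 3) :
    IntegrableOn (fun y => potential lam φ y * g y j) Ω :=
  IntegrableOn.continuousOn_mul_of_subset
    (contDiff_potential lam (n := 0) (hφ.1.of_le (by simp)) hφ.2.1).continuous.continuousOn
    (Integrable.eval hg j) hΩ.isCompact_closure hΩm subset_closure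

lemma memLp_gradDivPotential (hΩ : IsBoundedLipschitzDomain Ω) (hpq : p.HolderConjugate q)
    (hg : MemLp g (ENNReal.ofReal p) (volume.restrict Ω))
    (hd : MemLp d (ENNReal.ofReal p) (volume.restrict Ω)) :
    MemLp (gradDivPotential lam Ω g d) (ENNReal.ofReal p) (volume.restrict Ω) := by
  have hρ : Continuous (Metric.infDist · Ωᶜ) := Metric.continuous_infDist_pt Ωᶜ
  have hgrad {σ : R3 → ℝ} (hσ : Continuous σ) (i : Fin 3) :=
    (isLpKernel_thetaGrad lam hΩ.isOpen.measurableSet hΩ.isBounded hpq hσ i).memLp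
      (measurable_thetaGrad lam hσ i) hpq.pos hd
  exact MemLp.of_eval fun i => ((hgrad continuous_const i).sub (hgrad hρ i)).sub
    (memLp_finsetSum _ fun j _ => (hΩ.isLpKernel_thetaHess lam hpq i j).memLp
      (measurable_thetaHess lam hρ i j) hpq.pos (hg.eval j))

lemma integral_mul_gradDivPotential_eq_sub (hΩ : IsBoundedLipschitzDomain Ω)
    (hpq : p.HolderConjugate q) (hg : MemLp g (ENNReal.ofReal p) (volume.restrict Ω))
    (hd : MemLp d (ENNReal.ofReal p) (volume.restrict Ω)) (hφ : IsTestFunction Ω φ) (i : Fin 3) :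
    ∫ x in Ω, φ x * gradDivPotential lam Ω g d x i =
      -(∫ y in Ω, (potential lam (fun x => grad3 φ x i) y +
        regPotential lam (Metric.infDist · Ωᶜ) i φ y) * d y) -
      ∑ j, ∫ y in Ω, (∫ x, φ x * thetaHess lam (Metric.infDist · Ωᶜ) i j x y) * g y j := by
  have := hΩ.isFiniteMeasure_restrict
  have hρ : Continuous (Metric.infDist · Ωᶜ) := Metric.continuous_infDist_pt Ωᶜ
  have hgrad {σ : R3 → ℝ} (hσ : Continuous σ) :=
    isLpKernel_thetaGrad lam hΩ.isOpen.measurableSet hΩ.isBounded hpq hσ i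
  have hhess (j : Fin 3) := hΩ.isLpKernel_thetaHess lam hpq i j
  have mgrad {σ : R3 → ℝ} (hσ : Continuous σ) := measurable_thetaGrad lam hσ i
  have mhess (j : Fin 3) := measurable_thetaHess lam hρ i j
  have igrad {σ : R3 → ℝ} (hσ : Continuous σ) :=
    hφ.integrableOn_smul (locallyIntegrableOn_of_memLp
      ((hgrad hσ).memLp (mgrad hσ) hpq.pos hd) hpq.lt.le)
  have ihess (j : Fin 3) :=
    hφ.integrableOn_smul (locallyIntegrableOn_of_memLp
      ((hhess j).memLp (mhess j) hpq.pos (hg.eval j)) hpq.lt.le)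
  obtain ⟨i₀, h₀⟩ := hφ.integral_mul_integral (hgrad continuous_zero) (mgrad continuous_zero)
    hpq.lt.le hd
  obtain ⟨iρ, hρd⟩ := hφ.integral_mul_integral (hgrad hρ) (mgrad hρ) hpq.lt.le hd
  have hpot (y : R3) : potential lam (fun x => grad3 φ x i) y = -regPotential lam 0 i φ y := by
    rw [regPotential_of_eq_zero lam (hφ.1.of_le (by simp)) hφ.2.1 i rfl, neg_neg]
  simp only [gradDivPotential, mul_sub, Finset.mul_sum]
  refine (integral_sub ((igrad continuous_zero).sub (igrad hρ))
    (integrable_finsetSum _ fun j _ => ihess j)).trans ?_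
  simp only [smul_eq_mul] at igrad ihess ⊢
  rw [integral_sub' (igrad continuous_zero) (igrad hρ), h₀, hρd, ← integral_sub i₀ iρ,
    integral_finsetSum _ fun j _ => ihess j, ← integral_neg]
  congr 1
  · congr 1 with y
    rw [hpot, regPotential, regPotential]
    ring
  · exact Finset.sum_congr rfl fun j _ =>
      (hφ.integral_mul_integral (hhess j) (mhess j) hpq.lt.le (hg.eval j)).2

lemma integral_mul_gradDivPotential (hΩ : IsBoundedLipschitzDomain Ω) (hpq : p.HolderConjugate q)
    (hg : MemLp g (ENNReal.ofReal p) (volume.restrict Ω))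
    (hd : MemLp d (ENNReal.ofReal p) (volume.restrict Ω)) (h : HasWeakDiv Ω g d)
    (hφ : IsTestFunction Ω φ) (i : Fin 3) :
    ∫ x in Ω, φ x * gradDivPotential lam Ω g d x i =
      ∑ j, potentialPairing lam Ω g (fun x => grad3 (fun x => grad3 φ x i) x j) j := by
  have := hΩ.isFiniteMeasure_restrict
  have hp : 1 ≤ ENNReal.ofReal p := by simpa using hpq.lt.le
  have hρ : LipschitzWith 1 (Metric.infDist · Ωᶜ) := Metric.lipschitz_infDist_pt Ωᶜ
  have hne : (Ωᶜ).Nonempty :=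
    Set.nonempty_compl.2 fun h => NormedSpace.unbounded_univ ℝ R3 (h ▸ hΩ.isBounded)
  have hpos : ∀ x ∈ Ω, 0 < Metric.infDist x Ωᶜ := fun x hx =>
    (hΩ.isOpen.isClosed_compl.notMem_iff_infDist_pos hne).1 (Set.notMem_compl_iff.2 hx)
  have hzero : ∀ x ∈ frontier Ω, Metric.infDist x Ωᶜ = 0 := fun x hx =>
    Metric.infDist_zero_of_mem (hΩ.isOpen.frontier_eq ▸ hx).2
  have ihess (j : Fin 3) := (hφ.integral_mul_integral (hΩ.isLpKernel_thetaHess lam hpq i j)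
    (measurable_thetaHess lam hρ.continuous i j) hpq.lt.le (hg.eval j)).1
  have ipot (j : Fin 3) :=
    ((hφ.grad3 i).grad3 j).integrableOn_potential_mul lam hΩ.isBounded hΩ.isOpen.measurableSet
      (hg.integrable hp) j
  rw [integral_mul_gradDivPotential_eq_sub lam hΩ hpq hg hd hφ,
    h.integral_potential (hg.integrable hp) (hd.integrable hp) hΩ.isOpen hΩ.isBounded lam hρ hpos
      hzero hφ, neg_neg]
  simp only [add_mul, Finset.sum_add_distrib]
  rw [integral_add (integrable_finsetSum _ fun j _ => ipot j)
    (integrable_finsetSum _ fun j _ => ihess j), integral_finsetSum _ fun j _ => ihess j,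
    add_sub_cancel_right, integral_finsetSum _ fun j _ => ipot j]
  rfl

end GradDiv

/-! ### Calculus of weak curls and divergences -/

lemma crossProduct_apply_cyclic (a b : C3) (k : Fin 3) :
    crossProduct a b k = a (k + 1) * b (k + 2) - a (k + 2) * b (k + 1) := by
  fin_cases k <;> simp [cross_apply]

section WeakCalculus

variable {Ω : Set R3} {u v u' v' : R3 → C3} {d d' : R3 → ℂ} {φ : R3 → ℂ}

lemma IsTestFunction.grad3_comm (hφ : IsTestFunction Ω φ) (i j : Fin 3) :
    (fun x => _root_.grad3 (fun x => _root_.grad3 φ x i) x j) =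
      fun x => _root_.grad3 (fun x => _root_.grad3 φ x j) x i :=
  funext fun x => grad3_grad3_comm (hφ.1.of_le (by norm_cast)) i j x

lemma IsTestFunction.integrableOn_mul_apply (hφ : IsTestFunction Ω φ)
    (hu : LocallyIntegrableOn u Ω) (k : Fin 3) : IntegrableOn (fun x => φ x * u x k) Ω :=
  Integrable.eval (hφ.integrableOn_smul hu) k

lemma IsTestFunction.integral_smul_apply (hφ : IsTestFunction Ω φ)
    (hu : LocallyIntegrableOn u Ω) (k : Fin 3) :
    (∫ x in Ω, φ x • u x) k = ∫ x in Ω, φ x * u x k :=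
  eval_integral (f := fun x => φ x • u x) (fun k => hφ.integrableOn_mul_apply hu k) k

lemma IsTestFunction.integral_crossProduct_apply (hφ : IsTestFunction Ω φ)
    (hu : LocallyIntegrableOn u Ω) (k : Fin 3) :
    (∫ x in Ω, crossProduct (_root_.grad3 φ x) (u x)) k =
      (∫ x in Ω, _root_.grad3 φ x (k + 1) * u x (k + 2)) -
        ∫ x in Ω, _root_.grad3 φ x (k + 2) * u x (k + 1) := by
  have hint (i j : Fin 3) := (hφ.grad3 i).integrableOn_mul_apply hu j
  rw [eval_integral]
  · simp_rw [crossProduct_apply_cyclic]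
    rw [integral_sub (hint _ _) (hint _ _)]
  · intro j
    simp_rw [crossProduct_apply_cyclic]
    exact (hint _ _).sub (hint _ _)

lemma hasWeakCurl_iff (hu : LocallyIntegrableOn u Ω) (hv : LocallyIntegrableOn v Ω) :
    HasWeakCurl Ω u v ↔ ∀ φ : R3 → ℂ, IsTestFunction Ω φ → ∀ k : Fin 3,
      ∫ x in Ω, φ x * v x k = (∫ x in Ω, grad3 φ x (k + 2) * u x (k + 1)) -
        ∫ x in Ω, grad3 φ x (k + 1) * u x (k + 2) := by
  simp only [HasWeakCurl, hu, hv, true_and]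
  refine forall₂_congr fun φ hφ => funext_iff.trans (forall_congr' fun k => ?_)
  rw [hφ.integral_smul_apply hv, Pi.neg_apply, hφ.integral_crossProduct_apply hu, neg_sub]

lemma HasWeakCurl.congr_ae (h : HasWeakCurl Ω u v) (huu' : u =ᵐ[volume.restrict Ω] u') :
    HasWeakCurl Ω u' v :=
  ⟨h.1.congr huu', h.2.1, fun φ hφ => by
    rw [h.2.2 φ hφ, integral_congr_ae (huu'.mono fun x hx => by rw [hx])]⟩

lemma HasWeakDiv.congr_ae (h : HasWeakDiv Ω u d) (huu' : u =ᵐ[volume.restrict Ω] u') :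
    HasWeakDiv Ω u' d :=
  ⟨h.1.congr huu', h.2.1, fun φ hφ => by
    rw [h.2.2 φ hφ, integral_congr_ae (huu'.mono fun x hx => by rw [hx])]⟩

lemma IsTestFunction.integral_mul_add_smul_apply (hφ : IsTestFunction Ω φ)
    (hu : LocallyIntegrableOn u Ω) (hv : LocallyIntegrableOn v Ω) (c : ℂ) (k : Fin 3) :
    ∫ x in Ω, φ x * (u + c • v) x k =
      (∫ x in Ω, φ x * u x k) + c * ∫ x in Ω, φ x * v x k := by
  rw [← integral_const_mul, ← integral_add (hφ.integrableOn_mul_apply hu k)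
    ((hφ.integrableOn_mul_apply hv k).const_mul c)]
  congr 1 with x
  simp only [Pi.add_apply, Pi.smul_apply, smul_eq_mul]
  ring

lemma HasWeakCurl.add_smul (h : HasWeakCurl Ω u v) (h' : HasWeakCurl Ω u' v') (c : ℂ) :
    HasWeakCurl Ω (u + c • u') (v + c • v') := by
  obtain ⟨hu, hv, -⟩ := id h
  obtain ⟨hu', hv', -⟩ := id h'
  rw [hasWeakCurl_iff (hu.add (hu'.smul c)) (hv.add (hv'.smul c))]
  intro φ hφ k
  rw [hφ.integral_mul_add_smul_apply hv hv', (hasWeakCurl_iff hu hv).1 h φ hφ k,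
    (hasWeakCurl_iff hu' hv').1 h' φ hφ k, (hφ.grad3 _).integral_mul_add_smul_apply hu hu',
    (hφ.grad3 _).integral_mul_add_smul_apply hu hu']
  ring

lemma HasWeakDiv.sub (h : HasWeakDiv Ω u d) (h' : HasWeakDiv Ω v d') :
    HasWeakDiv Ω (u - v) (d - d') := by
  refine ⟨h.1.sub h'.1, h.2.1.sub h'.2.1, fun φ hφ => ?_⟩
  have hint {f : R3 → C3} (hf : LocallyIntegrableOn f Ω) :
      IntegrableOn (fun x => ∑ i, grad3 φ x i * f x i) Ω :=
    integrable_finsetSum _ fun i _ => (hφ.grad3 i).integrableOn_mul_apply hf i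
  simp only [Pi.sub_apply, mul_sub, Finset.sum_sub_distrib]
  rw [integral_sub (f := fun x => φ x * d x) (g := fun x => φ x * d' x)
      (hφ.integrableOn_smul h.2.1) (hφ.integrableOn_smul h'.2.1),
    integral_sub (hint h.1) (hint h'.1), h.2.2 φ hφ, h'.2.2 φ hφ, neg_sub_neg, neg_sub]

lemma HasWeakDiv.const_smul (h : HasWeakDiv Ω u d) (c : ℂ) : HasWeakDiv Ω (c • u) (c • d) := by
  refine ⟨h.1.smul c, h.2.1.smul c, fun φ hφ => ?_⟩
  simp only [Pi.smul_apply, smul_eq_mul, mul_left_comm _ c, ← Finset.mul_sum]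
  rw [integral_const_mul, integral_const_mul, h.2.2 φ hφ, mul_neg]

lemma HasWeakCurl.hasWeakDiv_zero (h : HasWeakCurl Ω u v) : HasWeakDiv Ω v 0 := by
  refine ⟨h.2.1, locallyIntegrableOn_zero, fun φ hφ => ?_⟩
  have hcurl (i : Fin 3) := (hasWeakCurl_iff h.1 h.2.1).1 h _ (hφ.grad3 i) i
  have hcomm (i j : Fin 3) (x : R3) := congrFun (hφ.grad3_comm i j) x
  rw [integral_finsetSum _ fun i _ => (hφ.grad3 i).integrableOn_mul_apply h.2.1 i]
  simp_rw [hcurl]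
  simp [Fin.sum_univ_three, hcomm 1 0, hcomm 2 0, hcomm 2 1]
  ring

lemma HasWeakCurl.ae_eq (hΩ : IsOpen Ω) (hv : HasWeakCurl Ω u v) (hv' : HasWeakCurl Ω u v') :
    v =ᵐ[volume.restrict Ω] v' := by
  have key := hΩ.ae_eq_zero_of_integral_contDiff_smul_eq_zero (hv.2.1.sub hv'.2.1)
    fun ψ hψ hψc hψΩ => by
      have hsub : tsupport (fun x => (ψ x : ℂ)) ⊆ tsupport ψ :=
        closure_mono fun x hx h => hx (by simp [h])
      have hφ : IsTestFunction Ω fun x => (ψ x : ℂ) :=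
        ⟨Complex.ofRealCLM.contDiff.comp hψ, hψc.of_isClosed_subset (isClosed_tsupport _) hsub,
          hsub.trans hψΩ⟩
      have hzero : ∫ x in Ω, (ψ x : ℂ) • (v - v') x = 0 := by
        simp only [Pi.sub_apply, smul_sub]
        rw [integral_sub (hφ.integrableOn_smul hv.2.1) (hφ.integrableOn_smul hv'.2.1),
          hv.2.2 _ hφ, hv'.2.2 _ hφ, sub_self]
      rw [← hzero, setIntegral_eq_integral_of_forall_compl_eq_zero fun x hx => by
        rw [image_eq_zero_of_notMem_tsupport (f := fun x => (ψ x : ℂ)) fun h => hx (hφ.2.2 h),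
          zero_smul]]
      rfl
  filter_upwards [ae_restrict_of_ae key, ae_restrict_mem hΩ.measurableSet] with x hx hxΩ
  simpa [sub_eq_zero] using hx hxΩ

lemma HasWeakCurl.weakCurl (h : HasWeakCurl Ω u v) : HasWeakCurl Ω u (weakCurl Ω u) := by
  have hex : ∃ v, HasWeakCurl Ω u v := ⟨v, h⟩
  rw [_root_.weakCurl, dif_pos hex]
  exact hex.choose_spec

end WeakCalculus

/-! ### The Teodorescu transform -/

/-- The transform `T_{2,λ}[g]`, its components being written with scalar potentials. -/
noncomputable def teodorescuComponents (lam : ℂ) (Ω : Set R3) (g : R3 → C3) (x : R3) : C3 :=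
  fun k => lam * (∫ y in Ω, helmholtzTheta lam (x - y) * g y k) -
    ((∫ y in Ω, thetaGrad lam 0 (k + 1) x y * g y (k + 2)) -
      ∫ y in Ω, thetaGrad lam 0 (k + 2) x y * g y (k + 1))

section Teodorescu

variable {Ω : Set R3} {p q : ℝ} {g : R3 → C3} {d φ : R3 → ℂ} (lam : ℂ)

lemma teodorescuIntegrand_apply {x y : R3} (hxy : x ≠ y) (g : R3 → C3) (k : Fin 3) :
    teodorescuIntegrand lam g x y k = lam * (helmholtzTheta lam (x - y) * g y k) -
      (thetaGrad lam 0 (k + 1) x y * g y (k + 2) - thetaGrad lam 0 (k + 2) x y * g y (k + 1)) := by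
  simp only [teodorescuIntegrand, Pi.sub_apply, Pi.smul_apply, smul_eq_mul,
    crossProduct_apply_cyclic, grad3_helmholtzTheta lam (sub_ne_zero.2 hxy), thetaGrad,
    Pi.zero_apply]
  ring

lemma integrableOn_teodorescuIntegrand {x : R3}
    (hθ : ∀ k, IntegrableOn (fun y => helmholtzTheta lam (x - y) * g y k) Ω)
    (hgrad : ∀ i k, IntegrableOn (fun y => thetaGrad lam 0 i x y * g y k) Ω) :
    IntegrableOn (teodorescuIntegrand lam g x) Ω ∧
      teodorescuT2 lam Ω g x = teodorescuComponents lam Ω g x := by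
  have hae : ∀ᵐ y ∂(volume.restrict Ω), x ≠ y := by
    filter_upwards [ae_restrict_of_ae (Measure.ae_ne volume x)] with y hy using hy.symm
  have hcurl (k : Fin 3) : IntegrableOn (fun y => thetaGrad lam 0 (k + 1) x y * g y (k + 2) -
      thetaGrad lam 0 (k + 2) x y * g y (k + 1)) Ω := (hgrad _ _).sub (hgrad _ _)
  have hint (k : Fin 3) :
      Integrable (fun y => teodorescuIntegrand lam g x y k) (volume.restrict Ω) :=
    (((hθ k).const_mul lam).sub (hcurl k)).congr
      (hae.mono fun y hy => (teodorescuIntegrand_apply lam hy g k).symm)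
  refine ⟨Integrable.of_eval hint, ?_⟩
  ext k
  rw [teodorescuT2, eval_integral hint, teodorescuComponents,
    integral_congr_ae (hae.mono fun y hy => teodorescuIntegrand_apply lam hy g k),
    integral_sub ((hθ k).const_mul lam) (hcurl k), integral_const_mul,
    integral_sub (hgrad _ _) (hgrad _ _)]

variable (hΩ : IsBoundedLipschitzDomain Ω) (hpq : p.HolderConjugate q)
  (hg : MemLp g (ENNReal.ofReal p) (volume.restrict Ω))

include hΩ hpq hg

lemma ae_integrableOn_teodorescuIntegrand :
    ∀ᵐ x ∂(volume.restrict Ω), IntegrableOn (teodorescuIntegrand lam g x) Ω ∧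
      teodorescuT2 lam Ω g x = teodorescuComponents lam Ω g x := by
  have := hΩ.isFiniteMeasure_restrict
  have hΩm := hΩ.isOpen.measurableSet
  have hθ : ∀ᵐ x ∂(volume.restrict Ω),
      ∀ k, IntegrableOn (fun y => helmholtzTheta lam (x - y) * g y k) Ω :=
    eventually_all.2 fun k => (isLpKernel_helmholtzTheta_sub lam hΩm hΩ.isBounded hpq).ae_integrable
      (measurable_helmholtzTheta_sub lam) hpq.lt.le (hg.eval k)
  have hgrad : ∀ᵐ x ∂(volume.restrict Ω),
      ∀ i k, IntegrableOn (fun y => thetaGrad lam 0 i x y * g y k) Ω := by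
    refine eventually_all.2 fun i => eventually_all.2 fun k => ?_
    exact (isLpKernel_thetaGrad lam hΩm hΩ.isBounded hpq continuous_zero i).ae_integrable
      (measurable_thetaGrad lam continuous_zero i) hpq.lt.le (hg.eval k)
  filter_upwards [hθ, hgrad] with x hx hx' using integrableOn_teodorescuIntegrand lam hx hx'

lemma memLp_integral_helmholtzTheta_mul (k : Fin 3) :
    MemLp (fun x => ∫ y in Ω, helmholtzTheta lam (x - y) * g y k) (ENNReal.ofReal p)
      (volume.restrict Ω) :=
  (isLpKernel_helmholtzTheta_sub lam hΩ.isOpen.measurableSet hΩ.isBounded hpq).memLp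
    (measurable_helmholtzTheta_sub lam) hpq.pos (hg.eval k)

lemma memLp_integral_thetaGrad_mul (i k : Fin 3) :
    MemLp (fun x => ∫ y in Ω, thetaGrad lam 0 i x y * g y k) (ENNReal.ofReal p)
      (volume.restrict Ω) :=
  (isLpKernel_thetaGrad lam hΩ.isOpen.measurableSet hΩ.isBounded hpq continuous_zero i).memLp
    (measurable_thetaGrad lam continuous_zero i) hpq.pos (hg.eval k)

lemma memLp_teodorescuComponents :
    MemLp (teodorescuComponents lam Ω g) (ENNReal.ofReal p) (volume.restrict Ω) :=
  MemLp.of_eval fun k => ((memLp_integral_helmholtzTheta_mul lam hΩ hpq hg k).const_mul lam).sub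
    ((memLp_integral_thetaGrad_mul lam hΩ hpq hg _ _).sub
      (memLp_integral_thetaGrad_mul lam hΩ hpq hg _ _))

lemma integral_mul_integral_helmholtzTheta (hφ : IsTestFunction Ω φ) (k : Fin 3) :
    ∫ x in Ω, φ x * ∫ y in Ω, helmholtzTheta lam (x - y) * g y k =
      potentialPairing lam Ω g φ k := by
  have := hΩ.isFiniteMeasure_restrict
  exact (hφ.integral_mul_integral
    (isLpKernel_helmholtzTheta_sub lam hΩ.isOpen.measurableSet hΩ.isBounded hpq)
    (measurable_helmholtzTheta_sub lam) hpq.lt.le (hg.eval k)).2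

lemma integral_mul_integral_thetaGrad (hφ : IsTestFunction Ω φ) (i k : Fin 3) :
    ∫ x in Ω, φ x * ∫ y in Ω, thetaGrad lam 0 i x y * g y k =
      -potentialPairing lam Ω g (fun x => grad3 φ x i) k := by
  have := hΩ.isFiniteMeasure_restrict
  rw [(hφ.integral_mul_integral
    (isLpKernel_thetaGrad lam hΩ.isOpen.measurableSet hΩ.isBounded hpq continuous_zero i)
    (measurable_thetaGrad lam continuous_zero i) hpq.lt.le (hg.eval k)).2, potentialPairing,
    ← integral_neg]
  congr 1 with y
  rw [potential_grad3 lam (hφ.1.of_le (by simp)) hφ.2.1, neg_mul, neg_neg]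
  rfl

lemma integral_mul_teodorescuComponents (hφ : IsTestFunction Ω φ) (k : Fin 3) :
    ∫ x in Ω, φ x * teodorescuComponents lam Ω g x k =
      lam * potentialPairing lam Ω g φ k +
        (potentialPairing lam Ω g (fun x => grad3 φ x (k + 1)) (k + 2) -
          potentialPairing lam Ω g (fun x => grad3 φ x (k + 2)) (k + 1)) := by
  have hint {f : R3 → ℂ} (hf : MemLp f (ENNReal.ofReal p) (volume.restrict Ω)) :
      IntegrableOn (fun x => φ x * f x) Ω :=
    hφ.integrableOn_smul (locallyIntegrableOn_of_memLp hf hpq.lt.le)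
  have hθ := hint (memLp_integral_helmholtzTheta_mul lam hΩ hpq hg k)
  have hgrad (i k : Fin 3) := hint (memLp_integral_thetaGrad_mul lam hΩ hpq hg i k)
  simp only [teodorescuComponents, mul_sub, mul_left_comm _ lam]
  refine (integral_sub (hθ.const_mul lam) ((hgrad _ _).sub (hgrad _ _))).trans ?_
  rw [integral_const_mul,
    integral_sub' (hgrad _ _) (hgrad _ _), integral_mul_integral_helmholtzTheta lam hΩ hpq hg hφ,
    integral_mul_integral_thetaGrad lam hΩ hpq hg hφ,
    integral_mul_integral_thetaGrad lam hΩ hpq hg hφ]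
  ring

omit hpq hg

lemma integral_mul_apply_eq_potentialPairing (hg : IntegrableOn g Ω) (hφ : IsTestFunction Ω φ)
    (k : Fin 3) :
    ∫ x in Ω, φ x * g x k =
      ∑ i, potentialPairing lam Ω g (fun x => grad3 (fun x => grad3 φ x i) x i) k +
        lam ^ 2 * potentialPairing lam Ω g φ k := by
  have hpot {χ : R3 → ℂ} (hχ : IsTestFunction Ω χ) :=
    hχ.integrableOn_potential_mul lam hΩ.isBounded hΩ.isOpen.measurableSet hg k
  have hpot₂ (i : Fin 3) := hpot ((hφ.grad3 i).grad3 i)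
  simp only [potentialPairing]
  rw [← integral_finsetSum _ fun i _ => hpot₂ i, ← integral_const_mul, ← integral_add
    (integrable_finsetSum _ fun i _ => hpot₂ i) ((hpot hφ).const_mul _)]
  congr 1 with y
  rw [← sum_potential_grad3_grad3_add lam (hφ.1.of_le (by norm_cast)) hφ.2.1 y, add_mul,
    Finset.sum_mul, mul_assoc]

include hpq

lemma hasWeakCurl_teodorescuComponents (hg : MemLp g (ENNReal.ofReal p) (volume.restrict Ω))
    (hd : MemLp d (ENNReal.ofReal p) (volume.restrict Ω)) (h : HasWeakDiv Ω g d) :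
    HasWeakCurl Ω (teodorescuComponents lam Ω g)
      (g - lam • teodorescuComponents lam Ω g - gradDivPotential lam Ω g d) := by
  have := hΩ.isFiniteMeasure_restrict
  have hloc {f : R3 → C3} (hf : MemLp f (ENNReal.ofReal p) (volume.restrict Ω)) :
      LocallyIntegrableOn f Ω := locallyIntegrableOn_of_memLp hf hpq.lt.le
  have hT := hloc (memLp_teodorescuComponents lam hΩ hpq hg)
  have hF := hloc (memLp_gradDivPotential lam hΩ hpq hg hd)
  have hv : g - lam • teodorescuComponents lam Ω g - gradDivPotential lam Ω g d =
      g + (-lam) • teodorescuComponents lam Ω g + (-1 : ℂ) • gradDivPotential lam Ω g d := by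
    module
  have hgT := (hloc hg).add (hT.smul (-lam))
  rw [hv, hasWeakCurl_iff hT (hgT.add (hF.smul _))]
  intro φ hφ k
  rw [hφ.integral_mul_add_smul_apply hgT hF, hφ.integral_mul_add_smul_apply (hloc hg) hT,
    integral_mul_apply_eq_potentialPairing lam hΩ (hg.integrable (by simpa using hpq.lt.le)) hφ,
    integral_mul_teodorescuComponents lam hΩ hpq hg hφ,
    integral_mul_gradDivPotential lam hΩ hpq hg hd h hφ,
    integral_mul_teodorescuComponents lam hΩ hpq hg (hφ.grad3 _),
    integral_mul_teodorescuComponents lam hΩ hpq hg (hφ.grad3 _)]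
  fin_cases k <;>
    simp [Fin.sum_univ_three, hφ.grad3_comm 1 0, hφ.grad3_comm 2 0, hφ.grad3_comm 2 1] <;> ring

lemma hasWeakCurl_gradDivPotential (hg : MemLp g (ENNReal.ofReal p) (volume.restrict Ω))
    (hd : MemLp d (ENNReal.ofReal p) (volume.restrict Ω)) (h : HasWeakDiv Ω g d) :
    HasWeakCurl Ω (gradDivPotential lam Ω g d) 0 := by
  have hF := locallyIntegrableOn_of_memLp (memLp_gradDivPotential lam hΩ hpq hg hd) hpq.lt.le
  refine (hasWeakCurl_iff hF locallyIntegrableOn_zero).2 fun φ hφ k => ?_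
  rw [integral_mul_gradDivPotential lam hΩ hpq hg hd h (hφ.grad3 _),
    integral_mul_gradDivPotential lam hΩ hpq hg hd h (hφ.grad3 _), hφ.grad3_comm]
  simp

end Teodorescu

/-! ### The right inverse -/

lemma HasWeakCurl.rightInverseR_ae_eq {Ω : Set R3} {lam : ℂ} {g v : R3 → C3}
    (h : HasWeakCurl Ω (teodorescuT2 lam Ω g) v) (hΩ : IsOpen Ω) :
    rightInverseR lam Ω g =ᵐ[volume.restrict Ω] lam⁻¹ • (g - v) := by
  filter_upwards [h.weakCurl.ae_eq hΩ h] with x hx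
  rw [rightInverseR, hx, Pi.smul_apply, Pi.sub_apply]

section RightInverse

variable {Ω : Set R3} {p q : ℝ} {g : R3 → C3} {d : R3 → ℂ} (lam : ℂ)
  (hΩ : IsBoundedLipschitzDomain Ω) (hpq : p.HolderConjugate q)
  (hg : MemLp g (ENNReal.ofReal p) (volume.restrict Ω))
  (hd : MemLp d (ENNReal.ofReal p) (volume.restrict Ω)) (h : HasWeakDiv Ω g d)

include hΩ hpq hg hd h

lemma hasWeakCurl_teodorescuT2 : HasWeakCurl Ω (teodorescuT2 lam Ω g)
    (g - lam • teodorescuComponents lam Ω g - gradDivPotential lam Ω g d) :=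
  (hasWeakCurl_teodorescuComponents lam hΩ hpq hg hd h).congr_ae
    ((ae_integrableOn_teodorescuIntegrand lam hΩ hpq hg).mono fun _ hx => hx.2.symm)

lemma memWdiv_rightInverseR : MemWdiv (ENNReal.ofReal p) Ω (rightInverseR lam Ω g) := by
  have hcurl := hasWeakCurl_teodorescuT2 lam hΩ hpq hg hd h
  have hR := hcurl.rightInverseR_ae_eq hΩ.isOpen
  have hmem := (hg.sub ((memLp_teodorescuComponents lam hΩ hpq hg).const_smul lam)).sub
    (memLp_gradDivPotential lam hΩ hpq hg hd)
  exact ⟨((hg.sub hmem).const_smul lam⁻¹).ae_eq hR.symm, lam⁻¹ • (d - 0),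
    (hd.sub MemLp.zero).const_smul _,
    ((h.sub hcurl.hasWeakDiv_zero).const_smul _).congr_ae hR.symm⟩

variable {lam}

lemma rightInverseR_ae_eq_teodorescuComponents_add (hlam : lam ≠ 0) :
    rightInverseR lam Ω g =ᵐ[volume.restrict Ω]
      teodorescuComponents lam Ω g + lam⁻¹ • gradDivPotential lam Ω g d := by
  refine ((hasWeakCurl_teodorescuT2 lam hΩ hpq hg hd h).rightInverseR_ae_eq hΩ.isOpen).trans
    (EventuallyEq.of_eq ?_)
  rw [sub_sub, sub_sub_cancel, smul_add, inv_smul_smul₀ hlam]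

lemma hasWeakCurl_rightInverseR (hlam : lam ≠ 0) : HasWeakCurl Ω (rightInverseR lam Ω g)
    (g - lam • teodorescuComponents lam Ω g - gradDivPotential lam Ω g d) := by
  have hcurl := (hasWeakCurl_teodorescuComponents lam hΩ hpq hg hd h).add_smul
    (hasWeakCurl_gradDivPotential lam hΩ hpq hg hd h) lam⁻¹
  rw [smul_zero, add_zero] at hcurl
  exact hcurl.congr_ae
    (rightInverseR_ae_eq_teodorescuComponents_add hΩ hpq hg hd h hlam).symm

lemma weakCurl_rightInverseR_add_smul_ae_eq (hlam : lam ≠ 0) :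
    (fun x => weakCurl Ω (rightInverseR lam Ω g) x + lam • rightInverseR lam Ω g x)
      =ᵐ[volume.restrict Ω] g := by
  have hcurl := hasWeakCurl_rightInverseR hΩ hpq hg hd h hlam
  filter_upwards [hcurl.weakCurl.ae_eq hΩ.isOpen hcurl,
    (hasWeakCurl_teodorescuT2 lam hΩ hpq hg hd h).rightInverseR_ae_eq hΩ.isOpen] with x hx hRx
  rw [hx, hRx, Pi.smul_apply, smul_inv_smul₀ hlam, ← Pi.add_apply, add_sub_cancel]

end RightInverse

theorem mainTheorem2_general (Ω : Set R3) (hΩ : IsBoundedLipschitzDomain Ω) (lam : ℂ)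
    (hlam : lam ≠ 0) (p : ℝ≥0∞) (hp : 1 < p) (hp' : p < ⊤) (g : R3 → C3) (hg : MemWdiv p Ω g) :
    (∀ᵐ x ∂(volume.restrict Ω), IntegrableOn (teodorescuIntegrand lam g x) Ω) ∧
    HasWeakCurl Ω (teodorescuT2 lam Ω g) (weakCurl Ω (teodorescuT2 lam Ω g)) ∧
    MemWdiv p Ω (rightInverseR lam Ω g) ∧
    HasWeakCurl Ω (rightInverseR lam Ω g) (weakCurl Ω (rightInverseR lam Ω g)) ∧
    (fun x => weakCurl Ω (rightInverseR lam Ω g) x + lam • rightInverseR lam Ω g x)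
      =ᵐ[volume.restrict Ω] g := by
  obtain ⟨hg, d, hd, hdiv⟩ := hg
  obtain ⟨r, rfl⟩ : ∃ r : ℝ, p = ENNReal.ofReal r :=
    ⟨p.toReal, (ENNReal.ofReal_toReal hp'.ne).symm⟩
  have hr : r.HolderConjugate r.conjExponent :=
    Real.HolderConjugate.conjExponent (by simpa using hp)
  exact ⟨(ae_integrableOn_teodorescuIntegrand lam hΩ hr hg).mono fun _ hx => hx.1,
    (hasWeakCurl_teodorescuT2 lam hΩ hr hg hd hdiv).weakCurl,
    memWdiv_rightInverseR lam hΩ hr hg hd hdiv,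
    (hasWeakCurl_rightInverseR hΩ hr hg hd hdiv hlam).weakCurl,
    weakCurl_rightInverseR_add_smul_ae_eq hΩ hr hg hd hdiv hlam⟩

theorem mainTheorem2 (Ω : Set R3) (hΩ : IsBoundedLiapunovDomain Ω) (lam : ℂ) (hlam : lam ≠ 0)
    (p : ℝ≥0∞) (hp : 1 < p) (hp' : p < ⊤) (g : R3 → C3) (hg : MemWdiv p Ω g) :
    -- the integral that defines `T_{2,λ}[g]` converges, and `T_{2,λ}[g]` has a weak curl
    (∀ᵐ x ∂(volume.restrict Ω), IntegrableOn (teodorescuIntegrand lam g x) Ω) ∧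
    HasWeakCurl Ω (teodorescuT2 lam Ω g) (weakCurl Ω (teodorescuT2 lam Ω g)) ∧
    -- `R_λ` maps the space into itself, into the domain of the weak curl
    MemWdiv p Ω (rightInverseR lam Ω g) ∧
    HasWeakCurl Ω (rightInverseR lam Ω g) (weakCurl Ω (rightInverseR lam Ω g)) ∧
    -- `(curl + λ) R_λ g = g`
    (fun x => weakCurl Ω (rightInverseR lam Ω g) x + lam • rightInverseR lam Ω g x)
      =ᵐ[volume.restrict Ω] g :=
  mainTheorem2_general Ω hΩ.isBoundedLipschitzDomain lam hlam p hp hp' g hg
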